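/- Let $M>0$ and let $\Omega=S^2\times(0,\infty)$ be the spatial manifold of the negative-mass Schwarzschild spacetime, with metric $$ds^2=-\Big(1+\frac{2M}{r}\Big)dt^2+\Big(1+\frac{2M}{r}\Big)^{-1}dr^2+r^2\,d\Sigma^2,$$ where $d\Sigma^2$ is the metric of the unit sphere $S^2$, with surface measure $d\sigma$; in polar coordinates $x=r\theta$, $\Omega$ is identified with $\mathbb{R}^3\setminus\{0\}$. The wave equation on this spacetime reads $\partial_{tt}\phi+A\phi=0$ with $$A\varphi=-\Big(1+\frac{2M}{r}\Big)\frac{1}{r^2}\Big[\partial_r\Big(r^2\Big(1+\frac{2M}{r}\Big)\partial_r\varphi\Big)+\Delta_{S^2}\varphi\Big].$$ Regard $A$ as an operator with domain the smooth compactly supported functions $C_0^\infty(\Omega)$ in the complex Hilbert space $$H=L^2\Big(\Omega,\ \frac{r^2}{1+2M/r}\,dr\,d\sigma(\theta)\Big).$$ Let $\mathcal{E}$ be the energy space $$\mathcal{E}=\{\varphi\in H^1_{loc}(\Omega)\cap H:\ b(\varphi,\varphi)<\infty\},$$ $$b(\varphi,\varphi)=\int_\Omega\Big(1+\frac{2M}{r}\Big)|\partial_r\varphi|^2\,r^2\,dr\,d\sigma(\theta)+\int_\Omega|\nabla_\theta\varphi|^2\,r^2\,dr\,d\sigma(\theta),$$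 where derivatives are weak derivatives and $\nabla_\theta$ is the gradient along the sphere of radius $r$ (so that $r^2|\nabla_\theta\varphi|^2=|\nabla_{S^2}\varphi|^2$ is the squared length of the gradient on the unit sphere). Theorem. The operator $A$ is not essentially self-adjoint, that is, its closure in $H$ is not self-adjoint. However, $A$ has exactly one self-adjoint extension in $H$ whose domain is included in $\mathcal{E}$. -/

import Mathlib

open MeasureTheory Set
open scoped ContDiff ENNReal InnerProductSpace

noncomputable section

namespace NegSchwarzschild

/-!
The spatial manifold `S² × (0, ∞)` is described in polar coordinates: the point `(θ, r)` is the
point `x = r θ` of `Ω = ℝ³ ∖ {0}`, so that `r = ‖x‖`, `θ = x / ‖x‖`, and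
`r² dr dσ(θ)` is Lebesgue measure `dx`.
-/

/-- The Euclidean space `ℝ³`. -/
abbrev E3 : Type := EuclideanSpace ℝ (Fin 3)

/-- The spatial domain `Ω = ℝ³ ∖ {0} ≃ S² × (0, ∞)`. -/
def Om : Set E3 := {0}ᶜ

/-- The standard basis of `ℝ³`. -/
def bvec (i : Fin 3) : E3 := EuclideanSpace.single i 1

/-- The radial unit vector `θ = x / ‖x‖`. -/
def rhat (x : E3) : E3 := ‖x‖⁻¹ • x

/-- The orthogonal projection of `v` on the tangent plane at `x` of the sphere of radius `‖x‖`. -/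
def tanProj (x v : E3) : E3 := v - (⟪rhat x, v⟫_ℝ) • rhat x

/-- The function `1 + 2 M / r`. -/
def lapse (M : ℝ) (x : E3) : ℝ := 1 + 2 * M / ‖x‖

/-- The radial derivative `∂_r φ`. -/
def dRad (φ : E3 → ℂ) (x : E3) : ℂ := fderiv ℝ φ x (rhat x)

/-- The `i`-th Cartesian component of the tangential gradient of `φ` along the spheres centred
at the origin (for the metric induced by `ℝ³`). -/
def dTan (i : Fin 3) (φ : E3 → ℂ) (x : E3) : ℂ := fderiv ℝ φ x (tanProj x (bvec i))

/-- `Δ_{S²} φ`, where `Δ_{S²}` is the Laplace-Beltrami operator of the unit sphere acting in the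
variable `θ`: it is `r²` times the tangential divergence of the tangential gradient on the sphere
of radius `r`. -/
def sphLap (φ : E3 → ℂ) (x : E3) : ℂ := ((‖x‖ ^ 2 : ℝ) : ℂ) * ∑ i, dTan i (dTan i φ) x

/-- The differential expression
`A φ = -(1 + 2M/r) r⁻² [∂_r (r² (1 + 2M/r) ∂_r φ) + Δ_{S²} φ]`. -/
def waveExpr (M : ℝ) (φ : E3 → ℂ) (x : E3) : ℂ :=
  ((-(lapse M x * (‖x‖ ^ 2)⁻¹) : ℝ) : ℂ) *
    (dRad (fun y => ((‖y‖ ^ 2 * lapse M y : ℝ) : ℂ) * dRad φ y) x + sphLap φ x)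

/-- The space `C₀^∞(Ω)` of smooth complex functions with compact support in `Ω` (extended by `0`
at the origin). -/
def testFun : Submodule ℂ (E3 → ℂ) where
  carrier := {φ | ContDiff ℝ ∞ φ ∧ HasCompactSupport φ ∧ tsupport φ ⊆ Om}
  add_mem' := by
    rintro φ ψ ⟨h1, h2, h3⟩ ⟨k1, k2, k3⟩
    exact ⟨h1.add k1, h2.add k2, (tsupport_add φ ψ).trans (union_subset h3 k3)⟩
  zero_mem' := by
    refine ⟨contDiff_const, HasCompactSupport.zero, ?_⟩
    simp [tsupport]
  smul_mem' := by
    rintro c φ ⟨h1, h2, h3⟩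
    exact ⟨h1.const_smul c, h2.smul_left (f := fun _ => c),
      (tsupport_smul_subset_right (fun _ => c) φ).trans h3⟩

/-- A smooth derivation along a vector field that is smooth on `Ω` preserves `C₀^∞(Ω)`. -/
theorem fderiv_mem_testFun {φ : E3 → ℂ} (hφ : φ ∈ testFun) {X : E3 → E3}
    (hX : ∀ x ∈ Om, ContDiffAt ℝ ∞ X x) : (fun x => fderiv ℝ φ x (X x)) ∈ testFun := by
  obtain ⟨h1, h2, h3⟩ := hφ
  have hs : tsupport (fun x => fderiv ℝ φ x (X x)) ⊆ tsupport φ := by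
    refine closure_minimal (fun x hx => ?_) (isClosed_tsupport φ)
    by_contra hc
    apply hx
    have : fderiv ℝ φ x = 0 := by
      by_contra h
      exact hc (support_fderiv_subset ℝ h)
    simp [this]
  refine ⟨contDiff_iff_contDiffAt.2 fun x => ?_, ?_, hs.trans h3⟩
  · by_cases hx : x ∈ tsupport φ
    · have hd : ContDiffAt ℝ ∞ (fderiv ℝ φ) x :=
        (h1.fderiv_right (m := ∞) (by simp)).contDiffAt
      exact hd.clm_apply (hX x (h3 hx))
    · have hz : (fun x => fderiv ℝ φ x (X x)) =ᶠ[nhds x] fun _ => 0 :=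
        notMem_tsupport_iff_eventuallyEq.1 fun h => hx (hs h)
      exact contDiffAt_const.congr_of_eventuallyEq hz
  · exact h2.of_isClosed_subset (isClosed_tsupport _) hs

/-- Multiplication by a real function that is smooth on `Ω` preserves `C₀^∞(Ω)`. -/
theorem mul_mem_testFun {φ : E3 → ℂ} (hφ : φ ∈ testFun) {c : E3 → ℝ}
    (hc : ∀ x ∈ Om, ContDiffAt ℝ ∞ c x) : (fun x => (c x : ℂ) * φ x) ∈ testFun := by
  obtain ⟨h1, h2, h3⟩ := hφ
  have hs : tsupport (fun x => (c x : ℂ) * φ x) ⊆ tsupport φ :=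
    tsupport_mul_subset_right (f := fun x => (c x : ℂ)) (g := φ)
  refine ⟨contDiff_iff_contDiffAt.2 fun x => ?_, ?_, hs.trans h3⟩
  · by_cases hx : x ∈ tsupport φ
    · have hd : ContDiffAt ℝ ∞ (fun x => (c x : ℂ)) x :=
        Complex.ofRealCLM.contDiff.contDiffAt.comp x (hc x (h3 hx))
      exact hd.mul h1.contDiffAt
    · have hz : (fun x => (c x : ℂ) * φ x) =ᶠ[nhds x] fun _ => 0 :=
        notMem_tsupport_iff_eventuallyEq.1 fun h => hx (hs h)
      exact contDiffAt_const.congr_of_eventuallyEq hz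
  · exact h2.of_isClosed_subset (isClosed_tsupport _) hs

theorem contDiffAt_norm_Om {x : E3} (hx : x ∈ Om) : ContDiffAt ℝ ∞ (fun y : E3 => ‖y‖) x :=
  contDiffAt_norm ℝ hx

theorem contDiffAt_rhat {x : E3} (hx : x ∈ Om) : ContDiffAt ℝ ∞ rhat x :=
  ((contDiffAt_norm_Om hx).inv (norm_ne_zero_iff.2 hx)).smul contDiffAt_id

theorem contDiffAt_tanProj (v : E3) {x : E3} (hx : x ∈ Om) :
    ContDiffAt ℝ ∞ (fun y => tanProj y v) x :=
  contDiffAt_const.sub (((contDiffAt_rhat hx).inner ℝ contDiffAt_const).smul (contDiffAt_rhat hx))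

theorem contDiffAt_lapse (M : ℝ) {x : E3} (hx : x ∈ Om) : ContDiffAt ℝ ∞ (lapse M) x :=
  contDiffAt_const.add (contDiffAt_const.div (contDiffAt_norm_Om hx) (norm_ne_zero_iff.2 hx))

theorem dRad_mem {φ : E3 → ℂ} (hφ : φ ∈ testFun) : dRad φ ∈ testFun :=
  fderiv_mem_testFun hφ fun _ hx => contDiffAt_rhat hx

theorem dTan_mem (i : Fin 3) {φ : E3 → ℂ} (hφ : φ ∈ testFun) : dTan i φ ∈ testFun :=
  fderiv_mem_testFun hφ fun _ hx => contDiffAt_tanProj (bvec i) hx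

theorem radFlux_mem (M : ℝ) {φ : E3 → ℂ} (hφ : φ ∈ testFun) :
    (fun y => ((‖y‖ ^ 2 * lapse M y : ℝ) : ℂ) * dRad φ y) ∈ testFun :=
  mul_mem_testFun (c := fun y => ‖y‖ ^ 2 * lapse M y) (dRad_mem hφ) fun _ hx =>
    ((contDiffAt_norm_Om hx).pow 2).mul (contDiffAt_lapse M hx)

theorem waveExpr_mem (M : ℝ) {φ : E3 → ℂ} (hφ : φ ∈ testFun) : waveExpr M φ ∈ testFun := by
  have hsum : (fun x => ∑ i, dTan i (dTan i φ) x) ∈ testFun := by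
    have := testFun.sum_mem (t := Finset.univ) (f := fun i => dTan i (dTan i φ))
      fun i _ => dTan_mem i (dTan_mem i hφ)
    convert this using 1
    ext x
    simp
  have hsph : sphLap φ ∈ testFun :=
    mul_mem_testFun (c := fun x => ‖x‖ ^ 2) hsum fun _ hx => (contDiffAt_norm_Om hx).pow 2
  refine mul_mem_testFun (c := fun x => -(lapse M x * (‖x‖ ^ 2)⁻¹))
    (testFun.add_mem (dRad_mem (radFlux_mem M hφ)) hsph) fun x hx => ?_
  exact ((contDiffAt_lapse M hx).mul (((contDiffAt_norm_Om hx).pow 2).inv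
    (pow_ne_zero 2 (norm_ne_zero_iff.2 hx)))).neg

theorem differentiable_of_mem {φ : E3 → ℂ} (hφ : φ ∈ testFun) : Differentiable ℝ φ :=
  hφ.1.differentiable (by simp)

theorem dRad_add {φ ψ : E3 → ℂ} (hφ : φ ∈ testFun) (hψ : ψ ∈ testFun) :
    dRad (φ + ψ) = dRad φ + dRad ψ := by
  ext x
  simp [dRad, fderiv_add (differentiable_of_mem hφ x) (differentiable_of_mem hψ x)]

theorem dTan_add (i : Fin 3) {φ ψ : E3 → ℂ} (hφ : φ ∈ testFun) (hψ : ψ ∈ testFun) :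
    dTan i (φ + ψ) = dTan i φ + dTan i ψ := by
  ext x
  simp [dTan, fderiv_add (differentiable_of_mem hφ x) (differentiable_of_mem hψ x)]

theorem dRad_smul (c : ℂ) {φ : E3 → ℂ} (hφ : φ ∈ testFun) : dRad (c • φ) = c • dRad φ := by
  ext x
  simp [dRad, fderiv_const_smul (differentiable_of_mem hφ x) c]

theorem dTan_smul (i : Fin 3) (c : ℂ) {φ : E3 → ℂ} (hφ : φ ∈ testFun) :
    dTan i (c • φ) = c • dTan i φ := by
  ext x
  simp [dTan, fderiv_const_smul (differentiable_of_mem hφ x) c]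

/-- The operator `A` as a linear map of `C₀^∞(Ω)` into itself. -/
def waveTest (M : ℝ) : testFun →ₗ[ℂ] testFun where
  toFun φ := ⟨waveExpr M φ, waveExpr_mem M φ.2⟩
  map_add' φ ψ := by
    have hf : (fun y => ((‖y‖ ^ 2 * lapse M y : ℝ) : ℂ) * dRad ((φ : E3 → ℂ) + ψ) y) =
        (fun y => ((‖y‖ ^ 2 * lapse M y : ℝ) : ℂ) * dRad φ y) +
          fun y => ((‖y‖ ^ 2 * lapse M y : ℝ) : ℂ) * dRad ψ y := by
      rw [dRad_add φ.2 ψ.2]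
      ext y
      simp only [Pi.add_apply]
      ring
    ext x
    simp only [Submodule.coe_add, waveExpr, sphLap, Pi.add_apply]
    rw [hf, dRad_add (radFlux_mem M φ.2) (radFlux_mem M ψ.2)]
    simp only [dTan_add _ φ.2 ψ.2, dTan_add _ (dTan_mem _ φ.2) (dTan_mem _ ψ.2), Pi.add_apply,
      Finset.sum_add_distrib]
    ring
  map_smul' c φ := by
    have hf : (fun y => ((‖y‖ ^ 2 * lapse M y : ℝ) : ℂ) * dRad (c • (φ : E3 → ℂ)) y) =
        c • (fun y => ((‖y‖ ^ 2 * lapse M y : ℝ) : ℂ) * dRad φ y) := by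
      rw [dRad_smul c φ.2]
      ext y
      simp only [Pi.smul_apply, smul_eq_mul]
      ring
    ext x
    simp only [Submodule.coe_smul, waveExpr, sphLap, Pi.smul_apply, RingHom.id_apply]
    rw [hf, dRad_smul c (radFlux_mem M φ.2)]
    simp only [dTan_smul _ c φ.2, dTan_smul _ c (dTan_mem _ φ.2), Pi.smul_apply, smul_eq_mul,
      ← Finset.mul_sum]
    ring

/-- The measure `r² / (1 + 2M/r) dr dσ(θ) = (1 + 2M/r)⁻¹ dx` (the origin is a null set). -/
def hMeasure (M : ℝ) : Measure E3 :=
  (volume : Measure E3).withDensity fun x => ENNReal.ofReal (lapse M x)⁻¹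

/-- The Hilbert space `H = L²(Ω, r² / (1 + 2M/r) dr dσ)`. -/
abbrev H (M : ℝ) : Type := Lp ℂ 2 (hMeasure M)

theorem lapse_ge_one {M : ℝ} (hM : 0 < M) (x : E3) : 1 ≤ lapse M x := by
  have : 0 ≤ 2 * M / ‖x‖ := by positivity
  unfold lapse
  linarith

theorem hMeasure_le {M : ℝ} (hM : 0 < M) : hMeasure M ≤ volume := by
  calc hMeasure M ≤ (volume : Measure E3).withDensity 1 := by
        refine withDensity_mono (Filter.Eventually.of_forall fun x => ?_)
        simpa using inv_le_one_of_one_le₀ (lapse_ge_one hM x)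
    _ = volume := withDensity_one

theorem measurable_lapse (M : ℝ) : Measurable (lapse M) := by
  unfold lapse
  fun_prop

theorem testFun_memLp {M : ℝ} (hM : 0 < M) (φ : testFun) : MemLp (φ : E3 → ℂ) 2 (hMeasure M) :=
  (φ.2.1.continuous.memLp_of_hasCompactSupport φ.2.2.1).mono_measure (hMeasure_le hM)

/-- The inclusion of `C₀^∞(Ω)` in `H`. -/
def toH {M : ℝ} (hM : 0 < M) : testFun →ₗ[ℂ] H M where
  toFun φ := (testFun_memLp hM φ).toLp (φ : E3 → ℂ)
  map_add' φ ψ := MemLp.toLp_add (testFun_memLp hM φ) (testFun_memLp hM ψ)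
  map_smul' c φ := MemLp.toLp_const_smul c (testFun_memLp hM φ)

theorem toH_injective {M : ℝ} (hM : 0 < M) : Function.Injective (toH hM) := by
  intro φ ψ h
  have h1 : (φ : E3 → ℂ) =ᵐ[hMeasure M] ψ :=
    (MemLp.toLp_eq_toLp_iff (testFun_memLp hM φ) (testFun_memLp hM ψ)).1 h
  have h2 : (φ : E3 → ℂ) =ᵐ[volume] ψ := by
    have h3 := (ae_withDensity_iff (measurable_lapse M).inv.ennreal_ofReal).1 h1
    filter_upwards [h3] with x hx
    refine hx (ne_of_gt (ENNReal.ofReal_pos.2 (inv_pos.2 ?_)))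
    linarith [lapse_ge_one hM x]
  exact Subtype.ext (Measure.eq_of_ae_eq h2 φ.2.1.continuous ψ.2.1.continuous)

/-- The operator `A` on the Hilbert space `H`, with domain `C₀^∞(Ω)`. -/
def waveOp {M : ℝ} (hM : 0 < M) : H M →ₗ.[ℂ] H M where
  domain := LinearMap.range (toH hM)
  toFun := toH hM ∘ₗ waveTest M ∘ₗ
    (LinearEquiv.ofInjective (toH hM) (toH_injective hM)).symm.toLinearMap

/-- `G = (G₀, G₁, G₂)` is the weak gradient on `Ω` of the function `u`. -/
def HasWeakGrad (u : E3 → ℂ) (G : Fin 3 → E3 → ℂ) : Prop :=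
  LocallyIntegrableOn u Om ∧ ∀ i, LocallyIntegrableOn (G i) Om ∧
    ∀ η ∈ testFun, ∫ x, u x * fderiv ℝ η x (bvec i) = -∫ x, G i x * η x

/-- `f ∈ L²_loc(Ω)`. -/
def MemL2loc (f : E3 → ℂ) : Prop :=
  ∀ K ⊆ Om, IsCompact K → MemLp f 2 (volume.restrict K)

/-- The radial component `∂_r u` of a gradient field. -/
def radPart (G : Fin 3 → E3 → ℂ) (x : E3) : ℂ := ∑ i, (rhat x i : ℂ) * G i x

/-- The Cartesian components of the tangential part `∇_θ u` of a gradient field. -/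
def tanPart (G : Fin 3 → E3 → ℂ) (i : Fin 3) (x : E3) : ℂ := G i x - (rhat x i : ℂ) * radPart G x

/-- The energy
`b(u, u) = ∫ (1 + 2M/r) |∂_r u|² r² dr dσ + ∫ |∇_θ u|² r² dr dσ`
of a function with gradient field `G`. Here `∇_θ` is the gradient along the sphere of radius `r`,
so that `r² |∇_θ u|²` is the squared norm of the gradient on the unit sphere. -/
def energy (M : ℝ) (G : Fin 3 → E3 → ℂ) : ℝ≥0∞ :=
  ∫⁻ x, (ENNReal.ofReal (lapse M x) * ‖radPart G x‖ₑ ^ 2 + ∑ i, ‖tanPart G i x‖ₑ ^ 2)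

/-- The energy space `𝓔 = {u ∈ H¹_loc(Ω) ∩ H : b(u, u) < ∞}`. -/
def energySpace (M : ℝ) : Set (H M) :=
  {u | MemL2loc u ∧ ∃ G : Fin 3 → E3 → ℂ,
    HasWeakGrad u G ∧ (∀ i, MemL2loc (G i)) ∧ energy M G < ⊤}

/-- A densely defined symmetric operator is essentially self-adjoint if its closure is
self-adjoint. -/
def EssentiallySelfAdjoint {V : Type*} [NormedAddCommGroup V] [InnerProductSpace ℂ V]
    [CompleteSpace V] (T : V →ₗ.[ℂ] V) : Prop :=
  IsSelfAdjoint T.closure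

end NegSchwarzschild

end

open MeasureTheory Set
open scoped ContDiff ENNReal InnerProductSpace

noncomputable section

namespace NegSchwarzschild

/-! Write W = 1 + 2M/r and s = log W. On test functions W⁻¹Aφ = -div(W ∂_rφ θ + ∇_θφ), so the
pairing ⟪u, Aφ⟫ in H is the form b. Both halves of the theorem are governed by s, which runs from ∞
at r = 0 to 0 at r = ∞ and satisfies r²W ∂_r s = -2M. Hence the radial functions 1 and s are both
annihilated by A, and the radial energy equals 2M ∫ |∂_s u|² ds dσ.

Failure of essential self-adjointness: near r = 0 the weight of H is of order r³, so 1 and s are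
both square integrable there. Cut off at finite radius, they lie in the domain of the adjoint, and
their boundary form is a nonzero multiple of M (`integral_cutLog_mul_deriv_fluxStep`). A
self-adjoint closure would force it to vanish (`inner_eq_of_isSelfAdjoint_closure`).

Existence: the Friedrichs extension. If J is the map to H from the closure of the test functions in
the energy norm, T = J J* is bounded, symmetric and injective, and T⁻¹ - 1 is self-adjoint
(`isSelfAdjoint_invSubOne`). Elements of this closure have a weak gradient of finite energy.

Uniqueness: the closure is the whole energy space (`mkForm_mem_formDomain`). A self-adjoint
extension B with domain in the energy space then satisfies the weak equation that characterises the
Friedrichs extension, so B is contained in it, and self-adjoint operators are maximal. For the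
density, multiply u by cutoffs k_N(s) with |k_N'| ≤ C/s uniformly in N. The error is controlled by ∫
|u|² s⁻² ds dσ, which is finite by a Hardy inequality in s (`hardy`); the end s = 0 is absorbed by
the norm of H. What has compact support in Ω is then mollified. All limits are taken weakly, against
vectors orthogonal to the test functions. -/

/-- The `i`-th partial derivative. -/
def pd (i : Fin 3) (φ : E3 → ℂ) (x : E3) : ℂ := fderiv ℝ φ x (bvec i)

/-! ### Partial derivatives of test functions -/

theorem isOpen_Om : IsOpen Om := isOpen_compl_singleton

theorem ae_mem_Om : ∀ᵐ x : E3, x ∈ Om := by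
  simp [Om, ae_iff, measure_singleton]

theorem norm_pos_of_mem_Om {x : E3} (hx : x ∈ Om) : 0 < ‖x‖ := norm_pos_iff.2 hx

theorem pd_mem (i : Fin 3) {φ : E3 → ℂ} (hφ : φ ∈ testFun) : pd i φ ∈ testFun :=
  fderiv_mem_testFun hφ fun _ _ => contDiffAt_const

theorem eq_sum_bvec (v : E3) : v = ∑ i, v i • bvec i := by
  have := (EuclideanSpace.basisFun (Fin 3) ℝ).sum_repr v
  simpa [bvec] using this.symm

theorem fderiv_apply_eq_sum (φ : E3 → ℂ) (x v : E3) :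
    fderiv ℝ φ x v = ∑ i, (v i : ℂ) * pd i φ x := by
  conv_lhs => rw [eq_sum_bvec v]
  simp [pd]

theorem dRad_eq (φ : E3 → ℂ) (x : E3) : dRad φ x = radPart (fun i => pd i φ) x :=
  fderiv_apply_eq_sum φ x _

theorem inner_bvec (x : E3) (i : Fin 3) : ⟪x, bvec i⟫_ℝ = x i := by
  simp [bvec, EuclideanSpace.inner_single_right]

theorem dTan_eq (i : Fin 3) (φ : E3 → ℂ) (x : E3) :
    dTan i φ x = tanPart (fun i => pd i φ) i x := by
  rw [tanPart, ← dRad_eq]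
  simp only [dTan, tanProj, map_sub, map_smul, inner_bvec, pd, dRad, Complex.real_smul]

/-- Multiplication by a complex function that is smooth on `Ω` preserves `C₀^∞(Ω)`. -/
theorem smooth_mul_mem {φ : E3 → ℂ} (hφ : φ ∈ testFun) {c : E3 → ℂ}
    (hc : ∀ x ∈ Om, ContDiffAt ℝ ∞ c x) : (fun x => c x * φ x) ∈ testFun := by
  obtain ⟨h1, h2, h3⟩ := hφ
  have hs : tsupport (fun x => c x * φ x) ⊆ tsupport φ := tsupport_mul_subset_right
  refine ⟨contDiff_iff_contDiffAt.2 fun x => ?_, ?_, hs.trans h3⟩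
  · by_cases hx : x ∈ tsupport φ
    · exact (hc x (h3 hx)).mul h1.contDiffAt
    · exact contDiffAt_const.congr_of_eventuallyEq
        (notMem_tsupport_iff_eventuallyEq.1 fun h => hx (hs h))
  · exact h2.of_isClosed_subset (isClosed_tsupport _) hs

theorem conj_mem {φ : E3 → ℂ} (hφ : φ ∈ testFun) :
    (fun x => starRingEnd ℂ (φ x)) ∈ testFun := by
  obtain ⟨h1, h2, h3⟩ := hφ
  have hs : tsupport (fun x => starRingEnd ℂ (φ x)) ⊆ tsupport φ :=
    closure_mono fun x hx h => hx (by simp [h])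
  exact ⟨Complex.conjCLE.contDiff.comp h1, h2.of_isClosed_subset (isClosed_tsupport _) hs,
    hs.trans h3⟩

theorem pd_mul (i : Fin 3) {f g : E3 → ℂ} {x : E3} (hf : DifferentiableAt ℝ f x)
    (hg : DifferentiableAt ℝ g x) :
    pd i (fun y => f y * g y) x = pd i f x * g x + f x * pd i g x := by
  simp only [pd, fderiv_fun_mul hf hg]
  simp
  ring

theorem pd_conj (i : Fin 3) {f : E3 → ℂ} {x : E3} (hf : DifferentiableAt ℝ f x) :
    pd i (fun y => starRingEnd ℂ (f y)) x = starRingEnd ℂ (pd i f x) := by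
  have : HasFDerivAt (fun y => starRingEnd ℂ (f y))
      ((Complex.conjCLE : ℂ →L[ℝ] ℂ).comp (fderiv ℝ f x)) x :=
    (Complex.conjCLE : ℂ →L[ℝ] ℂ).hasFDerivAt.comp x hf.hasFDerivAt
  simp [pd, this.fderiv]

theorem testFun_integrable {φ : E3 → ℂ} (hφ : φ ∈ testFun) : Integrable φ :=
  hφ.1.continuous.integrable_of_hasCompactSupport hφ.2.1

theorem testFun_memLp_volume {φ : E3 → ℂ} (hφ : φ ∈ testFun) (p : ℝ≥0∞) : MemLp φ p :=
  hφ.1.continuous.memLp_of_hasCompactSupport hφ.2.1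

theorem integral_pd_eq_zero (i : Fin 3) {φ : E3 → ℂ} (hφ : φ ∈ testFun) :
    ∫ x, pd i φ x = 0 := by
  have := integral_mul_fderiv_eq_neg_fderiv_mul_of_integrable (μ := (volume : Measure E3))
    (f := fun _ : E3 => (1 : ℂ)) (g := φ) (v := bvec i) (by simp)
    (by simpa using! testFun_integrable (pd_mem i hφ)) (by simpa using testFun_integrable hφ)
    (fun x _ => differentiableAt_const _) (fun x _ => differentiable_of_mem hφ x)
  simpa [pd] using this

theorem testFun_bdd {φ : E3 → ℂ} (hφ : φ ∈ testFun) : ∃ C, ∀ x, ‖φ x‖ ≤ C :=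
  hφ.2.1.exists_bound_of_continuous hφ.1.continuous

/-! ### Locally square integrable functions -/

namespace MemL2loc

variable {f g : E3 → ℂ}

theorem add (hf : MemL2loc f) (hg : MemL2loc g) : MemL2loc fun x => f x + g x :=
  fun K hK hc => (hf K hK hc).add (hg K hK hc)

theorem sub (hf : MemL2loc f) (hg : MemL2loc g) : MemL2loc fun x => f x - g x :=
  fun K hK hc => (hf K hK hc).sub (hg K hK hc)

theorem sum {ι : Type*} {s : Finset ι} {F : ι → E3 → ℂ} (h : ∀ i ∈ s, MemL2loc (F i)) :
    MemL2loc fun x => ∑ i ∈ s, F i x :=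
  fun K hK hc => memLp_finsetSum s fun i hi => h i hi K hK hc

theorem conj (hf : MemL2loc f) : MemL2loc fun x => starRingEnd ℂ (f x) :=
  fun K hK hc => (hf K hK hc).star

theorem of_memLp (hf : MemLp f 2) : MemL2loc f := fun K _ _ => hf.restrict K

theorem mul_continuousOn (hf : MemL2loc f) {c : E3 → ℂ} (hc : ContinuousOn c Om) :
    MemL2loc fun x => c x * f x := by
  intro K hK hcK
  obtain ⟨C, hC⟩ := hcK.exists_bound_of_continuousOn (hc.mono hK)
  refine MemLp.of_le_mul (c := C) (hf K hK hcK) ?_ ?_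
  · exact ((hc.mono hK).aestronglyMeasurable hcK.measurableSet).mul (hf K hK hcK).1
  · refine ae_restrict_of_forall_mem hcK.measurableSet fun x hx => ?_
    rw [norm_mul]
    exact mul_le_mul_of_nonneg_right (hC x hx) (norm_nonneg _)

theorem of_continuousOn {c : E3 → ℂ} (hc : ContinuousOn c Om) : MemL2loc c := by
  intro K hK hcK
  have : IsFiniteMeasure (volume.restrict K : Measure E3) :=
    ⟨by simpa using hcK.measure_lt_top⟩
  obtain ⟨C, hC⟩ := hcK.exists_bound_of_continuousOn (hc.mono hK)
  exact MemLp.of_bound ((hc.mono hK).aestronglyMeasurable hcK.measurableSet) C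
    (ae_restrict_of_forall_mem hcK.measurableSet hC)

theorem memLp_mul (hf : MemL2loc f) {φ : E3 → ℂ} (hφ : φ ∈ testFun) :
    MemLp (fun x => f x * φ x) 2 := by
  have h1 : MemLp ((tsupport φ).indicator f) 2 :=
    (memLp_indicator_iff_restrict (isClosed_tsupport φ).measurableSet).2
      (hf _ hφ.2.2 hφ.2.1)
  obtain ⟨C, hC⟩ := testFun_bdd hφ
  have h2 : MemLp (fun x => (tsupport φ).indicator f x * φ x) 2 := by
    refine MemLp.of_le_mul (c := C) h1
      (h1.1.mul hφ.1.continuous.aestronglyMeasurable) (.of_forall fun x => ?_)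
    rw [norm_mul, mul_comm]
    exact mul_le_mul_of_nonneg_right (hC x) (norm_nonneg _)
  convert h2 using 2 with x
  by_cases hx : x ∈ tsupport φ
  · simp [hx]
  · simp [image_eq_zero_of_notMem_tsupport hx]

/-- Cauchy-Schwarz on the support of φ, a compact subset of Ω on which both factors are square
integrable. -/
theorem integrable_mul_mul (hf : MemL2loc f) (hg : MemL2loc g) {φ : E3 → ℂ} (hφ : φ ∈ testFun) :
    Integrable fun x => f x * (g x * φ x) := by
  have h1 : MemLp ((tsupport φ).indicator f) 2 :=
    (memLp_indicator_iff_restrict (isClosed_tsupport φ).measurableSet).2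
      (hf _ hφ.2.2 hφ.2.1)
  have h2 := h1.integrable_mul (hg.memLp_mul hφ)
  refine h2.congr (.of_forall fun x => ?_)
  by_cases hx : x ∈ tsupport φ
  · simp [hx]
  · simp [image_eq_zero_of_notMem_tsupport hx]

theorem integrable_mul (hf : MemL2loc f) {φ : E3 → ℂ} (hφ : φ ∈ testFun) :
    Integrable fun x => f x * φ x := by
  simpa using (of_continuousOn (c := fun _ => 1) continuousOn_const).integrable_mul_mul hf hφ

theorem locallyIntegrableOn (hf : MemL2loc f) : LocallyIntegrableOn f Om := by
  rw [locallyIntegrableOn_iff isOpen_Om.isLocallyClosed]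
  intro K hK hc
  have : IsFiniteMeasure (volume.restrict K : Measure E3) := ⟨by simpa using hc.measure_lt_top⟩
  exact (hf K hK hc).integrable (by norm_num)

end MemL2loc

/-! ### Mollification, and passage from test functions to H¹ functions -/

open Filter Topology Convolution

/-- Correlations of square integrable functions are continuous. -/
theorem continuous_integral_mul_translate {a f : E3 → ℂ} (ha : MemLp a 2) (hf : MemLp f 2) :
    Continuous fun z : E3 => ∫ x, a x * f (x + z) := by
  have hmp : ∀ z : E3, MeasurePreserving (ContinuousMap.addRight z)
      (volume : Measure E3) volume := fun z => measurePreserving_add_right volume z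
  have hac : MemLp (fun x => starRingEnd ℂ (a x)) 2 := ha.star
  have h2 : Continuous fun z : E3 =>
      Lp.compMeasurePreserving (ContinuousMap.addRight z) (hmp z) (hf.toLp f) := by
    refine Continuous.compMeasurePreservingLp continuous_const ?_ hmp (by norm_num)
    exact ContinuousMap.curry ⟨fun p : E3 × E3 => p.2 + p.1, by fun_prop⟩ |>.continuous
  have h3 : Continuous fun z : E3 =>
      ⟪hac.toLp _, Lp.compMeasurePreserving (ContinuousMap.addRight z) (hmp z) (hf.toLp f)⟫_ℂ :=
    continuous_const.inner h2
  convert h3 using 2 with z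
  rw [L2.inner_def]
  refine integral_congr_ae ?_
  filter_upwards [hac.coeFn_toLp, Lp.coeFn_compMeasurePreserving (hf.toLp f) (hmp z),
    (hmp z).quasiMeasurePreserving.ae_eq_comp hf.coeFn_toLp] with x h1 h2 h3
  rw [h1, h2, h3]
  simp [mul_comm]

/-- The bilinear map used for convolving a complex function with a real kernel. -/
abbrev mollL : ℂ →L[ℝ] ℝ →L[ℝ] ℂ := (ContinuousLinearMap.lsmul ℝ ℝ).flip

/-- Mollification converges weakly in `L²`. -/
theorem tendsto_integral_mul_mollify {a f : E3 → ℂ} (ha : MemLp a 2) (hf : MemLp f 2)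
    (ha1 : Integrable a) (hf1 : Integrable f) {ρ : ℕ → ContDiffBump (0 : E3)}
    (hρ : Tendsto (fun n => (ρ n).rOut) atTop (𝓝 0)) :
    Tendsto (fun n => ∫ x, a x * (f ⋆[mollL] (ρ n).normed volume) x) atTop
      (𝓝 (∫ x, a x * f x)) := by
  -- Pairing a with the mollified f averages the correlation z ↦ ∫ a(x) f(x + z) dx against the
  -- kernel. The limit is its value at z = 0, so continuity of the correlation is all that is
  -- needed.
  have hC := continuous_integral_mul_translate ha hf
  have h := ContDiffBump.convolution_tendsto_right_of_continuous (μ := (volume : Measure E3)) hρ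
    (hC.comp continuous_neg) 0
  simp only [Function.comp_apply, neg_zero, add_zero] at h
  refine h.congr fun n => ?_
  set η := (ρ n).normed (volume : Measure E3) with hη
  have hηc : Continuous η := (ρ n).continuous_normed
  obtain ⟨C, hCb⟩ := (ρ n).hasCompactSupport_normed (μ := (volume : Measure E3))
    |>.exists_bound_of_continuous hηc
  have h1 : ∀ x, (f ⋆[mollL] η) x = ∫ z, η z • f (x + z) := by
    intro x
    rw [convolution_def, ← integral_add_left_eq_self _ x]
    refine integral_congr_ae (.of_forall fun z => ?_)
    simp [hη, (ρ n).normed_neg]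
  have h2 : Integrable (Function.uncurry fun x z : E3 => η z • (a x * f (x + z)))
      (volume.prod volume) := by
    have h3 : Integrable (fun p : E3 × E3 => (η (p.2 - p.1) : ℂ) * (a p.1 * f p.2))
        (volume.prod volume) := by
      refine (ha1.mul_prod hf1).bdd_mul (c := C) ?_ (.of_forall fun p => ?_)
      · exact (Complex.continuous_ofReal.comp
          (hηc.comp (continuous_snd.sub continuous_fst))).aestronglyMeasurable
      · simpa using hCb (p.2 - p.1)
    -- The shear (x, z) ↦ (x, x + z) preserves the product measure and turns a bounded kernel times
    -- a ⊗ f into the integrand needed for Fubini.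
    have h4 := (measurePreserving_prod_add (volume : Measure E3) volume).integrable_comp_of_integrable h3
    refine h4.congr (.of_forall fun p => ?_)
    simp [Function.uncurry]
  calc (η ⋆[ContinuousLinearMap.lsmul ℝ ℝ] fun y => ∫ x, a x * f (x + -y)) 0
      = ∫ z, η z • ∫ x, a x * f (x + z) := by simp [convolution_def]
    _ = ∫ z, ∫ x, η z • (a x * f (x + z)) := by simp_rw [integral_smul]
    _ = ∫ x, ∫ z, η z • (a x * f (x + z)) := (integral_integral_swap h2).symm
    _ = ∫ x, a x * (f ⋆[mollL] η) x := by
      refine integral_congr_ae (.of_forall fun x => ?_)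
      simp only [h1, ← integral_const_mul]
      refine integral_congr_ae (.of_forall fun z => ?_)
      simp only [Complex.real_smul]
      ring

/-- The mollification of a function with compact support in `Ω`. -/
theorem mollify_support {f : E3 → ℂ} {K : Set E3} (hfK : ∀ x ∉ K, f x = 0) {δ : ℝ}
    (η : ContDiffBump (0 : E3)) (hη : η.rOut ≤ δ) {x : E3} (hx : x ∉ Metric.cthickening δ K) :
    (f ⋆[mollL] η.normed volume) x = 0 := by
  rw [convolution_def]
  refine integral_eq_zero_of_ae (.of_forall fun t => ?_)
  by_cases ht : t ∈ K
  · have h1 : x - t ∉ Function.support (η.normed (volume : Measure E3)) := by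
      rw [η.support_normed_eq]
      intro h
      refine hx (Metric.mem_cthickening_of_dist_le x t δ K ht ?_)
      rw [mem_ball_zero_iff] at h
      rw [dist_eq_norm]
      linarith
    simp [Function.notMem_support.1 h1]
  · simp [hfK t ht]

theorem mollify_mem {f : E3 → ℂ} (hf : LocallyIntegrable f) {K : Set E3} (hK : IsCompact K)
    (hfK : ∀ x ∉ K, f x = 0) {δ : ℝ} (hδ : Metric.cthickening δ K ⊆ Om)
    (η : ContDiffBump (0 : E3)) (hη : η.rOut ≤ δ) :
    (f ⋆[mollL] η.normed volume) ∈ testFun := by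
  have hs : tsupport (f ⋆[mollL] η.normed volume) ⊆ Metric.cthickening δ K := by
    refine closure_minimal (fun x hx => ?_) Metric.isClosed_cthickening
    by_contra h
    exact hx (mollify_support hfK η hη h)
  exact ⟨η.hasCompactSupport_normed.contDiff_convolution_right _ hf η.contDiff_normed,
    hK.cthickening.of_isClosed_subset (isClosed_tsupport _) hs, hs.trans hδ⟩

/-- The weak derivative is tested against t ↦ η(x - t), whose support need not lie in Ω. Hence `hF`
is required for all smooth functions, which is available once f has compact support in Ω. -/
theorem pd_mollify {f F : E3 → ℂ} (hf : LocallyIntegrable f) (i : Fin 3)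
    (hF : ∀ η : E3 → ℂ, ContDiff ℝ ∞ η → ∫ x, f x * pd i η x = -∫ x, F x * η x)
    (η : ContDiffBump (0 : E3)) (x : E3) :
    pd i (f ⋆[mollL] η.normed volume) x = (F ⋆[mollL] η.normed volume) x := by
  have hη : ContDiff ℝ ∞ (η.normed (volume : Measure E3)) := η.contDiff_normed
  have h1 := η.hasCompactSupport_normed.hasFDerivAt_convolution_right mollL hf
    (hη.of_le (by simp)) x
  have hd : Continuous (fderiv ℝ (η.normed (volume : Measure E3))) :=
    hη.continuous_fderiv (by simp)
  rw [pd, h1.fderiv, convolution_precompR_apply mollL hf (η.hasCompactSupport_normed.fderiv ℝ) hd]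
  simp only [convolution_def]
  have hr : ContDiff ℝ ∞ fun t : E3 => ((η.normed (volume : Measure E3) (x - t) : ℝ) : ℂ) :=
    Complex.ofRealCLM.contDiff.comp (hη.comp (contDiff_const.sub contDiff_id))
  have h2 := hF _ hr
  have h3 : ∀ t, pd i (fun t : E3 => ((η.normed (volume : Measure E3) (x - t) : ℝ) : ℂ)) t
      = -((fderiv ℝ (η.normed (volume : Measure E3)) (x - t) (bvec i) : ℝ) : ℂ) := by
    intro t
    have h4 : HasFDerivAt (fun t : E3 => x - t) (-ContinuousLinearMap.id ℝ E3) t := by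
      simpa using (hasFDerivAt_id t).const_sub x
    have h5 := Complex.ofRealCLM.hasFDerivAt.comp t
      (((hη.differentiable (by simp)) (x - t)).hasFDerivAt.comp t h4)
    rw [pd]
    erw [h5.fderiv]
    simp
  simp only [h3, mul_neg, integral_neg, neg_inj] at h2
  simpa [mul_comm] using h2

/-- If `∫ a φ + ∑ bᵢ ∂ᵢφ = 0` for all test functions, the identity extends to `H¹` functions with
compact support. -/
theorem integral_eq_zero_of_hasWeakGrad {a : E3 → ℂ} {b : Fin 3 → E3 → ℂ} (ha : MemL2loc a)
    (hb : ∀ i, MemL2loc (b i))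
    (h : ∀ φ ∈ testFun, ∫ x, (a x * φ x + ∑ i, b i x * pd i φ x) = 0)
    {u : E3 → ℂ} {G : Fin 3 → E3 → ℂ} (hu : MemL2loc u) (hG : ∀ i, MemL2loc (G i))
    (hw : HasWeakGrad u G) {χ : E3 → ℂ} (hχ : χ ∈ testFun) :
    ∫ x, (a x * (χ x * u x) + ∑ i, b i x * (χ x * G i x + u x * pd i χ x)) = 0 := by
  set K := tsupport χ with hK
  have hKc : IsCompact K := hχ.2.1
  set f : E3 → ℂ := fun x => χ x * u x with hf
  set F : Fin 3 → E3 → ℂ := fun i x => χ x * G i x + u x * pd i χ x with hF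
  have hχ0 : ∀ x ∉ K, χ x = 0 := fun x hx => image_eq_zero_of_notMem_tsupport hx
  have hχ1 : ∀ i, ∀ x ∉ K, pd i χ x = 0 := fun i x hx => by
    have : fderiv ℝ χ x = 0 := by
      by_contra h'
      exact hx (support_fderiv_subset ℝ h')
    simp [pd, this]
  have hfK : ∀ x ∉ K, f x = 0 := fun x hx => by simp [hf, hχ0 x hx]
  have hFK : ∀ i, ∀ x ∉ K, F i x = 0 := fun i x hx => by simp [hF, hχ0 x hx, hχ1 i x hx]
  have hf2 : MemLp f 2 := by simpa [hf, mul_comm] using hu.memLp_mul hχ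
  have hF2 : ∀ i, MemLp (F i) 2 := fun i =>
    (((hG i).memLp_mul hχ).add (hu.memLp_mul (pd_mem i hχ))).ae_eq
      (.of_forall fun x => by simp [hF, mul_comm])
  have hf1 : Integrable f := by simpa [hf, mul_comm] using hu.integrable_mul hχ
  have hF1 : ∀ i, Integrable (F i) := fun i =>
    (((hG i).integrable_mul hχ).add (hu.integrable_mul (pd_mem i hχ))).congr
      (.of_forall fun x => by simp [hF, mul_comm])
  -- F is the weak gradient of χ u on all of ℝ³: test the weak gradient of u against η χ, which lies
  -- in `testFun` for any smooth η.
  have hder : ∀ i, ∀ η : E3 → ℂ, ContDiff ℝ ∞ η → ∫ x, f x * pd i η x = -∫ x, F i x * η x := by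
    intro i η hη
    have hm : (fun x => η x * χ x) ∈ testFun := smooth_mul_mem hχ fun x _ => hη.contDiffAt
    have h1 := (hw.2 i).2 _ hm
    have h2 : ∀ x, fderiv ℝ (fun x => η x * χ x) x (bvec i) = pd i η x * χ x + η x * pd i χ x :=
      fun x => pd_mul i (hη.differentiable (by simp) x) (differentiable_of_mem hχ x)
    simp only [h2] at h1
    have hpη : ∀ x ∈ Om, ContDiffAt ℝ ∞ (pd i η) x := fun x _ =>
      ((hη.fderiv_right (m := ∞) (by simp)).clm_apply contDiff_const).contDiffAt
    have i1 : Integrable fun x => f x * pd i η x := by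
      refine (hu.integrable_mul (smooth_mul_mem hχ hpη)).congr (.of_forall fun x => ?_)
      simp only [hf]; ring
    have i2 : Integrable fun x => u x * (η x * pd i χ x) :=
      hu.integrable_mul (smooth_mul_mem (pd_mem i hχ) fun x _ => hη.contDiffAt)
    have i3 : Integrable fun x => G i x * (η x * χ x) := (hG i).integrable_mul hm
    have e1 : ∫ x, u x * (pd i η x * χ x + η x * pd i χ x)
        = (∫ x, f x * pd i η x) + ∫ x, u x * (η x * pd i χ x) := by
      rw [← integral_add i1 i2]
      refine integral_congr_ae (.of_forall fun x => ?_)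
      simp only [hf]; ring
    have e2 : ∫ x, F i x * η x
        = (∫ x, G i x * (η x * χ x)) + ∫ x, u x * (η x * pd i χ x) := by
      rw [← integral_add i3 i2]
      refine integral_congr_ae (.of_forall fun x => ?_)
      simp only [hF]; ring
    rw [e2, neg_add, ← h1, e1]
    ring
  obtain ⟨δ, hδ0, hδ⟩ := hKc.exists_cthickening_subset_open isOpen_Om hχ.2.2
  set K' := Metric.cthickening δ K with hK'
  have hK'c : IsCompact K' := hKc.cthickening
  have hKK' : K ⊆ K' := Metric.self_subset_cthickening K
  -- Kernels of radius δ/(n + 1) ≤ δ keep every mollification supported in K', inside Ω.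
  let ρ : ℕ → ContDiffBump (0 : E3) := fun n =>
    ⟨δ / (n + 1) / 2, δ / (n + 1), by positivity, by have : 0 < δ / (n + 1) := by positivity
                                                     linarith⟩
  have hρ : Tendsto (fun n => (ρ n).rOut) atTop (𝓝 0) := by
    have := (tendsto_const_div_atTop_nhds_zero_nat δ).comp (tendsto_add_atTop_nat 1)
    simpa [ρ, Function.comp_def] using this
  have hρδ : ∀ n, (ρ n).rOut ≤ δ := fun n => by
    simp only [ρ]
    exact div_le_self hδ0.le (by linarith [Nat.cast_nonneg (α := ℝ) n])
  have hfin : IsFiniteMeasure (volume.restrict K' : Measure E3) :=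
    ⟨by simpa using hK'c.measure_lt_top⟩
  have hind : ∀ {c : E3 → ℂ}, MemL2loc c → MemLp (K'.indicator c) 2 ∧ Integrable (K'.indicator c) := by
    intro c hc
    refine ⟨(memLp_indicator_iff_restrict hK'c.measurableSet).2 (hc _ hδ hK'c), ?_⟩
    exact (integrable_indicator_iff hK'c.measurableSet).2
      ((hc _ hδ hK'c).integrable (by norm_num))
  -- a and b are only locally square integrable on Ω. Cutting them off to K' changes none of these
  -- integrals and makes them globally L², as the weak limit requires.
  have key : ∀ n, (∫ x, K'.indicator a x * (f ⋆[mollL] (ρ n).normed volume) x)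
      + ∑ i, ∫ x, K'.indicator (b i) x * (F i ⋆[mollL] (ρ n).normed volume) x = 0 := by
    intro n
    have hm := mollify_mem hf1.locallyIntegrable hKc hfK hδ (ρ n) (hρδ n)
    have e := h _ hm
    have e0 : ∀ {c g : E3 → ℂ}, (∀ x ∉ K, g x = 0) → ∀ x,
        K'.indicator c x * (g ⋆[mollL] (ρ n).normed volume) x
          = c x * (g ⋆[mollL] (ρ n).normed volume) x := by
      intro c g hg x
      by_cases hx : x ∈ K'
      · simp [hx]
      · rw [mollify_support hg (ρ n) (hρδ n) hx]; simp
    have e1 : ∀ i x, pd i (f ⋆[mollL] (ρ n).normed volume) x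
        = (F i ⋆[mollL] (ρ n).normed volume) x := fun i x =>
      pd_mollify hf1.locallyIntegrable i (hder i) (ρ n) x
    have hm1 : ∀ i, (F i ⋆[mollL] (ρ n).normed volume) ∈ testFun := fun i =>
      mollify_mem (hF1 i).locallyIntegrable hKc (hFK i) hδ (ρ n) (hρδ n)
    rw [integral_add (ha.integrable_mul hm), integral_finsetSum] at e
    · simpa only [e0 hfK, e0 (hFK _), e1] using e
    · intro i _
      exact (hb i).integrable_mul (pd_mem i hm)
    · exact integrable_finsetSum _ fun i _ => (hb i).integrable_mul (pd_mem i hm)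
  have lim : Tendsto (fun n => (∫ x, K'.indicator a x * (f ⋆[mollL] (ρ n).normed volume) x)
      + ∑ i, ∫ x, K'.indicator (b i) x * (F i ⋆[mollL] (ρ n).normed volume) x) atTop
      (𝓝 ((∫ x, K'.indicator a x * f x) + ∑ i, ∫ x, K'.indicator (b i) x * F i x)) :=
    (tendsto_integral_mul_mollify (hind ha).1 hf2 (hind ha).2 hf1 hρ).add
      (tendsto_finsetSum _ fun i _ =>
        tendsto_integral_mul_mollify (hind (hb i)).1 (hF2 i) (hind (hb i)).2 (hF1 i) hρ)
  simp only [key] at lim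
  have e3 := tendsto_nhds_unique lim tendsto_const_nhds
  have e0 : ∀ {c g : E3 → ℂ}, (∀ x ∉ K, g x = 0) → ∀ x, K'.indicator c x * g x = c x * g x := by
    intro c g hg x
    by_cases hx : x ∈ K'
    · simp [hx]
    · simp [hg x fun h => hx (hKK' h)]
  rw [integral_add, integral_finsetSum]
  · have e4 : (∫ x, a x * f x) + ∑ i, ∫ x, b i x * F i x = 0 := by
      simpa only [e0 hfK, e0 (hFK _)] using e3
    exact e4
  · intro i _
    exact ((hind (hb i)).1.integrable_mul (hF2 i)).congr (.of_forall (e0 (hFK i)))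
  · exact ((hind ha).1.integrable_mul hf2).congr (.of_forall (e0 hfK))
  · exact integrable_finsetSum _ fun i _ =>
      ((hind (hb i)).1.integrable_mul (hF2 i)).congr (.of_forall (e0 (hFK i)))

/-! ### Self-adjoint operators defined by a closed form -/

section Abstract

variable {V W : Type*} [NormedAddCommGroup V] [InnerProductSpace ℂ V]
  [NormedAddCommGroup W] [InnerProductSpace ℂ W] [CompleteSpace W]

/-- The operator `T⁻¹ - 1` with domain the range of the injective operator `T`. -/
def invSubOne (T : V →L[ℂ] V) (hT : Function.Injective T) : V →ₗ.[ℂ] V where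
  domain := LinearMap.range (T : V →ₗ[ℂ] V)
  toFun := (LinearEquiv.ofInjective (T : V →ₗ[ℂ] V) hT).symm.toLinearMap -
    (LinearMap.range (T : V →ₗ[ℂ] V)).subtype

theorem invSubOne_apply (T : V →L[ℂ] V) (hT : Function.Injective T) (x : V)
    (y : (invSubOne T hT).domain) (h : (y : V) = T x) : invSubOne T hT y = x - T x := by
  have hy : y = LinearEquiv.ofInjective (T : V →ₗ[ℂ] V) hT x := Subtype.ext h
  subst hy
  change (LinearEquiv.ofInjective (T : V →ₗ[ℂ] V) hT).symm _ - T x = _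
  rw [LinearEquiv.symm_apply_apply]

variable [CompleteSpace V]

/-- Symmetry and injectivity give dense range. If y is in the domain of B*, then ⟪T(B*y + y), h⟫ =
⟪y, (B + 1)Th⟫ = ⟪y, h⟫ for every h, so y = T(B*y + y) already lies in the range of T. -/
theorem isSelfAdjoint_invSubOne (T : V →L[ℂ] V) (hT : Function.Injective T)
    (hs : ∀ x y, ⟪T x, y⟫_ℂ = ⟪x, T y⟫_ℂ) : IsSelfAdjoint (invSubOne T hT) := by
  set B := invSubOne T hT with hB
  have hdense : Dense (B.domain : Set V) := by
    rw [Submodule.dense_iff_topologicalClosure_eq_top, Submodule.topologicalClosure_eq_top_iff,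
      Submodule.eq_bot_iff]
    intro x hx
    apply hT
    rw [map_zero, ← inner_self_eq_zero (𝕜 := ℂ), ← hs]
    exact (Submodule.mem_orthogonal _ x).1 hx (T (T x)) ⟨T x, rfl⟩
  have hsym : B.IsFormalAdjoint B := by
    rintro ⟨_, x, rfl⟩ ⟨_, y, rfl⟩
    rw [invSubOne_apply T hT x _ rfl, invSubOne_apply T hT y _ rfl]
    simp only [ContinuousLinearMap.coe_coe, map_sub, inner_sub_left, inner_sub_right, hs]
  refine le_antisymm ?_ (hsym.le_adjoint hdense)
  have key : ∀ y : (B.adjoint).domain, (y : V) = T (B.adjoint y + y) := by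
    intro y
    refine ext_inner_right ℂ fun h => ?_
    have h1 := B.adjoint_isFormalAdjoint hdense y ⟨T h, h, rfl⟩
    rw [invSubOne_apply T hT h _ rfl] at h1
    rw [hs, inner_add_left, h1, inner_sub_right]
    ring
  refine ⟨fun y hy => ⟨_, (key ⟨y, hy⟩).symm⟩, fun y z hyz => ?_⟩
  change B.adjoint y = _
  rw [invSubOne_apply T hT (B.adjoint y + y) z (by rw [← hyz]; exact key y), ← key y]
  simp

theorem inner_comp_adjoint (J : W →L[ℂ] V) (x y : V) :
    ⟪(J ∘L J.adjoint) x, y⟫_ℂ = ⟪x, (J ∘L J.adjoint) y⟫_ℂ := by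
  simp only [ContinuousLinearMap.comp_apply]
  rw [← ContinuousLinearMap.adjoint_inner_right, ContinuousLinearMap.adjoint_inner_left]

/-- J J*x = 0 gives ‖J*x‖² = 0, so x is orthogonal to the range of J, which is dense. -/
theorem comp_adjoint_injective (J : W →L[ℂ] V) (hJ : DenseRange J) :
    Function.Injective (J ∘L J.adjoint) := by
  rw [injective_iff_map_eq_zero]
  intro x hx
  have h1 : J.adjoint x = 0 := by
    rw [← inner_self_eq_zero (𝕜 := ℂ), ContinuousLinearMap.adjoint_inner_left]
    rw [show J (J.adjoint x) = 0 from hx, inner_zero_right]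
  refine hJ.eq_zero_of_inner_left ℂ fun w => ?_
  rw [← ContinuousLinearMap.adjoint_inner_left, h1, inner_zero_left]

section FormOperator

variable {X : Type*} [NormedAddCommGroup X] [InnerProductSpace ℂ X]
  (P : X →L[ℂ] V) (S : Submodule ℂ X) [CompleteSpace S]

/-- The self-adjoint operator `B` with form domain `S`, mapped to `V` by `P`, and form
`⟪(B + 1) P z, P w⟫ = ⟪z, w⟫`. -/
def formOp (hd : DenseRange (P ∘L S.subtypeL)) : V →ₗ.[ℂ] V :=
  invSubOne ((P ∘L S.subtypeL) ∘L (P ∘L S.subtypeL).adjoint) (comp_adjoint_injective _ hd)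

theorem isSelfAdjoint_formOp (hd : DenseRange (P ∘L S.subtypeL)) : IsSelfAdjoint (formOp P S hd) :=
  isSelfAdjoint_invSubOne _ _ (inner_comp_adjoint _)

theorem exists_of_mem_formOp_domain (hd : DenseRange (P ∘L S.subtypeL)) {y : V}
    (hy : y ∈ (formOp P S hd).domain) : ∃ z ∈ S, P z = y := by
  obtain ⟨x, rfl⟩ := hy
  exact ⟨_, ((P ∘L S.subtypeL).adjoint x).2, rfl⟩

/-- The hypothesis says that the adjoint of P restricted to S sends f to z, so T f = P z and (T⁻¹ -
1) P z = f - P z. -/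
theorem formOp_apply (hd : DenseRange (P ∘L S.subtypeL)) {z : X} (hz : z ∈ S) {f : V}
    (h : ∀ w ∈ S, ⟪f, P w⟫_ℂ = ⟪z, w⟫_ℂ) :
    ∃ hy : P z ∈ (formOp P S hd).domain, formOp P S hd ⟨P z, hy⟩ = f - P z := by
  have h1 : (P ∘L S.subtypeL).adjoint f = ⟨z, hz⟩ := by
    refine ext_inner_right ℂ fun w => ?_
    rw [ContinuousLinearMap.adjoint_inner_left]
    exact h w w.2
  have h3 : ((P ∘L S.subtypeL) ∘L (P ∘L S.subtypeL).adjoint) f = P z := by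
    rw [ContinuousLinearMap.comp_apply, h1]; rfl
  exact ⟨⟨f, h3⟩, (invSubOne_apply _ _ f _ h3.symm).trans (congrArg (f - ·) h3)⟩

end FormOperator

/-- If the closure of `T` is self-adjoint, `T` admits no elements `u, v` in the domain of its
adjoint with nonvanishing boundary form. -/
theorem inner_eq_of_isSelfAdjoint_closure {T : V →ₗ.[ℂ] V} (hT : IsSelfAdjoint T.closure)
    {u v f g : V} (hu : ∀ x : T.domain, ⟪f, x⟫_ℂ = ⟪u, T x⟫_ℂ)
    (hv : ∀ x : T.domain, ⟪g, x⟫_ℂ = ⟪v, T x⟫_ℂ) : ⟪f, v⟫_ℂ = ⟪u, g⟫_ℂ := by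
  -- `LinearPMap.closure` returns `T` itself when `T` is not closable, so closability has to be
  -- derived: the self-adjoint `T.closure` is closed and extends `T`.
  have hcl : T.IsClosable := LinearPMap.IsClosable.leIsClosable hT.isClosed.isClosable T.le_closure
  have key : ∀ {u f : V}, (∀ x : T.domain, ⟪f, x⟫_ℂ = ⟪u, T x⟫_ℂ) →
      ∃ h : u ∈ T.closure.domain, T.closure ⟨u, h⟩ = f := by
    intro u f hu
    have h1 : ∀ p ∈ T.closure.graph, ⟪f, p.1⟫_ℂ = ⟪u, p.2⟫_ℂ := by
      rw [← hcl.graph_closure_eq_closure_graph]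
      intro p hp
      have hc : IsClosed {p : V × V | ⟪f, p.1⟫_ℂ = ⟪u, p.2⟫_ℂ} :=
        isClosed_eq (by fun_prop) (by fun_prop)
      refine closure_minimal (fun q hq => ?_) hc hp
      obtain ⟨y, hy1, hy2⟩ := (LinearPMap.mem_graph_iff T).1 hq
      simp only [mem_ofPred_eq, ← hy1, ← hy2, hu]
    have h2 : ∀ x : T.closure.domain, ⟪f, x⟫_ℂ = ⟪u, T.closure x⟫_ℂ := fun x =>
      h1 _ (T.closure.mem_graph x)
    have h3 : u ∈ T.closure.adjoint.domain := T.closure.mem_adjoint_domain_of_exists u ⟨f, h2⟩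
    have h4 : T.closure.adjoint ⟨u, h3⟩ = f :=
      LinearPMap.adjoint_apply_eq hT.dense_domain ⟨u, h3⟩ h2
    have hle : T.closure.adjoint ≤ T.closure := le_of_eq hT
    exact ⟨hle.1 h3, by rw [← h4]; exact (hle.2 rfl).symm⟩
  obtain ⟨hu1, hu2⟩ := key hu
  obtain ⟨hv1, hv2⟩ := key hv
  have hle : T.closure ≤ T.closure.adjoint := ge_of_eq hT
  have h5 := T.closure.adjoint_isFormalAdjoint hT.dense_domain ⟨u, hle.1 hu1⟩ ⟨v, hv1⟩
  rw [← hle.2 (x := ⟨u, hu1⟩) rfl, hu2, hv2] at h5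
  exact h5

/-- A self-adjoint operator contained in a self-adjoint operator equals it. -/
theorem eq_of_le_of_isSelfAdjoint {A B : V →ₗ.[ℂ] V} (hA : IsSelfAdjoint A) (hB : IsSelfAdjoint B)
    (h : A ≤ B) : A = B := by
  refine le_antisymm h ?_
  have hf : A.IsFormalAdjoint B := by
    intro x y
    have h1 := B.adjoint_isFormalAdjoint hB.dense_domain
    rw [LinearPMap.isSelfAdjoint_def.1 hB] at h1
    have h2 := h1 ⟨x, h.1 x.2⟩ y
    rwa [← h.2 (x := x) rfl] at h2
  have h3 := hf.le_adjoint hA.dense_domain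
  rwa [LinearPMap.isSelfAdjoint_def.1 hA] at h3

end Abstract

/-! ### Radial and tangential parts -/

theorem rhat_apply (x : E3) (i : Fin 3) : rhat x i = ‖x‖⁻¹ * x i := rfl

theorem norm_sq_eq_sum (x : E3) : ‖x‖ ^ 2 = ∑ i, x i ^ 2 := by
  simp [EuclideanSpace.norm_sq_eq]

theorem sum_rhat_sq {x : E3} (hx : x ∈ Om) : ∑ i, (rhat x i : ℂ) * rhat x i = 1 := by
  have h0 := (norm_pos_of_mem_Om hx).ne'
  have h1 : ∑ i, rhat x i * rhat x i = 1 := by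
    have : ∑ i, rhat x i * rhat x i = (‖x‖ ^ 2)⁻¹ * ∑ i, x i ^ 2 := by
      rw [Finset.mul_sum]
      refine Finset.sum_congr rfl fun i _ => ?_
      rw [rhat_apply]
      field_simp
    rw [this, ← norm_sq_eq_sum]
    field_simp
  exact_mod_cast h1

theorem norm_rhat_apply_le (x : E3) (i : Fin 3) : ‖(rhat x i : ℂ)‖ ≤ 1 := by
  rw [Complex.norm_real]
  refine (PiLp.norm_apply_le _ i).trans ?_
  rw [rhat, norm_smul, norm_inv, norm_norm]
  exact inv_mul_le_one

/-- The field whose radial part is multiplied by `c` and whose tangential part is unchanged. -/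
def mix (c : E3 → ℝ) (G : Fin 3 → E3 → ℂ) (i : Fin 3) (x : E3) : ℂ :=
  c x * (rhat x i * radPart G x) + tanPart G i x

theorem radPart_tanPart {x : E3} (hx : x ∈ Om) (G : Fin 3 → E3 → ℂ) :
    ∑ i, (rhat x i : ℂ) * tanPart G i x = 0 := by
  have h : ∀ i, (rhat x i : ℂ) * tanPart G i x
      = rhat x i * G i x - (rhat x i * rhat x i) * radPart G x := fun i => by
    rw [tanPart]; ring
  simp only [h, Finset.sum_sub_distrib, ← Finset.sum_mul, sum_rhat_sq hx]
  simp [radPart]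

theorem radPart_mix {x : E3} (hx : x ∈ Om) (c : E3 → ℝ) (G : Fin 3 → E3 → ℂ) :
    radPart (mix c G) x = c x * radPart G x := by
  have h : ∀ i, (rhat x i : ℂ) * mix c G i x
      = (rhat x i * rhat x i) * (c x * radPart G x) + rhat x i * tanPart G i x := fun i => by
    rw [mix]; ring
  rw [radPart]
  simp only [h, Finset.sum_add_distrib, ← Finset.sum_mul, sum_rhat_sq hx, radPart_tanPart hx]
  ring

theorem tanPart_mix {x : E3} (hx : x ∈ Om) (c : E3 → ℝ) (G : Fin 3 → E3 → ℂ) (i : Fin 3) :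
    tanPart (mix c G) i x = tanPart G i x := by
  rw [tanPart, radPart_mix hx, mix]
  ring

/-- `mix c` is the matrix c θθᵀ + (1 - θθᵀ). Since |θ| = 1 on Ω, such matrices multiply as their
coefficients do; this permits the splitting W = √W · √W in the form. -/
theorem mix_mix {x : E3} (hx : x ∈ Om) (c d : E3 → ℝ) (G : Fin 3 → E3 → ℂ) (i : Fin 3) :
    mix c (mix d G) i x = mix (fun x => c x * d x) G i x := by
  simp only [mix, radPart_mix hx, tanPart_mix hx]
  push_cast
  ring

theorem mix_one {x : E3} {c : E3 → ℝ} (hc : c x = 1) (G : Fin 3 → E3 → ℂ) (i : Fin 3) :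
    mix c G i x = G i x := by
  simp [mix, hc, tanPart]

/-- The matrix c θθᵀ + (1 - θθᵀ) is symmetric. Normalisation of θ plays no role, so the origin is
not excluded. -/
theorem sum_mix_mul (c : E3 → ℝ) (F G : Fin 3 → E3 → ℂ) (x : E3) :
    ∑ i, mix c F i x * G i x = ∑ i, F i x * mix c G i x := by
  simp only [mix, tanPart, radPart, Fin.sum_univ_three]
  ring

theorem conj_mix (c : E3 → ℝ) (F : Fin 3 → E3 → ℂ) (i : Fin 3) (x : E3) :
    starRingEnd ℂ (mix c F i x) = mix c (fun i x => starRingEnd ℂ (F i x)) i x := by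
  simp [mix, tanPart, radPart]

/-- The `i`-th coordinate as a complex valued linear form. -/
def coordCLM (i : Fin 3) : E3 →L[ℝ] ℂ := Complex.ofRealCLM.comp (EuclideanSpace.proj i)

theorem contDiffAt_coord (i : Fin 3) (x : E3) : ContDiffAt ℝ ∞ (fun y : E3 => ((y i : ℝ) : ℂ)) x :=
  (coordCLM i).contDiff.contDiffAt

theorem contDiffAt_ofReal {c : E3 → ℝ} {x : E3} (hc : ContDiffAt ℝ ∞ c x) :
    ContDiffAt ℝ ∞ (fun y => (c y : ℂ)) x :=
  Complex.ofRealCLM.contDiff.contDiffAt.comp x hc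

theorem contDiffAt_rhat_coord (i : Fin 3) {x : E3} (hx : x ∈ Om) :
    ContDiffAt ℝ ∞ (fun y : E3 => ((rhat y i : ℝ) : ℂ)) x :=
  (contDiffAt_coord i _).comp x (contDiffAt_rhat hx)

theorem mix_grad (c : E3 → ℝ) (φ : E3 → ℂ) (i : Fin 3) (x : E3) :
    mix c (fun j => pd j φ) i x = c x * (rhat x i * dRad φ x) + dTan i φ x := by
  rw [mix, dRad_eq, dTan_eq]

theorem mix_grad_mem {c : E3 → ℝ} (hc : ∀ x ∈ Om, ContDiffAt ℝ ∞ c x) {φ : E3 → ℂ}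
    (hφ : φ ∈ testFun) (i : Fin 3) : mix c (fun j => pd j φ) i ∈ testFun := by
  have h := testFun.add_mem (mul_mem_testFun (smooth_mul_mem (dRad_mem hφ)
    fun x hx => contDiffAt_rhat_coord i hx) hc) (dTan_mem i hφ)
  convert h using 1
  ext x
  exact mix_grad c φ i x

/-! ### Radial functions -/

theorem hasFDerivAt_radial {κ : ℝ → ℝ} {κ' : ℝ} {x : E3} (hx : x ∈ Om)
    (hκ : HasDerivAt κ κ' ‖x‖) :
    HasFDerivAt (fun y : E3 => ((κ ‖y‖ : ℝ) : ℂ))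
      (Complex.ofRealCLM.comp (κ' • innerSL ℝ (rhat x))) x := by
  have h1 : HasFDerivAt (fun y : E3 => ‖y‖) (innerSL ℝ (rhat x)) x := by
    have h2 : HasFDerivAt (fun y : E3 => ‖y‖ ^ 2) (2 • innerSL ℝ x) x := by
      simpa using (hasStrictFDerivAt_norm_sq x).hasFDerivAt
    have hx0 := norm_pos_of_mem_Om hx
    have h3 := h2.sqrt (by positivity)
    simp only [Real.sqrt_sq (norm_nonneg _)] at h3
    refine h3.congr_fderiv ?_
    ext v
    simp [rhat]
    ring
  have h4 := hκ.comp_hasFDerivAt x h1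
  exact Complex.ofRealCLM.hasFDerivAt.comp x h4

theorem fderiv_radial {κ : ℝ → ℝ} {κ' : ℝ} {x : E3} (hx : x ∈ Om)
    (hκ : HasDerivAt κ κ' ‖x‖) (v : E3) :
    fderiv ℝ (fun y : E3 => ((κ ‖y‖ : ℝ) : ℂ)) x v = ((κ' * ⟪rhat x, v⟫_ℝ : ℝ) : ℂ) := by
  rw [(hasFDerivAt_radial hx hκ).fderiv]
  simp

theorem pd_radial {κ : ℝ → ℝ} {κ' : ℝ} {x : E3} (hx : x ∈ Om)
    (hκ : HasDerivAt κ κ' ‖x‖) (i : Fin 3) :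
    pd i (fun y : E3 => ((κ ‖y‖ : ℝ) : ℂ)) x = κ' * rhat x i := by
  rw [pd, fderiv_radial hx hκ, inner_bvec]
  push_cast
  rfl

theorem norm_rhat {x : E3} (hx : x ∈ Om) : ‖rhat x‖ = 1 := by
  rw [rhat, norm_smul, norm_inv, norm_norm]
  exact inv_mul_cancel₀ (norm_pos_of_mem_Om hx).ne'

theorem dRad_radial {κ : ℝ → ℝ} {κ' : ℝ} {x : E3} (hx : x ∈ Om)
    (hκ : HasDerivAt κ κ' ‖x‖) : dRad (fun y : E3 => ((κ ‖y‖ : ℝ) : ℂ)) x = κ' := by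
  rw [dRad, fderiv_radial hx hκ, real_inner_self_eq_norm_sq, norm_rhat hx]
  simp

theorem dRad_mul {f g : E3 → ℂ} {x : E3} (hf : DifferentiableAt ℝ f x)
    (hg : DifferentiableAt ℝ g x) :
    dRad (fun y => f y * g y) x = dRad f x * g x + f x * dRad g x := by
  simp only [dRad, fderiv_fun_mul hf hg]
  simp
  ring

theorem fderiv_coord (i : Fin 3) (x v : E3) :
    fderiv ℝ (fun y : E3 => ((y i : ℝ) : ℂ)) x v = v i := by
  have h : HasFDerivAt (fun y : E3 => ((y i : ℝ) : ℂ)) (coordCLM i) x := (coordCLM i).hasFDerivAt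
  rw [h.fderiv]
  rfl

theorem pd_coord (i : Fin 3) (x : E3) : pd i (fun y : E3 => ((y i : ℝ) : ℂ)) x = 1 := by
  rw [pd, fderiv_coord]
  simp [bvec]

theorem coord_eq (x : E3) (i : Fin 3) : (x i : ℂ) = ‖x‖ * rhat x i := by
  rw [rhat_apply]
  by_cases hx : x = 0
  · simp [hx]
  · have : (‖x‖ : ℂ) ≠ 0 := by simpa using hx
    push_cast
    field_simp

/-- The divergence of `g x`. -/
theorem sum_pd_coord_mul {g : E3 → ℂ} {x : E3} (hg : DifferentiableAt ℝ g x) :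
    ∑ i, pd i (fun y => (y i : ℂ) * g y) x = 3 * g x + ‖x‖ * dRad g x := by
  have h : ∀ i, pd i (fun y => (y i : ℂ) * g y) x = g x + ‖x‖ * (rhat x i * pd i g x) := by
    intro i
    rw [pd_mul i ((contDiffAt_coord i x).differentiableAt (by simp)) hg, pd_coord, coord_eq]
    ring
  simp only [h, Finset.sum_add_distrib, ← Finset.mul_sum]
  simp [dRad_eq, radPart]

/-- The divergence of a radial vector field. -/
theorem sum_pd_rhat_mul {F : E3 → ℂ} {x : E3} (hx : x ∈ Om) (hF : DifferentiableAt ℝ F x) :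
    ∑ i, pd i (fun y => (rhat y i : ℂ) * (((‖y‖ ^ 2)⁻¹ : ℝ) * F y)) x
      = ((‖x‖ ^ 2)⁻¹ : ℝ) * dRad F x := by
  have hx0 := norm_pos_of_mem_Om hx
  have hd : HasDerivAt (fun r : ℝ => (r ^ 3)⁻¹) (-(3 * ‖x‖ ^ 2) / (‖x‖ ^ 3) ^ 2) ‖x‖ := by
    simpa using (hasDerivAt_pow 3 ‖x‖).fun_inv (by positivity)
  have hdf := (hasFDerivAt_radial hx hd).differentiableAt
  have e : ∀ (i : Fin 3) (y : E3), (rhat y i : ℂ) * (((‖y‖ ^ 2)⁻¹ : ℝ) * F y)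
      = (y i : ℂ) * ((((‖y‖ ^ 3)⁻¹ : ℝ) : ℂ) * F y) := by
    intro i y
    rw [rhat_apply]
    push_cast
    ring
  simp only [e]
  rw [sum_pd_coord_mul (hdf.fun_mul hF), dRad_mul hdf hF, dRad_radial hx hd]
  have : (‖x‖ : ℂ) ≠ 0 := by exact_mod_cast hx0.ne'
  push_cast
  field_simp
  ring

/-! ### The divergence form of the differential expression -/

/-- Differentiate the identity ∑ yᵢ (∇_θφ)ᵢ = 0 radially. The outcome is that the tangential
divergence of the tangential gradient equals its full divergence. -/
theorem sum_rhat_mul_dRad_dTan {φ : E3 → ℂ} (hφ : φ ∈ testFun) {x : E3} (hx : x ∈ Om) :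
    ∑ i, (rhat x i : ℂ) * dRad (dTan i φ) x = 0 := by
  have hx0 : (‖x‖ : ℂ) ≠ 0 := by exact_mod_cast (norm_pos_of_mem_Om hx).ne'
  have hz : ∀ y ∈ Om, ∑ i, (y i : ℂ) * dTan i φ y = 0 := by
    intro y hy
    have h := radPart_tanPart hy fun j => pd j φ
    simp only [coord_eq y, dTan_eq, mul_assoc, ← Finset.mul_sum, h, mul_zero]
  have hz' : (fun y : E3 => ∑ i, (y i : ℂ) * dTan i φ y) =ᶠ[nhds x] fun _ => 0 :=
    Filter.eventually_of_mem (isOpen_Om.mem_nhds hx) hz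
  have h1 : dRad (fun y : E3 => ∑ i, (y i : ℂ) * dTan i φ y) x = 0 := by
    rw [dRad, hz'.fderiv_eq]; simp
  have hc : ∀ i, DifferentiableAt ℝ (fun y : E3 => (y i : ℂ)) x := fun i =>
    (contDiffAt_coord i x).differentiableAt (by simp)
  have ht : ∀ i, DifferentiableAt ℝ (dTan i φ) x := fun i => differentiable_of_mem (dTan_mem i hφ) x
  have h2 : dRad (fun y : E3 => ∑ i, (y i : ℂ) * dTan i φ y) x
      = ∑ i, dRad (fun y : E3 => (y i : ℂ) * dTan i φ y) x := by
    rw [dRad, fderiv_fun_sum fun i _ => (hc i).fun_mul (ht i)]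
    simp [dRad]
  have h3 : ∀ i, dRad (fun y : E3 => (y i : ℂ) * dTan i φ y) x
      = rhat x i * dTan i φ x + ‖x‖ * (rhat x i * dRad (dTan i φ) x) := by
    intro i
    rw [dRad_mul (hc i) (ht i), dRad, fderiv_coord, coord_eq x]
    ring
  rw [h1] at h2
  simp only [h3, Finset.sum_add_distrib, ← Finset.mul_sum] at h2
  have h4 : ∑ i, (rhat x i : ℂ) * dTan i φ x = 0 := by
    simpa only [dTan_eq] using radPart_tanPart hx fun j => pd j φ
  rw [h4, zero_add] at h2
  exact (mul_eq_zero.1 h2.symm).resolve_left hx0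

/-- The radial term is r⁻²∂_r(r²W∂_rφ) = div(W ∂_rφ θ), and the spherical Laplacian over r² is the
Euclidean divergence of ∇_θφ by `sum_rhat_mul_dRad_dTan`. -/
theorem waveExpr_eq_div {M : ℝ} (hM : 0 < M) {φ : E3 → ℂ} (hφ : φ ∈ testFun) {x : E3}
    (hx : x ∈ Om) :
    ((lapse M x)⁻¹ : ℝ) * waveExpr M φ x = -∑ i, pd i (mix (lapse M) (fun j => pd j φ) i) x := by
  have hw : (lapse M x : ℂ) ≠ 0 := by
    exact_mod_cast (zero_lt_one.trans_le (lapse_ge_one hM x)).ne'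
  have hx0 : (‖x‖ : ℂ) ≠ 0 := by exact_mod_cast (norm_pos_of_mem_Om hx).ne'
  set F : E3 → ℂ := fun y => ((‖y‖ ^ 2 * lapse M y : ℝ) : ℂ) * dRad φ y with hF
  have hFd : DifferentiableAt ℝ F x := differentiable_of_mem (radFlux_mem M hφ) x
  have h1 : ∀ i, pd i (mix (lapse M) (fun j => pd j φ) i) x
      = pd i (fun y => (rhat y i : ℂ) * (((‖y‖ ^ 2)⁻¹ : ℝ) * F y)) x + pd i (dTan i φ) x := by
    intro i
    have e : mix (lapse M) (fun j => pd j φ) i =ᶠ[nhds x]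
        fun y => (rhat y i : ℂ) * (((‖y‖ ^ 2)⁻¹ : ℝ) * F y) + dTan i φ y := by
      refine Filter.eventually_of_mem (isOpen_Om.mem_nhds hx) fun y hy => ?_
      have hy0 : (‖y‖ : ℂ) ≠ 0 := by exact_mod_cast (norm_pos_of_mem_Om hy).ne'
      simp only [mix_grad, hF]
      push_cast
      field_simp
    have hn : DifferentiableAt ℝ (fun y : E3 => (((‖y‖ ^ 2)⁻¹ : ℝ) : ℂ)) x :=
      (contDiffAt_ofReal (((contDiffAt_norm_Om hx).pow 2).inv
        (pow_ne_zero 2 (norm_ne_zero_iff.2 hx)))).differentiableAt (by simp)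
    have hr := (contDiffAt_rhat_coord i hx).differentiableAt (by simp)
    rw [pd, e.fderiv_eq, fderiv_fun_add (hr.fun_mul (hn.fun_mul hFd))
      (differentiable_of_mem (dTan_mem i hφ) x)]
    rfl
  have h2 : ∑ i, dTan i (dTan i φ) x = ∑ i, pd i (dTan i φ) x := by
    have : ∀ i, dTan i (dTan i φ) x = pd i (dTan i φ) x - rhat x i * dRad (dTan i φ) x := by
      intro i
      rw [dTan_eq, tanPart, ← dRad_eq]
    simp only [this, Finset.sum_sub_distrib, sum_rhat_mul_dRad_dTan hφ hx, sub_zero]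
  have h3 : waveExpr M φ x = ((-(lapse M x * (‖x‖ ^ 2)⁻¹) : ℝ) : ℂ) * (dRad F x + sphLap φ x) := rfl
  simp only [h1, Finset.sum_add_distrib, sum_pd_rhat_mul hx hFd, ← h2, h3, sphLap]
  push_cast
  field_simp

theorem lapse_pos {M : ℝ} (hM : 0 < M) (x : E3) : 0 < lapse M x :=
  zero_lt_one.trans_le (lapse_ge_one hM x)

theorem integral_hMeasure {M : ℝ} (hM : 0 < M) (f : E3 → ℂ) :
    ∫ x, f x ∂(hMeasure M) = ∫ x, ((lapse M x)⁻¹ : ℝ) * f x := by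
  rw [hMeasure, integral_withDensity_eq_integral_toReal_smul
    (measurable_lapse M).fun_inv.ennreal_ofReal (.of_forall fun _ => ENNReal.ofReal_lt_top)]
  refine integral_congr_ae (.of_forall fun x => ?_)
  simp only [Complex.real_smul]
  rw [ENNReal.toReal_ofReal (inv_nonneg.2 (lapse_pos hM x).le)]

/-- The weak form of the differential expression. -/
theorem integral_conj_mul_waveExpr {M : ℝ} (hM : 0 < M) {u : E3 → ℂ} {G : Fin 3 → E3 → ℂ}
    (hu : MemL2loc u) (hw : HasWeakGrad u G) (hG : ∀ i, MemL2loc (G i)) {φ : E3 → ℂ}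
    (hφ : φ ∈ testFun) :
    ∫ x, starRingEnd ℂ (u x) * waveExpr M φ x ∂(hMeasure M)
      = ∫ x, ∑ i, starRingEnd ℂ (G i x) * mix (lapse M) (fun j => pd j φ) i x := by
  have hm : ∀ i, mix (lapse M) (fun j => pd j φ) i ∈ testFun := fun i =>
    mix_grad_mem (fun x hx => contDiffAt_lapse M hx) hφ i
  rw [integral_hMeasure hM]
  have h1 : ∀ᵐ x : E3, ((lapse M x)⁻¹ : ℝ) * (starRingEnd ℂ (u x) * waveExpr M φ x)
      = -∑ i, starRingEnd ℂ (u x) * pd i (mix (lapse M) (fun j => pd j φ) i) x := by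
    filter_upwards [ae_mem_Om] with x hx
    rw [mul_left_comm, waveExpr_eq_div hM hφ hx, mul_neg, Finset.mul_sum]
  rw [integral_congr_ae h1, integral_neg, integral_finsetSum, integral_finsetSum,
    ← Finset.sum_neg_distrib]
  · refine Finset.sum_congr rfl fun i _ => ?_
    have h2 := (hw.2 i).2 _ (conj_mem (hm i))
    have h3 : ∀ x, fderiv ℝ (fun x => starRingEnd ℂ (mix (lapse M) (fun j => pd j φ) i x)) x (bvec i)
        = starRingEnd ℂ (pd i (mix (lapse M) (fun j => pd j φ) i) x) := fun x =>
      pd_conj i (differentiable_of_mem (hm i) x)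
    simp only [h3] at h2
    have h4 := congrArg (starRingEnd ℂ) h2
    rw [map_neg, ← integral_conj, ← integral_conj] at h4
    simp only [map_mul, Complex.conj_conj] at h4
    rw [h4, neg_neg]
  · exact fun i _ => (hG i).conj.integrable_mul (hm i)
  · exact fun i _ => hu.conj.integrable_mul (pd_mem i (hm i))

/-! ### The weighted space -/

theorem hMeasure_ac (M : ℝ) : hMeasure M ≪ volume := withDensity_absolutelyContinuous _ _

theorem volume_ac {M : ℝ} (hM : 0 < M) : volume ≪ hMeasure M :=
  withDensity_absolutelyContinuous' (measurable_lapse M).fun_inv.ennreal_ofReal.aemeasurable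
    (.of_forall fun x => (ENNReal.ofReal_pos.2 (inv_pos.2 (lapse_pos hM x))).ne')

/-- Multiplication by W^(-1/2) carries the weighted L² to the Lebesgue one. Measurability transfers
because the two measures are mutually absolutely continuous. -/
theorem memLp_hMeasure_iff {M : ℝ} (hM : 0 < M) {u : E3 → ℂ} :
    MemLp u 2 (hMeasure M) ↔ MemLp (fun x => ((√(lapse M x))⁻¹ : ℝ) * u x) 2 := by
  have hm : Measurable fun x => (((√(lapse M x))⁻¹ : ℝ) : ℂ) :=
    Complex.measurable_ofReal.comp (measurable_lapse M).sqrt.inv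
  have hae : AEStronglyMeasurable u (hMeasure M) ↔
      AEStronglyMeasurable (fun x => ((√(lapse M x))⁻¹ : ℝ) * u x) volume := by
    constructor
    · intro h
      exact hm.aestronglyMeasurable.mul (h.mono_ac (volume_ac hM))
    · intro h
      refine AEStronglyMeasurable.mono_ac (hMeasure_ac M) ?_
      have h2 := (hm.inv.aestronglyMeasurable (μ := volume)).mul h
      refine h2.congr (.of_forall fun x => ?_)
      have : (((√(lapse M x))⁻¹ : ℝ) : ℂ) ≠ 0 := by
        exact_mod_cast (inv_pos.2 (Real.sqrt_pos.2 (lapse_pos hM x))).ne'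
      simp only [Pi.mul_apply, Pi.inv_apply]
      rw [inv_mul_cancel_left₀ this]
  by_cases h : AEStronglyMeasurable u (hMeasure M)
  · rw [memLp_two_iff_integrable_sq_norm h, memLp_two_iff_integrable_sq_norm (hae.1 h), hMeasure,
      integrable_withDensity_iff_integrable_smul' (measurable_lapse M).fun_inv.ennreal_ofReal
        (.of_forall fun _ => ENNReal.ofReal_lt_top)]
    refine integrable_congr (.of_forall fun x => ?_)
    have h0 := lapse_pos hM x
    simp only [smul_eq_mul, norm_mul, Complex.norm_real, Real.norm_eq_abs, mul_pow, sq_abs]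
    rw [ENNReal.toReal_ofReal (inv_nonneg.2 h0.le), inv_pow, Real.sq_sqrt h0.le]
  · exact iff_of_false (fun h' => h h'.1) fun h' => h (hae.2 h'.1)

theorem contDiffAt_sqrt_lapse {M : ℝ} (hM : 0 < M) {x : E3} (hx : x ∈ Om) :
    ContDiffAt ℝ ∞ (fun y => √(lapse M y)) x :=
  (contDiffAt_lapse M hx).sqrt (lapse_pos hM x).ne'

theorem contDiffAt_inv_sqrt_lapse {M : ℝ} (hM : 0 < M) {x : E3} (hx : x ∈ Om) :
    ContDiffAt ℝ ∞ (fun y => (√(lapse M y))⁻¹) x :=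
  (contDiffAt_sqrt_lapse hM hx).inv (Real.sqrt_pos.2 (lapse_pos hM x)).ne'

theorem continuousOn_ofReal {c : E3 → ℝ} (hc : ∀ x ∈ Om, ContDiffAt ℝ ∞ c x) :
    ContinuousOn (fun x => (c x : ℂ)) Om := fun x hx =>
  (contDiffAt_ofReal (hc x hx)).continuousAt.continuousWithinAt

/-- √W is continuous on Ω, hence bounded on its compact subsets, although it blows up at the origin.
-/
theorem memL2loc_of_memLp {M : ℝ} (hM : 0 < M) {u : E3 → ℂ} (hu : MemLp u 2 (hMeasure M)) :
    MemL2loc u := by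
  have h := (MemL2loc.of_memLp ((memLp_hMeasure_iff hM).1 hu)).mul_continuousOn
    (continuousOn_ofReal fun x hx => contDiffAt_sqrt_lapse hM hx)
  convert h using 2 with x
  have : ((√(lapse M x) : ℝ) : ℂ) ≠ 0 := by
    exact_mod_cast (Real.sqrt_pos.2 (lapse_pos hM x)).ne'
  push_cast
  field_simp

theorem MemL2loc.mix {c : E3 → ℝ} (hc : ContinuousOn (fun x => (c x : ℂ)) Om)
    {G : Fin 3 → E3 → ℂ} (hG : ∀ i, MemL2loc (G i)) (i : Fin 3) : MemL2loc (mix c G i) := by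
  have hr : ∀ j, ContinuousOn (fun y : E3 => ((rhat y j : ℝ) : ℂ)) Om := fun j x hx =>
    (contDiffAt_rhat_coord j hx).continuousAt.continuousWithinAt
  have h1 : MemL2loc (radPart G) := MemL2loc.sum fun j _ => (hG j).mul_continuousOn (hr j)
  exact ((h1.mul_continuousOn (hr i)).mul_continuousOn hc).add
    ((hG i).sub (h1.mul_continuousOn (hr i)))

theorem mix_mem {c : E3 → ℝ} (hc : ∀ x ∈ Om, ContDiffAt ℝ ∞ c x) {F : Fin 3 → E3 → ℂ}
    (hF : ∀ i, F i ∈ testFun) (i : Fin 3) : mix c F i ∈ testFun := by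
  have hr : ∀ j, ∀ x ∈ Om, ContDiffAt ℝ ∞ (fun y : E3 => ((rhat y j : ℝ) : ℂ)) x :=
    fun j x hx => contDiffAt_rhat_coord j hx
  have h1 : radPart F ∈ testFun := by
    have := testFun.sum_mem (t := Finset.univ) (f := fun j x => (rhat x j : ℂ) * F j x)
      fun j _ => smooth_mul_mem (hF j) (hr j)
    convert this using 1
    ext x
    simp [radPart]
  have h2 := smooth_mul_mem h1 (hr i)
  exact testFun.add_mem (mul_mem_testFun h2 hc) (testFun.sub_mem (hF i) h2)

theorem hasWeakGrad_testFun {φ : E3 → ℂ} (hφ : φ ∈ testFun) : HasWeakGrad φ fun i => pd i φ := by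
  have hl : ∀ {ψ : E3 → ℂ}, ψ ∈ testFun → LocallyIntegrableOn ψ Om := fun h =>
    (testFun_integrable h).locallyIntegrable.locallyIntegrableOn _
  refine ⟨hl hφ, fun i => ⟨hl (pd_mem i hφ), fun η hη => ?_⟩⟩
  have hl2 : ∀ {ψ : E3 → ℂ}, ψ ∈ testFun → MemL2loc ψ := fun h =>
    MemL2loc.of_continuousOn h.1.continuous.continuousOn
  exact integral_mul_fderiv_eq_neg_fderiv_mul_of_integrable
    ((hl2 (pd_mem i hφ)).integrable_mul hη) ((hl2 hφ).integrable_mul (pd_mem i hη))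
    ((hl2 hφ).integrable_mul hη) (fun x _ => differentiable_of_mem hφ x)
    (fun x _ => differentiable_of_mem hη x)

theorem testFun_memL2loc {φ : E3 → ℂ} (hφ : φ ∈ testFun) : MemL2loc φ :=
  MemL2loc.of_continuousOn hφ.1.continuous.continuousOn

/-! ### The form space -/

/-- The space of pairs of a function in `H` and a square integrable vector field. -/
abbrev FormSpace (M : ℝ) : Type :=
  WithLp 2 (H M × PiLp 2 fun _ : Fin 3 => Lp ℂ 2 (volume : Measure E3))

/-- The element of the form space given by square integrable functions. -/
def mkForm {M : ℝ} {u : E3 → ℂ} {g : Fin 3 → E3 → ℂ} (hu : MemLp u 2 (hMeasure M))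
    (hg : ∀ i, MemLp (g i) 2 volume) : FormSpace M :=
  WithLp.toLp 2 (hu.toLp u, WithLp.toLp 2 fun i => (hg i).toLp (g i))

theorem inner_H_eq {M : ℝ} (hM : 0 < M) {f g : H M} {a b : E3 → ℂ}
    (hf : f =ᵐ[hMeasure M] a) (hg : g =ᵐ[hMeasure M] b) :
    ⟪f, g⟫_ℂ = ∫ x, ((lapse M x)⁻¹ : ℝ) * (starRingEnd ℂ (a x) * b x) := by
  rw [L2.inner_def, ← integral_hMeasure hM]
  refine integral_congr_ae ?_
  filter_upwards [hf, hg] with x h1 h2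
  rw [h1, h2, RCLike.inner_apply, mul_comm]

theorem inner_L2_eq {f g : Lp ℂ 2 (volume : Measure E3)} {a b : E3 → ℂ}
    (hf : f =ᵐ[volume] a) (hg : g =ᵐ[volume] b) :
    ⟪f, g⟫_ℂ = ∫ x, starRingEnd ℂ (a x) * b x := by
  rw [L2.inner_def]
  refine integral_congr_ae ?_
  filter_upwards [hf, hg] with x h1 h2
  rw [h1, h2, RCLike.inner_apply, mul_comm]

theorem inner_mkForm_left {M : ℝ} (hM : 0 < M) {u : E3 → ℂ} {g : Fin 3 → E3 → ℂ}
    (hu : MemLp u 2 (hMeasure M)) (hg : ∀ i, MemLp (g i) 2 volume) (z : FormSpace M) :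
    ⟪mkForm hu hg, z⟫_ℂ = (∫ x, ((lapse M x)⁻¹ : ℝ) * (starRingEnd ℂ (u x) * z.fst x)) +
      ∑ i, ∫ x, starRingEnd ℂ (g i x) * z.snd i x := by
  rw [WithLp.prod_inner_apply, PiLp.inner_apply]
  congr 1
  · exact inner_H_eq hM hu.coeFn_toLp Filter.EventuallyEq.rfl
  · exact Finset.sum_congr rfl fun i _ => inner_L2_eq (hg i).coeFn_toLp Filter.EventuallyEq.rfl

theorem inner_mkForm_right {M : ℝ} (hM : 0 < M) {u : E3 → ℂ} {g : Fin 3 → E3 → ℂ}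
    (hu : MemLp u 2 (hMeasure M)) (hg : ∀ i, MemLp (g i) 2 volume) (z : FormSpace M) :
    ⟪z, mkForm hu hg⟫_ℂ = (∫ x, ((lapse M x)⁻¹ : ℝ) * (starRingEnd ℂ (z.fst x) * u x)) +
      ∑ i, ∫ x, starRingEnd ℂ (z.snd i x) * g i x := by
  rw [WithLp.prod_inner_apply, PiLp.inner_apply]
  congr 1
  · exact inner_H_eq hM Filter.EventuallyEq.rfl hu.coeFn_toLp
  · exact Finset.sum_congr rfl fun i _ => inner_L2_eq Filter.EventuallyEq.rfl (hg i).coeFn_toLp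

theorem inner_mkForm {M : ℝ} (hM : 0 < M) {u v : E3 → ℂ} {g k : Fin 3 → E3 → ℂ}
    (hu : MemLp u 2 (hMeasure M)) (hg : ∀ i, MemLp (g i) 2 volume)
    (hv : MemLp v 2 (hMeasure M)) (hk : ∀ i, MemLp (k i) 2 volume) :
    ⟪mkForm hu hg, mkForm hv hk⟫_ℂ =
      (∫ x, ((lapse M x)⁻¹ : ℝ) * (starRingEnd ℂ (u x) * v x)) +
      ∑ i, ∫ x, starRingEnd ℂ (g i x) * k i x := by
  rw [WithLp.prod_inner_apply, PiLp.inner_apply]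
  congr 1
  · exact inner_H_eq hM hu.coeFn_toLp hv.coeFn_toLp
  · exact Finset.sum_congr rfl fun i _ => inner_L2_eq (hg i).coeFn_toLp (hk i).coeFn_toLp

/-- The weighted gradient, whose squared length is the energy density. -/
def wgrad (M : ℝ) (G : Fin 3 → E3 → ℂ) : Fin 3 → E3 → ℂ := mix (fun x => √(lapse M x)) G

theorem wgrad_mem {M : ℝ} (hM : 0 < M) {φ : E3 → ℂ} (hφ : φ ∈ testFun) (i : Fin 3) :
    wgrad M (fun j => pd j φ) i ∈ testFun :=
  mix_grad_mem (fun _ hx => contDiffAt_sqrt_lapse hM hx) hφ i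

/-- A test function together with its weighted gradient. -/
def testForm {M : ℝ} (hM : 0 < M) (φ : testFun) : FormSpace M :=
  mkForm (testFun_memLp hM φ) fun i => testFun_memLp_volume (wgrad_mem hM φ.2 i) 2

/-- The form domain: the closure of the test functions in the energy norm. -/
def formDomain {M : ℝ} (hM : 0 < M) : Submodule ℂ (FormSpace M) :=
  (Submodule.span ℂ (range (testForm hM))).topologicalClosure

theorem mem_orthogonal_span {M : ℝ} (hM : 0 < M) {ξ : FormSpace M} :
    ξ ∈ (Submodule.span ℂ (range (testForm hM)))ᗮ ↔ ∀ φ, ⟪ξ, testForm hM φ⟫_ℂ = 0 := by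
  rw [Submodule.mem_orthogonal']
  refine ⟨fun h φ => h _ (Submodule.subset_span ⟨φ, rfl⟩), fun h z hz => ?_⟩
  induction hz using Submodule.span_induction with
  | mem z hz => obtain ⟨φ, rfl⟩ := hz; exact h φ
  | zero => simp
  | add x y _ _ hx hy => rw [inner_add_right, hx, hy, add_zero]
  | smul c x _ hx => rw [inner_smul_right, hx, mul_zero]

/-- The closure is the double orthogonal complement. Membership can thus be checked, and identities
passed to the closure, by weak testing alone. -/
theorem mem_formDomain_iff {M : ℝ} (hM : 0 < M) {z : FormSpace M} :
    z ∈ formDomain hM ↔ ∀ ξ : FormSpace M, (∀ φ, ⟪ξ, testForm hM φ⟫_ℂ = 0) → ⟪ξ, z⟫_ℂ = 0 := by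
  rw [formDomain, ← Submodule.orthogonal_orthogonal_eq_closure, Submodule.mem_orthogonal]
  simp only [mem_orthogonal_span]

theorem testForm_mem {M : ℝ} (hM : 0 < M) (φ : testFun) : testForm hM φ ∈ formDomain hM :=
  (mem_formDomain_iff hM).2 fun _ h => h φ

instance {M : ℝ} (hM : 0 < M) : CompleteSpace (formDomain hM) :=
  (Submodule.isClosed_topologicalClosure _).completeSpace_coe

/-- The projection of the form space to `H`. -/
def formFst (M : ℝ) : FormSpace M →L[ℂ] H M := WithLp.fstL 2 ℂ (H M) _

/-- The fundamental lemma of the calculus of variations on Ω, applied to the conjugate of u divided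
by W. It makes the form domain dense in H. -/
theorem eq_zero_of_inner_toH {M : ℝ} (hM : 0 < M) {u : H M}
    (h : ∀ φ, ⟪u, toH hM φ⟫_ℂ = 0) : u = 0 := by
  have hu : MemL2loc u := memL2loc_of_memLp hM (Lp.memLp u)
  have hinv : ∀ x ∈ Om, ContDiffAt ℝ ∞ (fun y => (lapse M y)⁻¹) x := fun x hx =>
    (contDiffAt_lapse M hx).inv (lapse_pos hM x).ne'
  have h1 := isOpen_Om.ae_eq_zero_of_integral_contDiff_smul_eq_zero
    (hu.conj.mul_continuousOn (continuousOn_ofReal hinv)).locallyIntegrableOn (fun g hg hg1 hg2 => by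
      have hs : tsupport (fun x => (g x : ℂ)) ⊆ tsupport g :=
        closure_mono fun x hx h0 => hx (by simp [h0])
      have hm : (fun x => (g x : ℂ)) ∈ testFun := ⟨Complex.ofRealCLM.contDiff.comp hg,
        hg1.of_isClosed_subset (isClosed_tsupport _) hs, hs.trans hg2⟩
      have h2 := h ⟨_, hm⟩
      have h3 := inner_H_eq hM (f := u) Filter.EventuallyEq.rfl
        (testFun_memLp hM ⟨_, hm⟩).coeFn_toLp
      replace h2 := h3.symm.trans h2
      rw [← h2]
      refine integral_congr_ae (.of_forall fun x => ?_)
      simp only [Complex.real_smul]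
      ring)
  refine Lp.eq_zero_iff_ae_eq_zero.2 ?_
  refine (hMeasure_ac M).ae_le ?_
  filter_upwards [h1, ae_mem_Om] with x hx hx0
  have := hx hx0
  rcases mul_eq_zero.1 this with h3 | h3
  · have h4 := (inv_pos.2 (lapse_pos hM x)).ne'
    exact absurd (by exact_mod_cast h3) h4
  · simpa using h3

theorem denseRange_formFst {M : ℝ} (hM : 0 < M) :
    DenseRange (formFst M ∘L (formDomain hM).subtypeL) := by
  have h : Dense ((LinearMap.range (formFst M ∘L (formDomain hM).subtypeL).toLinearMap :
      Submodule ℂ (H M)) : Set (H M)) := by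
    rw [Submodule.dense_iff_topologicalClosure_eq_top, Submodule.topologicalClosure_eq_top_iff,
      Submodule.eq_bot_iff]
    intro u hu
    refine eq_zero_of_inner_toH hM fun φ => ?_
    exact (Submodule.mem_orthogonal' _ u).1 hu _ ⟨⟨testForm hM φ, testForm_mem hM φ⟩, rfl⟩
  exact h

/-! ### The Friedrichs extension -/

/-- The Friedrichs extension. -/
def friedrichs {M : ℝ} (hM : 0 < M) : H M →ₗ.[ℂ] H M :=
  formOp (formFst M) (formDomain hM) (denseRange_formFst hM)

theorem isSelfAdjoint_friedrichs {M : ℝ} (hM : 0 < M) : IsSelfAdjoint (friedrichs hM) :=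
  isSelfAdjoint_formOp _ _ _

/-- The characterisation of the Friedrichs extension by the form. -/
theorem friedrichs_apply {M : ℝ} (hM : 0 < M) {z : FormSpace M} (hz : z ∈ formDomain hM)
    {f : H M} (h : ∀ φ, ⟪f, toH hM φ⟫_ℂ + ⟪z.fst, toH hM φ⟫_ℂ = ⟪z, testForm hM φ⟫_ℂ) :
    ∃ hy : z.fst ∈ (friedrichs hM).domain, friedrichs hM ⟨z.fst, hy⟩ = f := by
  -- The hypothesis says that (f + z.fst, 0) - z is orthogonal to every test form. It is then
  -- orthogonal to the whole form domain, which is the condition of `formOp_apply`.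
  have h0 : ∀ w : FormSpace M, ⟪WithLp.toLp 2 (f + z.fst, 0) - z, w⟫_ℂ
      = ⟪f + z.fst, w.fst⟫_ℂ - ⟪z, w⟫_ℂ := fun w => by
    rw [inner_sub_left, WithLp.prod_inner_apply (WithLp.toLp 2 (f + z.fst, 0)) w]
    simp
  obtain ⟨hy, h1⟩ := formOp_apply (formFst M) (formDomain hM) (denseRange_formFst hM) hz
    (f := f + z.fst) fun w hw => by
      have h2 := (mem_formDomain_iff hM).1 hw (WithLp.toLp 2 (f + z.fst, 0) - z) fun φ => by
        rw [h0, ← h φ, inner_add_left, sub_eq_zero]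
        rfl
      rw [h0, sub_eq_zero] at h2
      exact h2
  exact ⟨hy, h1.trans (add_sub_cancel_right _ _)⟩

theorem exists_of_mem_friedrichs {M : ℝ} (hM : 0 < M) {y : H M} (hy : y ∈ (friedrichs hM).domain) :
    ∃ z ∈ formDomain hM, z.fst = y :=
  exists_of_mem_formOp_domain (formFst M) (formDomain hM) (denseRange_formFst hM) hy

theorem waveOp_apply {M : ℝ} (hM : 0 < M) (φ : testFun) (y : (waveOp hM).domain)
    (hy : (y : H M) = toH hM φ) : waveOp hM y = toH hM (waveTest M φ) := by
  have hy' : y = LinearEquiv.ofInjective (toH hM) (toH_injective hM) φ := Subtype.ext hy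
  subst hy'
  change toH hM (waveTest M ((LinearEquiv.ofInjective (toH hM) (toH_injective hM)).symm _)) = _
  rw [LinearEquiv.symm_apply_apply]

theorem mem_waveOp_domain {M : ℝ} (hM : 0 < M) (φ : testFun) :
    toH hM φ ∈ (waveOp hM).domain := ⟨φ, rfl⟩

/-- Green's formula: ⟪u, Aφ⟫ is the integral of the conjugate of G against the W-weighted gradient
of φ. Writing W = √W · √W and moving one factor to each side gives the pairing of weighted
gradients. -/
theorem inner_toH_waveTest {M : ℝ} (hM : 0 < M) {u : E3 → ℂ} {G : Fin 3 → E3 → ℂ}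
    (hw : HasWeakGrad u G) (hG : ∀ i, MemL2loc (G i)) (hu : MemLp u 2 (hMeasure M))
    (hg : ∀ i, MemLp (wgrad M G i) 2 volume) (φ : testFun) :
    ⟪hu.toLp u, toH hM (waveTest M φ)⟫_ℂ + ⟪hu.toLp u, toH hM φ⟫_ℂ
      = ⟪mkForm hu hg, testForm hM φ⟫_ℂ := by
  rw [testForm, inner_mkForm hM, add_comm]
  congr 1
  · exact inner_H_eq hM hu.coeFn_toLp (testFun_memLp hM φ).coeFn_toLp
  · have h1 := inner_H_eq hM hu.coeFn_toLp (testFun_memLp hM (waveTest M φ)).coeFn_toLp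
    have h2 := integral_conj_mul_waveExpr hM (memL2loc_of_memLp hM hu) hw hG φ.2
    rw [integral_hMeasure hM] at h2
    refine (h1.trans h2).trans ?_
    rw [← integral_finsetSum]
    · refine integral_congr_ae ?_
      filter_upwards [ae_mem_Om] with x hx
      simp only [wgrad, conj_mix, sum_mix_mul]
      refine Finset.sum_congr rfl fun i _ => ?_
      rw [mix_mix hx]
      congr 2
      ext y
      exact (Real.mul_self_sqrt (lapse_pos hM y).le).symm
    · intro i _
      exact (hg i).star.integrable_mul (testFun_memLp_volume (wgrad_mem hM φ.2 i) 2)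

/-- Green's formula with the two test functions exchanged, then conjugated, is the weak equation of
`friedrichs_apply` with f = Aφ. -/
theorem waveOp_le_friedrichs {M : ℝ} (hM : 0 < M) : waveOp hM ≤ friedrichs hM := by
  have key : ∀ φ, ∃ hy : toH hM φ ∈ (friedrichs hM).domain,
      friedrichs hM ⟨toH hM φ, hy⟩ = toH hM (waveTest M φ) := by
    intro φ
    refine friedrichs_apply hM (testForm_mem hM φ) fun ψ => ?_
    have h := inner_toH_waveTest hM (hasWeakGrad_testFun ψ.2)
      (fun i => testFun_memL2loc (pd_mem i ψ.2)) (testFun_memLp hM ψ)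
      (fun i => testFun_memLp_volume (wgrad_mem hM ψ.2 i) 2) φ
    have h' := congrArg (starRingEnd ℂ) h
    rw [map_add, inner_conj_symm, inner_conj_symm, inner_conj_symm] at h'
    exact h'
  constructor
  · rintro _ ⟨φ, rfl⟩
    exact (key φ).1
  · rintro ⟨_, φ, rfl⟩ ⟨y, hy⟩ h
    obtain rfl : toH hM φ = y := h
    rw [waveOp_apply hM φ _ rfl]
    exact (key φ).2.symm

/-! ### Elements of the form domain have finite energy -/

theorem lintegral_enorm_sq_lt_top_iff {f : E3 → ℂ} :
    ∫⁻ x, ‖f x‖ₑ ^ 2 < ⊤ ↔ eLpNorm f 2 volume < ⊤ := by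
  have h := eLpNorm_nnreal_pow_eq_lintegral (μ := (volume : Measure E3)) (f := f) (p := 2) (by simp)
  have h2 : ∫⁻ x, ‖f x‖ₑ ^ 2 = eLpNorm f 2 volume ^ 2 := by
    simpa using h.symm
  rw [h2]
  simp [ENNReal.pow_lt_top_iff]

theorem measurable_rhat_coord (i : Fin 3) : Measurable fun x : E3 => ((rhat x i : ℝ) : ℂ) := by
  have : ∀ x : E3, rhat x i = ‖x‖⁻¹ * x i := fun x => rhat_apply x i
  simp only [this]
  fun_prop

theorem memLp_rhat_mul {f : E3 → ℂ} (hf : MemLp f 2 volume) (i : Fin 3) :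
    MemLp (fun x => (rhat x i : ℂ) * f x) 2 volume := by
  refine hf.of_le ((measurable_rhat_coord i).aestronglyMeasurable.mul hf.1) (.of_forall fun x => ?_)
  rw [norm_mul]
  exact mul_le_of_le_one_left (norm_nonneg _) (norm_rhat_apply_le x i)

theorem memLp_radPart {g : Fin 3 → E3 → ℂ} (hg : ∀ i, MemLp (g i) 2 volume) :
    MemLp (radPart g) 2 volume :=
  memLp_finsetSum Finset.univ fun i _ => memLp_rhat_mul (hg i) i

theorem memLp_tanPart {g : Fin 3 → E3 → ℂ} (hg : ∀ i, MemLp (g i) 2 volume) (i : Fin 3) :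
    MemLp (tanPart g i) 2 volume :=
  (hg i).sub (memLp_rhat_mul (memLp_radPart hg) i)

theorem enorm_sqrt_lapse_mul_sq {M : ℝ} (hM : 0 < M) (x : E3) (c : ℂ) :
    ‖((√(lapse M x) : ℝ) : ℂ) * c‖ₑ ^ 2 = ENNReal.ofReal (lapse M x) * ‖c‖ₑ ^ 2 := by
  rw [enorm_mul, mul_pow, ← ofReal_norm (((√(lapse M x) : ℝ) : ℂ)), Complex.norm_real,
    Real.norm_eq_abs, abs_of_nonneg (Real.sqrt_nonneg _), ← ENNReal.ofReal_pow (Real.sqrt_nonneg _),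
    Real.sq_sqrt (lapse_pos hM x).le]

theorem energy_lt_top {M : ℝ} (hM : 0 < M) {G : Fin 3 → E3 → ℂ}
    (hg : ∀ i, MemLp (wgrad M G i) 2 volume) : energy M G < ⊤ := by
  have h1 : energy M G = ∫⁻ x, (‖radPart (wgrad M G) x‖ₑ ^ 2
      + ∑ i, ‖tanPart (wgrad M G) i x‖ₑ ^ 2) := by
    refine lintegral_congr_ae ?_
    filter_upwards [ae_mem_Om] with x hx
    simp only [wgrad, radPart_mix hx, tanPart_mix hx, enorm_sqrt_lapse_mul_sq hM]
  have hm : ∀ {f : E3 → ℂ}, MemLp f 2 volume → AEMeasurable fun x => ‖f x‖ₑ ^ 2 :=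
    fun hf => hf.1.enorm.pow_const 2
  rw [h1, lintegral_add_left' (hm (memLp_radPart hg)),
    lintegral_finsetSum' _ fun i _ => hm (memLp_tanPart hg i)]
  refine ENNReal.add_lt_top.2 ⟨lintegral_enorm_sq_lt_top_iff.2 (memLp_radPart hg).2, ?_⟩
  exact ENNReal.sum_lt_top.2 fun i _ => lintegral_enorm_sq_lt_top_iff.2 (memLp_tanPart hg i).2

theorem aestronglyMeasurable_of_locallyIntegrableOn {f : E3 → ℂ} (hf : LocallyIntegrableOn f Om) :
    AEStronglyMeasurable f volume := by
  have h := hf.aestronglyMeasurable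
  rwa [Measure.restrict_eq_self_of_ae_mem ae_mem_Om] at h

theorem aestronglyMeasurable_radPart {G : Fin 3 → E3 → ℂ}
    (hG : ∀ i, AEStronglyMeasurable (G i) volume) : AEStronglyMeasurable (radPart G) volume :=
  Finset.aestronglyMeasurable_fun_sum _ fun i _ =>
    (measurable_rhat_coord i).aestronglyMeasurable.mul (hG i)

theorem measurable_sqrt_lapse (M : ℝ) : Measurable fun x => ((√(lapse M x) : ℝ) : ℂ) :=
  Complex.measurable_ofReal.comp (measurable_lapse M).sqrt

theorem memLp_of_energy_lt_top {M : ℝ} (hM : 0 < M) {G : Fin 3 → E3 → ℂ}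
    (hG : ∀ i, AEStronglyMeasurable (G i) volume) (he : energy M G < ⊤) :
    MemLp (fun x => ((√(lapse M x) : ℝ) : ℂ) * radPart G x) 2 volume ∧
      ∀ i, MemLp (wgrad M G i) 2 volume := by
  have hr : AEStronglyMeasurable (radPart G) volume := aestronglyMeasurable_radPart hG
  have h1 : MemLp (fun x => ((√(lapse M x) : ℝ) : ℂ) * radPart G x) 2 volume := by
    refine ⟨(measurable_sqrt_lapse M).aestronglyMeasurable.mul hr,
      lintegral_enorm_sq_lt_top_iff.1 (lt_of_le_of_lt ?_ he)⟩
    refine lintegral_mono fun x => ?_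
    rw [enorm_sqrt_lapse_mul_sq hM]
    exact le_self_add
  have h2 : ∀ i, MemLp (tanPart G i) 2 volume := by
    intro i
    refine ⟨(hG i).sub ((measurable_rhat_coord i).aestronglyMeasurable.mul hr),
      lintegral_enorm_sq_lt_top_iff.1 (lt_of_le_of_lt ?_ he)⟩
    refine lintegral_mono fun x => ?_
    exact (Finset.single_le_sum (f := fun i => ‖tanPart G i x‖ₑ ^ 2) (fun _ _ => zero_le)
      (Finset.mem_univ i)).trans le_add_self
  refine ⟨h1, fun i => ((memLp_rhat_mul h1 i).add (h2 i)).ae_eq (.of_forall fun x => ?_)⟩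
  simp only [wgrad, mix, Pi.add_apply]
  ring

/-- For fixed η and i, the weak derivative identity is orthogonality to one vector of the form
space. Test forms satisfy it by integration by parts, so it passes to their closure. -/
theorem hasWeakGrad_of_mem_formDomain {M : ℝ} (hM : 0 < M) {z : FormSpace M}
    (hz : z ∈ formDomain hM) :
    HasWeakGrad z.fst (mix (fun x => (√(lapse M x))⁻¹) fun i => z.snd i) := by
  set c : E3 → ℝ := fun x => (√(lapse M x))⁻¹ with hc
  have hcs : ∀ x ∈ Om, ContDiffAt ℝ ∞ c x := fun x hx => contDiffAt_inv_sqrt_lapse hM hx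
  have hg2 : ∀ i, MemL2loc (z.snd i) := fun i => MemL2loc.of_memLp (Lp.memLp _)
  have hG2 : ∀ i, MemL2loc (mix c (fun i => z.snd i) i) := MemL2loc.mix (continuousOn_ofReal hcs) hg2
  have hu : MemL2loc z.fst := memL2loc_of_memLp hM (Lp.memLp _)
  refine ⟨hu.locallyIntegrableOn, fun i => ⟨(hG2 i).locallyIntegrableOn, fun η hη => ?_⟩⟩
  -- The testing vector has function part W times the conjugate of ∂ᵢη, the W cancelling the weight
  -- of H, and vector part `mix c F` with c = W^(-1/2), which undoes the weight in the weighted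
  -- gradient.
  set F : Fin 3 → E3 → ℂ := fun j => if j = i then (fun x => starRingEnd ℂ (η x)) else 0 with hF
  have hFm : ∀ j, F j ∈ testFun := fun j => by
    by_cases h : j = i
    · simpa [hF, h] using! conj_mem hη
    · simp [hF, h, testFun.zero_mem]
  have hk : ∀ j, mix c F j ∈ testFun := mix_mem hcs hFm
  have ha : (fun x => (lapse M x : ℂ) * starRingEnd ℂ (pd i η x)) ∈ testFun :=
    mul_mem_testFun (conj_mem (pd_mem i hη)) fun x hx => contDiffAt_lapse M hx
  have hsum : ∀ (k : Fin 3 → E3 → ℂ) (x : E3), x ∈ Om →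
      ∑ j, starRingEnd ℂ (mix c F j x) * k j x = mix c k i x * η x := by
    intro k x _
    simp only [conj_mix, sum_mix_mul]
    rw [Finset.sum_eq_single i]
    · simp [hF, mul_comm]
    · intro j _ hj
      simp [hF, hj]
    · simp
  have hfst : ∀ (v : E3 → ℂ) (x : E3), ((lapse M x)⁻¹ : ℝ) *
      (starRingEnd ℂ ((lapse M x : ℂ) * starRingEnd ℂ (pd i η x)) * v x) = v x * pd i η x := by
    intro v x
    have : (lapse M x : ℂ) ≠ 0 := by exact_mod_cast (lapse_pos hM x).ne'
    simp only [map_mul, Complex.conj_ofReal, Complex.conj_conj]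
    push_cast
    field_simp
  have h1 := (mem_formDomain_iff hM).1 hz (mkForm (testFun_memLp hM ⟨_, ha⟩)
    fun j => testFun_memLp_volume (hk j) 2) fun φ => by
      rw [testForm, inner_mkForm hM]
      simp only [hfst]
      rw [← integral_finsetSum]
      · have h2 := ((hasWeakGrad_testFun φ.2).2 i).2 η hη
        change ∫ x, (φ : E3 → ℂ) x * pd i η x = _ at h2
        rw [h2, neg_add_eq_zero]
        refine integral_congr_ae ?_
        filter_upwards [ae_mem_Om] with x hx
        rw [hsum _ x hx, wgrad, mix_mix hx, mix_one]
        exact inv_mul_cancel₀ (Real.sqrt_pos.2 (lapse_pos hM x)).ne'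
      · intro j _
        exact (testFun_memL2loc (conj_mem (hk j))).integrable_mul (wgrad_mem hM φ.2 j)
  rw [inner_mkForm_left hM] at h1
  simp only [hfst] at h1
  rw [← integral_finsetSum] at h1
  · change ∫ x, z.fst x * pd i η x = _
    rw [eq_neg_iff_add_eq_zero, ← h1]
    congr 1
    refine integral_congr_ae ?_
    filter_upwards [ae_mem_Om] with x hx
    rw [hsum _ x hx]
  · intro j _
    refine ((hg2 j).integrable_mul (conj_mem (hk j))).congr (.of_forall fun x => ?_)
    ring

theorem mem_energySpace_of_mem_formDomain {M : ℝ} (hM : 0 < M) {z : FormSpace M}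
    (hz : z ∈ formDomain hM) : z.fst ∈ energySpace M := by
  refine ⟨memL2loc_of_memLp hM (Lp.memLp _), _, hasWeakGrad_of_mem_formDomain hM hz, ?_, ?_⟩
  · exact MemL2loc.mix (continuousOn_ofReal fun x hx => contDiffAt_inv_sqrt_lapse hM hx)
      fun i => MemL2loc.of_memLp (Lp.memLp _)
  · refine energy_lt_top hM fun i => (Lp.memLp (z.snd i)).ae_eq ?_
    filter_upwards [ae_mem_Om] with x hx
    rw [wgrad, mix_mix hx, mix_one]
    exact mul_inv_cancel₀ (Real.sqrt_pos.2 (lapse_pos hM x)).ne'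

/-! ### Logarithmic cutoffs -/

/-- `Real.smoothTransition` attains its minimum 0 on t ≤ 0 and its maximum 1 on 1 ≤ t, so the
endpoints are covered as well. -/
theorem deriv_smoothTransition_eq_zero {t : ℝ} (ht : t ≤ 0 ∨ 1 ≤ t) :
    deriv Real.smoothTransition t = 0 := by
  rcases ht with ht | ht
  · refine IsLocalMin.deriv_eq_zero (.of_forall fun y => ?_)
    rw [Real.smoothTransition.zero_of_nonpos ht]
    exact Real.smoothTransition.nonneg y
  · refine IsLocalMax.deriv_eq_zero (.of_forall fun y => ?_)
    rw [Real.smoothTransition.one_of_one_le ht]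
    exact Real.smoothTransition.le_one y

theorem hasDerivAt_smoothTransition (t : ℝ) :
    HasDerivAt Real.smoothTransition (deriv Real.smoothTransition t) t :=
  ((Real.smoothTransition.contDiff (n := 1)).differentiable (by simp) t).hasDerivAt

theorem deriv_smoothTransition_nonneg (t : ℝ) : 0 ≤ deriv Real.smoothTransition t :=
  Real.smoothTransition.monotone.deriv_nonneg

theorem exists_deriv_smoothTransition_le : ∃ C, ∀ t, deriv Real.smoothTransition t ≤ C := by
  have hc : Continuous (deriv Real.smoothTransition) :=
    (Real.smoothTransition.contDiff (n := 1)).continuous_deriv (by simp)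
  obtain ⟨C, hC⟩ := (isCompact_Icc (a := (0 : ℝ)) (b := 1)).exists_bound_of_continuousOn
    hc.continuousOn
  have hC0 : 0 ≤ C := (norm_nonneg _).trans (hC 0 (by simp))
  refine ⟨C, fun t => ?_⟩
  by_cases ht : t ∈ Icc (0 : ℝ) 1
  · exact (le_abs_self _).trans (hC t ht)
  · rw [deriv_smoothTransition_eq_zero]
    · exact hC0
    · by_contra h
      push Not at h
      exact ht ⟨h.1.le, h.2.le⟩

/-- A smooth function equal to `1` on `[2/N, N]` and to `0` outside `[1/N, 2N]`. -/
def cutoff (N : ℕ) (s : ℝ) : ℝ :=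
  Real.smoothTransition ((N + 1) * s - 1) * Real.smoothTransition (2 - s / (N + 1))

/-- The derivative of `cutoff N`. -/
def cutoff' (N : ℕ) (s : ℝ) : ℝ :=
  (N + 1) * deriv Real.smoothTransition ((N + 1) * s - 1) * Real.smoothTransition (2 - s / (N + 1))
  - Real.smoothTransition ((N + 1) * s - 1) *
    (deriv Real.smoothTransition (2 - s / (N + 1)) / (N + 1))

theorem hasDerivAt_cutoff (N : ℕ) (s : ℝ) : HasDerivAt (cutoff N) (cutoff' N s) s := by
  have h1 : HasDerivAt (fun s : ℝ => ((N : ℝ) + 1) * s - 1) ((N : ℝ) + 1) s := by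
    simpa using ((hasDerivAt_id s).const_mul ((N : ℝ) + 1)).sub_const 1
  have h2 : HasDerivAt (fun s : ℝ => 2 - s / ((N : ℝ) + 1)) (-(1 / ((N : ℝ) + 1))) s := by
    simpa using ((hasDerivAt_id s).div_const ((N : ℝ) + 1)).const_sub 2
  have h3 := ((hasDerivAt_smoothTransition _).comp s h1).mul
    ((hasDerivAt_smoothTransition _).comp s h2)
  refine h3.congr_deriv ?_
  simp only [cutoff', Function.comp_apply]
  ring

theorem contDiff_cutoff (N : ℕ) : ContDiff ℝ ∞ (cutoff N) :=
  (Real.smoothTransition.contDiff.comp (by fun_prop)).mul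
    (Real.smoothTransition.contDiff.comp (by fun_prop))

theorem cutoff_nonneg (N : ℕ) (s : ℝ) : 0 ≤ cutoff N s :=
  mul_nonneg (Real.smoothTransition.nonneg _) (Real.smoothTransition.nonneg _)

theorem cutoff_le_one (N : ℕ) (s : ℝ) : cutoff N s ≤ 1 :=
  mul_le_one₀ (Real.smoothTransition.le_one _) (Real.smoothTransition.nonneg _)
    (Real.smoothTransition.le_one _)

theorem mem_of_cutoff_ne_zero {N : ℕ} {s : ℝ} (h : cutoff N s ≠ 0) :
    1 / ((N : ℝ) + 1) < s ∧ s < 2 * (N + 1) := by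
  have hN : (0 : ℝ) < N + 1 := by positivity
  obtain ⟨h1, h2⟩ := mul_ne_zero_iff.1 h
  rw [Ne, Real.smoothTransition.zero_iff_nonpos, not_le] at h1 h2
  constructor
  · rw [div_lt_iff₀ hN]; linarith
  · rw [sub_pos, div_lt_iff₀ hN] at h2; linarith

theorem cutoff_eq_one {N : ℕ} {s : ℝ} (h1 : 2 ≤ (N + 1) * s) (h2 : s ≤ N + 1) :
    cutoff N s = 1 := by
  have hN : (0 : ℝ) < N + 1 := by positivity
  have : s / (N + 1) ≤ 1 := (div_le_one hN).2 h2
  rw [cutoff, Real.smoothTransition.one_of_one_le (by linarith),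
    Real.smoothTransition.one_of_one_le (by linarith), one_mul]

theorem cutoff'_eq_zero {N : ℕ} {s : ℝ} (h1 : 2 ≤ (N + 1) * s) (h2 : s ≤ N + 1) :
    cutoff' N s = 0 := by
  have hN : (0 : ℝ) < N + 1 := by positivity
  have : s / (N + 1) ≤ 1 := (div_le_one hN).2 h2
  rw [cutoff', deriv_smoothTransition_eq_zero (Or.inr (by linarith)),
    deriv_smoothTransition_eq_zero (Or.inr (by linarith))]
  simp

theorem eventually_cutoff {s : ℝ} (hs : 0 < s) :
    ∀ᶠ N : ℕ in atTop, cutoff N s = 1 ∧ cutoff' N s = 0 := by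
  filter_upwards [tendsto_natCast_atTop_atTop.eventually_ge_atTop s,
    tendsto_natCast_atTop_atTop.eventually_ge_atTop (2 / s)] with N h1 h2
  have h3 : 2 ≤ ((N : ℝ) + 1) * s := by
    rw [div_le_iff₀ hs] at h2
    linarith
  exact ⟨cutoff_eq_one h3 (by linarith), cutoff'_eq_zero h3 (by linarith)⟩

/-- Since N + 1 ≥ 1, the rising factor is already constant for s ≥ 2, uniformly in N, and only the
decreasing factor varies. -/
theorem cutoff'_nonpos {N : ℕ} {s : ℝ} (hs : 2 ≤ s) : cutoff' N s ≤ 0 := by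
  have hN : (0 : ℝ) ≤ N := by positivity
  have : 2 ≤ ((N : ℝ) + 1) * s := by nlinarith
  rw [cutoff', deriv_smoothTransition_eq_zero (Or.inr (by linarith))]
  have := mul_nonneg (Real.smoothTransition.nonneg (((N : ℝ) + 1) * s - 1))
    (div_nonneg (deriv_smoothTransition_nonneg (2 - s / (N + 1)))
      (by positivity : (0 : ℝ) ≤ N + 1))
  linarith

/-- The rising factor varies only where (N + 1)s ≤ 2, so its slope of order N + 1 is at most of
order 1/s. The falling one varies only where s ≤ 2(N + 1), so its slope of order 1/(N + 1) is too.
-/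
theorem exists_abs_cutoff'_le : ∃ C, 0 ≤ C ∧ ∀ (N : ℕ) (s : ℝ), 0 < s → |cutoff' N s| ≤ C / s := by
  obtain ⟨C, hC⟩ := exists_deriv_smoothTransition_le
  have hC0 : 0 ≤ C := (deriv_smoothTransition_nonneg 0).trans (hC 0)
  refine ⟨4 * C, by positivity, fun N s hs => ?_⟩
  have hN : (0 : ℝ) < N + 1 := by positivity
  have h1 : |(N + 1) * deriv Real.smoothTransition ((N + 1) * s - 1)| ≤ 2 * C / s := by
    rw [abs_of_nonneg (mul_nonneg hN.le (deriv_smoothTransition_nonneg _)), le_div_iff₀ hs]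
    by_cases h : 1 ≤ (N + 1) * s - 1
    · rw [deriv_smoothTransition_eq_zero (Or.inr h)]
      simp; positivity
    · have h2 : (N + 1) * s ≤ 2 := by linarith
      have := hC ((N + 1) * s - 1)
      have h3 := deriv_smoothTransition_nonneg (((N : ℝ) + 1) * s - 1)
      calc _ = ((N + 1) * s) * deriv Real.smoothTransition ((N + 1) * s - 1) := by ring
        _ ≤ 2 * C := mul_le_mul h2 this h3 (by norm_num)
  have h2 : |deriv Real.smoothTransition (2 - s / (N + 1)) / (N + 1)| ≤ 2 * C / s := by
    rw [abs_of_nonneg (div_nonneg (deriv_smoothTransition_nonneg _) hN.le), le_div_iff₀ hs]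
    by_cases h : 2 - s / (N + 1) ≤ 0
    · rw [deriv_smoothTransition_eq_zero (Or.inl h)]
      simp; positivity
    · have h3 : s / (N + 1) ≤ 2 := by linarith
      calc _ = (s / (N + 1)) * deriv Real.smoothTransition (2 - s / (N + 1)) := by ring
        _ ≤ 2 * C := mul_le_mul h3 (hC _) (deriv_smoothTransition_nonneg _) (by norm_num)
  have hσ : ∀ t, |Real.smoothTransition t| ≤ 1 := fun t => by
    rw [abs_of_nonneg (Real.smoothTransition.nonneg t)]
    exact Real.smoothTransition.le_one t
  rw [cutoff']
  refine (abs_sub _ _).trans ?_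
  rw [abs_mul (((N : ℝ) + 1) * deriv Real.smoothTransition ((N + 1) * s - 1)),
    abs_mul (Real.smoothTransition ((N + 1) * s - 1))]
  have h3 := mul_le_mul h1 (hσ (2 - s / (N + 1))) (abs_nonneg _) (by positivity)
  have h4 := mul_le_mul (hσ ((N + 1) * s - 1)) h2 (abs_nonneg _) (by positivity)
  calc _ ≤ 2 * C / s * 1 + 1 * (2 * C / s) := add_le_add h3 h4
    _ = 4 * C / s := by ring

/-! ### The logarithmic radial coordinate -/

/-- The coordinate `log (1 + 2M/r)`, which is harmonic for `A`. -/
def logLapse (M : ℝ) (r : ℝ) : ℝ := Real.log (1 + 2 * M / r)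

theorem one_lt_lapse {M : ℝ} (hM : 0 < M) {r : ℝ} (hr : 0 < r) : 1 < 1 + 2 * M / r := by
  have : 0 < 2 * M / r := by positivity
  linarith

theorem logLapse_pos {M : ℝ} (hM : 0 < M) {r : ℝ} (hr : 0 < r) : 0 < logLapse M r :=
  Real.log_pos (one_lt_lapse hM hr)

theorem hasDerivAt_logLapse {M : ℝ} (hM : 0 < M) {r : ℝ} (hr : 0 < r) :
    HasDerivAt (logLapse M) (-(2 * M) / (r ^ 2 * (1 + 2 * M / r))) r := by
  have h1 : HasDerivAt (fun r : ℝ => 1 + 2 * M / r) (-(2 * M) / r ^ 2) r := by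
    have := ((hasDerivAt_inv hr.ne').const_mul (2 * M)).const_add 1
    simp only [← div_eq_mul_inv] at this
    refine this.congr_deriv ?_
    field_simp
  have h0 := one_lt_lapse hM hr
  refine (h1.log (by linarith)).congr_deriv ?_
  rw [div_div]

theorem contDiffAt_logLapse_norm {M : ℝ} (hM : 0 < M) {x : E3} (hx : x ∈ Om) :
    ContDiffAt ℝ ∞ (fun y : E3 => logLapse M ‖y‖) x :=
  (contDiffAt_lapse M hx).log (lapse_pos hM x).ne'

/-- A function smooth on `Ω` vanishing outside a compact subset of `Ω` is a test function. -/
theorem mem_testFun_of_compact {f : E3 → ℂ} (hf : ∀ x ∈ Om, ContDiffAt ℝ ∞ f x) {K : Set E3}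
    (hK : IsCompact K) (hKO : K ⊆ Om) (h0 : ∀ x ∉ K, f x = 0) : f ∈ testFun := by
  have hs : tsupport f ⊆ K := closure_minimal (fun x hx => by
    by_contra h
    exact hx (h0 x h)) hK.isClosed
  refine ⟨contDiff_iff_contDiffAt.2 fun x => ?_,
    hK.of_isClosed_subset (isClosed_tsupport _) hs, hs.trans hKO⟩
  by_cases hx : x ∈ tsupport f
  · exact hf x (hKO (hs hx))
  · exact contDiffAt_const.congr_of_eventuallyEq (notMem_tsupport_iff_eventuallyEq.1 hx)

theorem isCompact_annulus (a b : ℝ) : IsCompact {x : E3 | a ≤ ‖x‖ ∧ ‖x‖ ≤ b} := by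
  refine (isCompact_closedBall (0 : E3) b).of_isClosed_subset ?_ fun x hx => by simpa using hx.2
  exact (isClosed_le continuous_const continuous_norm).inter
    (isClosed_le continuous_norm continuous_const)

theorem annulus_subset {a b : ℝ} (ha : 0 < a) : {x : E3 | a ≤ ‖x‖ ∧ ‖x‖ ≤ b} ⊆ Om :=
  fun _ hx => norm_pos_iff.1 (ha.trans_le hx.1)

/-- The radial cutoff on `Ω`. -/
def radCutoff (M : ℝ) (N : ℕ) (x : E3) : ℂ := ((cutoff N (logLapse M ‖x‖) : ℝ) : ℂ)

theorem radCutoff_mem {M : ℝ} (hM : 0 < M) (N : ℕ) : radCutoff M N ∈ testFun := by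
  have hN : (0 : ℝ) < N + 1 := by positivity
  -- The radii a and b solve log(1 + 2M/r) = 2(N + 1) and log(1 + 2M/r) = 1/(N + 1).
  set a := 2 * M / (Real.exp (2 * (N + 1)) - 1)
  set b := 2 * M / (Real.exp (1 / (N + 1)) - 1)
  have ha1 : 0 < Real.exp (2 * ((N : ℝ) + 1)) - 1 := by
    have := Real.add_one_lt_exp (x := 2 * ((N : ℝ) + 1)) (by positivity)
    linarith
  have hb1 : 0 < Real.exp (1 / ((N : ℝ) + 1)) - 1 := by
    have := Real.add_one_lt_exp (x := 1 / ((N : ℝ) + 1)) (by positivity)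
    have : 0 < 1 / ((N : ℝ) + 1) := by positivity
    linarith
  refine mem_testFun_of_compact (K := {x : E3 | a ≤ ‖x‖ ∧ ‖x‖ ≤ b}) (fun x hx => ?_)
    (isCompact_annulus a b) (annulus_subset (by positivity)) fun x hx => ?_
  · exact contDiffAt_ofReal ((contDiff_cutoff N).contDiffAt.comp x (contDiffAt_logLapse_norm hM hx))
  · by_contra h
    have h1 : cutoff N (logLapse M ‖x‖) ≠ 0 := fun h' => h (by simp [radCutoff, h'])
    obtain ⟨h2, h3⟩ := mem_of_cutoff_ne_zero h1
    -- At the origin 2M/0 = 0, so `logLapse` takes the value 0, which lies below the support of the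
    -- cutoff.
    have hx0 : 0 < ‖x‖ := by
      rw [norm_pos_iff]
      rintro rfl
      have : 0 < 1 / ((N : ℝ) + 1) := by positivity
      simp [logLapse] at h2
      linarith [inv_pos.2 hN]
    have hW := one_lt_lapse hM hx0
    rw [logLapse, Real.lt_log_iff_exp_lt (by linarith)] at h2
    rw [logLapse, Real.log_lt_iff_lt_exp (by linarith)] at h3
    refine hx ⟨?_, ?_⟩
    · rw [div_le_iff₀ ha1, ← div_le_iff₀' hx0]
      linarith
    · rw [le_div_iff₀ hb1, ← le_div_iff₀' hx0]
      linarith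

theorem hasDerivAt_cutoff_logLapse {M : ℝ} (hM : 0 < M) (N : ℕ) {r : ℝ} (hr : 0 < r) :
    HasDerivAt (fun r => cutoff N (logLapse M r))
      (cutoff' N (logLapse M r) * (-(2 * M) / (r ^ 2 * (1 + 2 * M / r)))) r :=
  (hasDerivAt_cutoff N _).comp r (hasDerivAt_logLapse hM hr)

theorem pd_radCutoff {M : ℝ} (hM : 0 < M) (N : ℕ) {x : E3} (hx : x ∈ Om) (i : Fin 3) :
    pd i (radCutoff M N) x = ((cutoff' N (logLapse M ‖x‖) *
      (-(2 * M) / (‖x‖ ^ 2 * lapse M x)) : ℝ) : ℂ) * rhat x i :=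
  pd_radial hx (hasDerivAt_cutoff_logLapse hM N (norm_pos_of_mem_Om hx)) i

/-! ### A Hardy inequality -/

section Hardy

variable {u : E3 → ℂ} {G : Fin 3 → E3 → ℂ}

theorem continuousOn_coord (i : Fin 3) : ContinuousOn (fun x : E3 => ((x i : ℝ) : ℂ)) Om :=
  (coordCLM i).continuous.continuousOn

theorem HasWeakGrad.integral_conj_mul_pd (hu : MemL2loc u) (hG : ∀ i, MemL2loc (G i))
    (hw : HasWeakGrad u G) {η : E3 → ℂ} (hη : η ∈ testFun) (i : Fin 3) :
    ∫ x, (starRingEnd ℂ (u x) * pd i η x + starRingEnd ℂ (G i x) * η x) = 0 := by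
  rw [integral_add (hu.conj.integrable_mul (pd_mem i hη)) ((hG i).conj.integrable_mul hη)]
  have h2 := (hw.2 i).2 _ (conj_mem hη)
  have h3 : ∀ x, fderiv ℝ (fun x => starRingEnd ℂ (η x)) x (bvec i)
      = starRingEnd ℂ (pd i η x) := fun x => pd_conj i (differentiable_of_mem hη x)
  simp only [h3] at h2
  have h4 := congrArg (starRingEnd ℂ) h2
  rw [map_neg, ← integral_conj, ← integral_conj] at h4
  simp only [map_mul, Complex.conj_conj] at h4
  rw [h4, neg_add_cancel]

/-- Integration of `div (|u|² χ x)`. -/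
theorem integral_div_sq_mul (hu : MemL2loc u) (hG : ∀ i, MemL2loc (G i)) (hw : HasWeakGrad u G)
    {χ : E3 → ℂ} (hχ : χ ∈ testFun) :
    Integrable (fun x => (3 * starRingEnd ℂ (u x) + ∑ i, (x i : ℂ) * starRingEnd ℂ (G i x)) *
      (χ x * u x) + ∑ i, ((x i : ℂ) * starRingEnd ℂ (u x)) * (χ x * G i x + u x * pd i χ x)) ∧
    ∫ x, ((3 * starRingEnd ℂ (u x) + ∑ i, (x i : ℂ) * starRingEnd ℂ (G i x)) * (χ x * u x) +
      ∑ i, ((x i : ℂ) * starRingEnd ℂ (u x)) * (χ x * G i x + u x * pd i χ x)) = 0 := by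
  have ha : MemL2loc fun x => 3 * starRingEnd ℂ (u x) + ∑ i, (x i : ℂ) * starRingEnd ℂ (G i x) :=
    (hu.conj.mul_continuousOn (c := fun _ => 3) continuousOn_const).add
      (MemL2loc.sum fun i _ => (hG i).conj.mul_continuousOn (continuousOn_coord i))
  have hb : ∀ i, MemL2loc fun x => (x i : ℂ) * starRingEnd ℂ (u x) := fun i =>
    hu.conj.mul_continuousOn (continuousOn_coord i)
  constructor
  · refine (((ha.integrable_mul_mul hu hχ)).congr (.of_forall fun x => by ring)).add
      (integrable_finsetSum _ fun i _ => ?_)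
    refine (((hb i).integrable_mul_mul (hG i) hχ).add
      ((hb i).integrable_mul_mul hu (pd_mem i hχ))).congr (.of_forall fun x => ?_)
    simp only [Pi.add_apply]
    ring
  -- Freeze the conjugate of u and regard the identity as linear in χ u. With a test function φ in
  -- place of χ u, it is the sum over i of the weak derivative of the conjugate of u tested against
  -- xᵢ φ.
  · refine integral_eq_zero_of_hasWeakGrad ha hb (fun φ hφ => ?_) hu hG hw hχ
    have hm : ∀ i : Fin 3, (fun x => (x i : ℂ) * φ x) ∈ testFun := fun i =>
      smooth_mul_mem hφ fun x _ => contDiffAt_coord i x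
    have h1 : ∀ i, ∫ x, (starRingEnd ℂ (u x) * pd i (fun x => (x i : ℂ) * φ x) x
        + starRingEnd ℂ (G i x) * ((x i : ℂ) * φ x)) = 0 := fun i =>
      hw.integral_conj_mul_pd hu hG (hm i) i
    have h2 : ∑ i, ∫ x, (starRingEnd ℂ (u x) * pd i (fun x => (x i : ℂ) * φ x) x
        + starRingEnd ℂ (G i x) * ((x i : ℂ) * φ x)) = 0 := Finset.sum_eq_zero fun i _ => h1 i
    rw [← integral_finsetSum] at h2
    · rw [← h2]
      refine integral_congr_ae (.of_forall fun x => ?_)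
      have h3 : ∀ i, pd i (fun x => (x i : ℂ) * φ x) x = φ x + x i * pd i φ x := fun i => by
        rw [pd_mul i ((contDiffAt_coord i x).differentiableAt (by simp))
          (differentiable_of_mem hφ x), pd_coord, one_mul]
      simp only [h3, Fin.sum_univ_three]
      ring
    · exact fun i _ => (hu.conj.integrable_mul (pd_mem i (hm i))).add
        ((hG i).conj.integrable_mul (hm i))

/-- For χ = κ(r), this evaluates div(|u|² χ x) in polar terms: only radial derivatives survive, and
the two conjugate cross terms combine into twice a real part. -/
theorem div_sq_mul_eq {κ : ℝ → ℝ} {κ' : ℝ} {x : E3} (hx : x ∈ Om) (hκ : HasDerivAt κ κ' ‖x‖) :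
    (3 * starRingEnd ℂ (u x) + ∑ i, (x i : ℂ) * starRingEnd ℂ (G i x)) * ((κ ‖x‖ : ℝ) * u x) +
      ∑ i, ((x i : ℂ) * starRingEnd ℂ (u x)) *
        ((κ ‖x‖ : ℝ) * G i x + u x * pd i (fun y => ((κ ‖y‖ : ℝ) : ℂ)) x)
    = ((‖u x‖ ^ 2 * (3 * κ ‖x‖ + ‖x‖ * κ')
        + 2 * (κ ‖x‖ * ‖x‖) * (starRingEnd ℂ (u x) * radPart G x).re : ℝ) : ℂ) := by
  have h1 : ∑ i, (x i : ℂ) * starRingEnd ℂ (G i x) = ‖x‖ * starRingEnd ℂ (radPart G x) := by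
    simp only [radPart, map_sum, map_mul, Complex.conj_ofReal, Finset.mul_sum, coord_eq x]
    exact Finset.sum_congr rfl fun i _ => by ring
  have h2 : ∀ i, ((x i : ℂ) * starRingEnd ℂ (u x)) *
        ((κ ‖x‖ : ℝ) * G i x + u x * pd i (fun y => ((κ ‖y‖ : ℝ) : ℂ)) x)
      = ‖x‖ * (κ ‖x‖ : ℝ) * starRingEnd ℂ (u x) * (rhat x i * G i x)
        + ‖x‖ * κ' * starRingEnd ℂ (u x) * u x * (rhat x i * rhat x i) := fun i => by
    rw [pd_radial hx hκ, coord_eq x]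
    ring
  have h3 : ((2 * (starRingEnd ℂ (u x) * radPart G x).re : ℝ) : ℂ)
      = starRingEnd ℂ (u x) * radPart G x + u x * starRingEnd ℂ (radPart G x) := by
    have := Complex.add_conj (starRingEnd ℂ (u x) * radPart G x)
    rw [map_mul, Complex.conj_conj] at this
    rw [this]
  have h4 : ((‖u x‖ ^ 2 : ℝ) : ℂ) = starRingEnd ℂ (u x) * u x := by
    rw [← Complex.normSq_eq_norm_sq, Complex.normSq_eq_conj_mul_self]
  simp only [h1, h2, Finset.sum_add_distrib, ← Finset.mul_sum, sum_rhat_sq hx]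
  rw [show ∑ i, (rhat x i : ℂ) * G i x = radPart G x from rfl]
  have h5 : ((‖u x‖ ^ 2 * (3 * κ ‖x‖ + ‖x‖ * κ')
        + 2 * (κ ‖x‖ * ‖x‖) * (starRingEnd ℂ (u x) * radPart G x).re : ℝ) : ℂ)
      = ((‖u x‖ ^ 2 : ℝ) : ℂ) * (3 * κ ‖x‖ + ‖x‖ * κ')
        + (κ ‖x‖ * ‖x‖) * ((2 * (starRingEnd ℂ (u x) * radPart G x).re : ℝ) : ℂ) := by
    push_cast
    ring
  rw [h5, h4, h3]
  ring

/-- The left side is r⁻²(r³κ)'. The factor r⁻³ is chosen so that r³κ = k(s)/s, whose derivative is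
∂_r s (k'/s - k/s²), with ∂_r s = -2M/(r²W). -/
theorem hasDerivAt_hardy {M : ℝ} (hM : 0 < M) (N : ℕ) {r : ℝ} (hr : 0 < r) :
    ∃ κ', HasDerivAt (fun r => (logLapse M r * r ^ 3)⁻¹ * cutoff N (logLapse M r)) κ' r ∧
      3 * ((logLapse M r * r ^ 3)⁻¹ * cutoff N (logLapse M r)) + r * κ'
        = 2 * M * (r ^ 4 * (1 + 2 * M / r))⁻¹ * (cutoff N (logLapse M r) / logLapse M r ^ 2 -
          cutoff' N (logLapse M r) / logLapse M r) := by
  have hs := logLapse_pos hM hr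
  have hW := one_lt_lapse hM hr
  have h1 := ((hasDerivAt_logLapse hM hr).mul (hasDerivAt_pow 3 r)).fun_inv (by
    simp only [Pi.mul_apply]; positivity)
  refine ⟨_, h1.mul (hasDerivAt_cutoff_logLapse hM N hr), ?_⟩
  simp only [Pi.mul_apply]
  generalize cutoff N (logLapse M r) = k
  generalize cutoff' N (logLapse M r) = k'
  generalize logLapse M r = s at *
  have hW0 : 1 + 2 * M / r ≠ 0 := by linarith
  generalize 1 + 2 * M / r = W at *
  field_simp
  ring

/-- s ≤ 2 means W ≤ e², so r ≥ 2M/(e² - 1). Then log W ≥ 1 - 1/W gives r²s ≥ 2Mr/W, bounded below by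
the constant c. -/
theorem exists_hardy_far {M : ℝ} (hM : 0 < M) : ∃ C, 0 ≤ C ∧ ∀ r, 0 < r → logLapse M r ≤ 2 →
    (r ^ 4 * logLapse M r ^ 2)⁻¹ ≤ C := by
  have he : (1 : ℝ) < Real.exp 2 := by
    have := Real.add_one_lt_exp (x := 2) (by norm_num)
    linarith
  set c := 2 * M * (2 * M / (Real.exp 2 - 1)) / Real.exp 2 with hc
  have hc0 : 0 < c := by
    have : 0 < Real.exp 2 - 1 := by linarith
    positivity
  refine ⟨(c ^ 2)⁻¹, by positivity, fun r hr hs => ?_⟩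
  have hW := one_lt_lapse hM hr
  have hW2 : 1 + 2 * M / r ≤ Real.exp 2 := (Real.log_le_iff_le_exp (by linarith)).1 hs
  have h1 : 1 - (1 + 2 * M / r)⁻¹ ≤ logLapse M r :=
    Real.one_sub_inv_le_log_of_pos (by linarith)
  have h2 : 2 * M / (Real.exp 2 - 1) ≤ r := by
    rw [div_le_iff₀ (by linarith), ← div_le_iff₀' hr]
    linarith
  have h3 : c ≤ r ^ 2 * logLapse M r := by
    calc c ≤ 2 * M * r / (1 + 2 * M / r) := by
          rw [hc]; gcongr
      _ = r ^ 2 * (1 - (1 + 2 * M / r)⁻¹) := by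
          have : 1 + 2 * M / r ≠ 0 := by linarith
          field_simp
          ring
      _ ≤ _ := by gcongr
  have h4 : r ^ 4 * logLapse M r ^ 2 = (r ^ 2 * logLapse M r) ^ 2 := by ring
  rw [h4]
  gcongr

/-- The pointwise estimate behind the Hardy inequality. -/
theorem hardy_pointwise {M W s r k k' U R : ℝ} {C C₂ p : ℝ} (hM : 0 < M) (hW : 0 < W) (hs : 0 < s)
    (hr : 0 < r) (hk0 : 0 ≤ k) (hk1 : k ≤ 1) (hC : 0 ≤ C) (hC₂ : 0 ≤ C₂)
    (hk' : |k'| ≤ C / s) (hk2 : 2 ≤ s → k' ≤ 0) (hfar : s ≤ 2 → (r ^ 4 * s ^ 2)⁻¹ ≤ C₂)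
    (hp : |p| ≤ U * R) :
    M * (k * ((r ^ 4 * W)⁻¹ * U ^ 2 / s ^ 2)) ≤
      (U ^ 2 * (2 * M * (r ^ 4 * W)⁻¹ * (k / s ^ 2 - k' / s)) + 2 * ((s * r ^ 3)⁻¹ * k * r) * p)
      + (2 * M * C * C₂ * (W⁻¹ * U ^ 2) + M⁻¹ * (W * R ^ 2)) := by
  have hUR : 0 ≤ U * R := (abs_nonneg p).trans hp
  -- The identity supplies twice the quantity to be bounded. One copy absorbs the cross term by
  -- completing a square, which produces k², bounded by k since k ≤ 1.
  have h1 : M * (k * ((r ^ 4 * W)⁻¹ * U ^ 2 / s ^ 2)) * k ≤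
      M * (k * ((r ^ 4 * W)⁻¹ * U ^ 2 / s ^ 2)) :=
    mul_le_of_le_one_right (by positivity) hk1
  have h2 : -(2 * ((s * r ^ 3)⁻¹ * k * r) * p) ≤
      M * (k * ((r ^ 4 * W)⁻¹ * U ^ 2 / s ^ 2)) * k + M⁻¹ * (W * R ^ 2) := by
    have h3 : -(2 * ((s * r ^ 3)⁻¹ * k * r) * p) ≤ 2 * ((s * r ^ 3)⁻¹ * k * r) * (U * R) := by
      rw [← mul_neg]
      exact mul_le_mul_of_nonneg_left ((neg_le_abs p).trans hp) (by positivity)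
    refine h3.trans (sub_nonneg.1 ?_)
    have h4 : M * (k * ((r ^ 4 * W)⁻¹ * U ^ 2 / s ^ 2)) * k + M⁻¹ * (W * R ^ 2)
        - 2 * ((s * r ^ 3)⁻¹ * k * r) * (U * R) = (M * W)⁻¹ * (M * k * U / (s * r ^ 2) - W * R) ^ 2 := by
      field_simp
      ring
    rw [h4]
    positivity
  have h5 : U ^ 2 * (2 * M * (r ^ 4 * W)⁻¹ * (k' / s)) ≤ 2 * M * C * C₂ * (W⁻¹ * U ^ 2) := by
    -- Near the origin (s ≥ 2) the derivative of the cutoff has the favourable sign; away from it (s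
    -- ≤ 2) the term is bounded by the density of the norm of H.
    rcases le_total 2 s with h | h
    · have h6 : k' / s ≤ 0 := div_nonpos_of_nonpos_of_nonneg (hk2 h) hs.le
      have h7 : U ^ 2 * (2 * M * (r ^ 4 * W)⁻¹ * (k' / s)) ≤ 0 :=
        mul_nonpos_of_nonneg_of_nonpos (by positivity)
          (mul_nonpos_of_nonneg_of_nonpos (by positivity) h6)
      exact h7.trans (by positivity)
    · have h6 : k' / s ≤ C / s ^ 2 := by
        rw [div_le_div_iff₀ hs (by positivity)]
        have := (le_abs_self k').trans hk'
        rw [le_div_iff₀ hs] at this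
        nlinarith
      calc U ^ 2 * (2 * M * (r ^ 4 * W)⁻¹ * (k' / s))
          ≤ U ^ 2 * (2 * M * (r ^ 4 * W)⁻¹ * (C / s ^ 2)) := by gcongr
        _ = 2 * M * C * (r ^ 4 * s ^ 2)⁻¹ * (W⁻¹ * U ^ 2) := by field_simp
        _ ≤ _ := by
          have := hfar h
          gcongr
  have h8 : U ^ 2 * (2 * M * (r ^ 4 * W)⁻¹ * (k / s ^ 2 - k' / s))
      = 2 * (M * (k * ((r ^ 4 * W)⁻¹ * U ^ 2 / s ^ 2)))
        - U ^ 2 * (2 * M * (r ^ 4 * W)⁻¹ * (k' / s)) := by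
    ring
  rw [h8]
  linarith

/-- In the coordinate s this is the one-dimensional inequality bounding ∫ |u|²/s² ds by ∫ |∂_s u|²
ds, up to the norm of H, which replaces a boundary condition at s = 0. The proof integrates div(|u|²
κ x) with κ = k_N(s)/(s r³). -/
theorem hardy {M : ℝ} (hM : 0 < M) (hw : HasWeakGrad u G) (hG : ∀ i, MemL2loc (G i))
    (hu : MemLp u 2 (hMeasure M))
    (hE : MemLp (fun x => ((√(lapse M x) : ℝ) : ℂ) * radPart G x) 2 volume) :
    MemLp (fun x => (((logLapse M ‖x‖ * ‖x‖ ^ 2 * √(lapse M x))⁻¹ : ℝ) : ℂ) * u x) 2 volume := by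
  have hu2 : MemL2loc u := memL2loc_of_memLp hM hu
  have hum : AEStronglyMeasurable u volume := aestronglyMeasurable_of_locallyIntegrableOn hw.1
  obtain ⟨C, hC, hk'⟩ := exists_abs_cutoff'_le
  obtain ⟨C₂, hC₂, hfar⟩ := exists_hardy_far hM
  set q : E3 → ℝ := fun x => (‖x‖ ^ 4 * lapse M x)⁻¹ * ‖u x‖ ^ 2 / logLapse M ‖x‖ ^ 2 with hq
  set B : E3 → ℝ := fun x => 2 * M * C * C₂ * ((lapse M x)⁻¹ * ‖u x‖ ^ 2)
    + M⁻¹ * (lapse M x * ‖radPart G x‖ ^ 2) with hB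
  have hBi : Integrable B := by
    have h1 := (memLp_two_iff_integrable_sq_norm ((memLp_hMeasure_iff hM).1 hu).1).1
      ((memLp_hMeasure_iff hM).1 hu)
    have h2 := (memLp_two_iff_integrable_sq_norm hE.1).1 hE
    refine ((h1.const_mul (2 * M * C * C₂)).add (h2.const_mul M⁻¹)).congr (.of_forall fun x => ?_)
    have h0 := (lapse_pos hM x).le
    simp only [hB, Pi.add_apply, norm_mul, Complex.norm_real, Real.norm_eq_abs, mul_pow, sq_abs,
      inv_pow, Real.sq_sqrt h0]
  have hlm : Measurable fun x : E3 => logLapse M ‖x‖ := (measurable_lapse M).log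
  have hqm : AEMeasurable q volume :=
    ((((measurable_norm.pow_const 4).mul (measurable_lapse M)).inv.aemeasurable.mul
      (hum.norm.aemeasurable.pow_const 2))).div (hlm.pow_const 2).aemeasurable
  have hkm : ∀ N, AEMeasurable (fun x => cutoff N (logLapse M ‖x‖) * q x) volume := fun N =>
    ((contDiff_cutoff N).continuous.measurable.comp hlm).aemeasurable.mul hqm
  have hbound : ∀ N, ∫⁻ x, ENNReal.ofReal (M * (cutoff N (logLapse M ‖x‖) * q x)) ≤
      ENNReal.ofReal (∫ x, B x) := by
    intro N
    set κ : ℝ → ℝ := fun r => (logLapse M r * r ^ 3)⁻¹ * cutoff N (logLapse M r) with hκ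
    have hχ : (fun x : E3 => ((κ ‖x‖ : ℝ) : ℂ)) ∈ testFun := by
      have := mul_mem_testFun (c := fun x => (logLapse M ‖x‖ * ‖x‖ ^ 3)⁻¹) (radCutoff_mem hM N)
        fun x hx => ((contDiffAt_logLapse_norm hM hx).mul ((contDiffAt_norm_Om hx).pow 3)).inv (by
          have h1 := norm_pos_of_mem_Om hx
          have h2 := logLapse_pos hM h1
          positivity)
      convert this using 2 with x
      simp [hκ, radCutoff]
    obtain ⟨hi, hz⟩ := integral_div_sq_mul hu2 hG hw hχ
    set I : E3 → ℝ := fun x => ‖u x‖ ^ 2 * (2 * M * (‖x‖ ^ 4 * lapse M x)⁻¹ *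
        (cutoff N (logLapse M ‖x‖) / logLapse M ‖x‖ ^ 2 - cutoff' N (logLapse M ‖x‖) / logLapse M ‖x‖))
        + 2 * ((logLapse M ‖x‖ * ‖x‖ ^ 3)⁻¹ * cutoff N (logLapse M ‖x‖) * ‖x‖) *
          (starRingEnd ℂ (u x) * radPart G x).re with hI
    have hIe : ∀ᵐ x : E3, (3 * starRingEnd ℂ (u x) + ∑ i, (x i : ℂ) * starRingEnd ℂ (G i x)) *
        ((κ ‖x‖ : ℝ) * u x) + ∑ i, ((x i : ℂ) * starRingEnd ℂ (u x)) *
        ((κ ‖x‖ : ℝ) * G i x + u x * pd i (fun y => ((κ ‖y‖ : ℝ) : ℂ)) x) = ((I x : ℝ) : ℂ) := by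
      filter_upwards [ae_mem_Om] with x hx
      obtain ⟨κ', h1, h2⟩ := hasDerivAt_hardy hM N (norm_pos_of_mem_Om hx)
      rw [div_sq_mul_eq hx h1, h2]
      rfl
    have hIi : Integrable I := by
      have := (hi.congr hIe).re
      exact this
    have hI0 : ∫ x, I x = 0 := by
      rw [integral_congr_ae hIe, integral_complex_ofReal] at hz
      exact_mod_cast hz
    have hle : ∀ᵐ x : E3, M * (cutoff N (logLapse M ‖x‖) * q x) ≤ I x + B x := by
      filter_upwards [ae_mem_Om] with x hx
      have hr := norm_pos_of_mem_Om hx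
      have hs := logLapse_pos hM hr
      refine hardy_pointwise hM (lapse_pos hM x) hs hr (cutoff_nonneg _ _) (cutoff_le_one _ _)
        hC hC₂ (hk' N _ hs) cutoff'_nonpos (hfar _ hr) ?_
      refine (Complex.abs_re_le_norm _).trans (le_of_eq ?_)
      rw [norm_mul, RCLike.norm_conj]
    calc ∫⁻ x, ENNReal.ofReal (M * (cutoff N (logLapse M ‖x‖) * q x))
        ≤ ∫⁻ x, ENNReal.ofReal (I x + B x) := lintegral_mono_ae (by
          filter_upwards [hle] with x hx using ENNReal.ofReal_le_ofReal hx)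
      _ = ENNReal.ofReal (∫ x, (I x + B x)) := by
          rw [ofReal_integral_eq_lintegral_ofReal (f := fun x => I x + B x) (hIi.add hBi)]
          filter_upwards [hle] with x hx
          refine le_trans ?_ hx
          have := cutoff_nonneg N (logLapse M ‖x‖)
          have := lapse_pos hM x
          simp only [hq, Pi.zero_apply]
          positivity
      _ = ENNReal.ofReal (∫ x, B x) := by rw [integral_add hIi hBi, hI0, zero_add]
  -- The bound is uniform in N because the divergence I integrates to zero, and the cutoffs are
  -- eventually 1 at each point of Ω, so Fatou removes them.
  have hfatou : ∫⁻ x, ENNReal.ofReal (M * q x) ≤ ENNReal.ofReal (∫ x, B x) := by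
    calc ∫⁻ x, ENNReal.ofReal (M * q x)
        = ∫⁻ x, liminf (fun N => ENNReal.ofReal (M * (cutoff N (logLapse M ‖x‖) * q x))) atTop := by
          refine lintegral_congr_ae ?_
          filter_upwards [ae_mem_Om] with x hx
          have h1 := eventually_cutoff (logLapse_pos hM (norm_pos_of_mem_Om hx))
          refine (Tendsto.liminf_eq (tendsto_const_nhds.congr' ?_)).symm
          filter_upwards [h1] with N hN
          rw [hN.1, one_mul]
      _ ≤ liminf (fun N => ∫⁻ x, ENNReal.ofReal (M * (cutoff N (logLapse M ‖x‖) * q x))) atTop :=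
          lintegral_liminf_le' fun N => ((hkm N).const_mul M).ennreal_ofReal
      _ ≤ liminf (fun _ : ℕ => ENNReal.ofReal (∫ x, B x)) atTop :=
          liminf_le_liminf (.of_forall hbound)
      _ = _ := liminf_const _
  have hfm : AEStronglyMeasurable
      (fun x => (((logLapse M ‖x‖ * ‖x‖ ^ 2 * √(lapse M x))⁻¹ : ℝ) : ℂ) * u x) volume :=
    (Complex.measurable_ofReal.comp ((hlm.mul (measurable_norm.pow_const 2)).mul
      (measurable_lapse M).sqrt).inv).aestronglyMeasurable.mul hum
  rw [memLp_two_iff_integrable_sq_norm hfm]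
  have hq0 : ∀ x, 0 ≤ q x := fun x => by
    have := lapse_pos hM x
    simp only [hq]
    positivity
  have hqi : Integrable fun x => M * q x :=
    ⟨(hqm.const_mul M).aestronglyMeasurable, by
      rw [hasFiniteIntegral_iff_ofReal (.of_forall fun x => mul_nonneg hM.le (hq0 x))]
      exact hfatou.trans_lt ENNReal.ofReal_lt_top⟩
  refine (hqi.const_mul M⁻¹).congr (.of_forall fun x => ?_)
  have h0 := (lapse_pos hM x).le
  simp only [hq, norm_mul, Complex.norm_real, Real.norm_eq_abs, mul_pow, sq_abs, inv_pow,
    Real.sq_sqrt h0]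
  field_simp

end Hardy

/-! ### The energy space is the form domain -/

/-- Orthogonality of ξ to test forms extends to compactly supported χ_N u by mollification. As N
grows the only error pairs u ∂_rχ_N with the field of ξ; `hardy` dominates it, so ξ is orthogonal to
u together with its weighted gradient. -/
theorem mkForm_mem_formDomain {M : ℝ} (hM : 0 < M) {u : E3 → ℂ} {G : Fin 3 → E3 → ℂ}
    (hw : HasWeakGrad u G) (hG : ∀ i, MemL2loc (G i)) (hu : MemLp u 2 (hMeasure M))
    (hE : MemLp (fun x => ((√(lapse M x) : ℝ) : ℂ) * radPart G x) 2 volume)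
    (hg : ∀ i, MemLp (wgrad M G i) 2 volume) : mkForm hu hg ∈ formDomain hM := by
  rw [mem_formDomain_iff]
  intro ξ hξ
  have hu2 : MemL2loc u := memL2loc_of_memLp hM hu
  set c : E3 → ℝ := fun x => √(lapse M x) with hc
  set b : Fin 3 → E3 → ℂ := fun i x => starRingEnd ℂ (ξ.snd i x) with hb
  set a : E3 → ℂ := fun x => (((lapse M x)⁻¹ : ℝ) : ℂ) * starRingEnd ℂ (ξ.fst x) with ha
  have hb2 : ∀ i, MemLp (b i) 2 volume := fun i => (Lp.memLp (ξ.snd i)).star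
  have hcs : ∀ x ∈ Om, ContDiffAt ℝ ∞ c x := fun x hx => contDiffAt_sqrt_lapse hM hx
  have haL : MemL2loc a := (memL2loc_of_memLp hM (Lp.memLp ξ.fst)).conj.mul_continuousOn
    (continuousOn_ofReal fun x hx => (contDiffAt_lapse M hx).inv (lapse_pos hM x).ne')
  have hbL : ∀ i, MemL2loc (mix c b i) :=
    MemL2loc.mix (continuousOn_ofReal hcs) fun i => MemL2loc.of_memLp (hb2 i)
  have h1 : ∀ φ ∈ testFun, ∫ x, (a x * φ x + ∑ i, mix c b i x * pd i φ x) = 0 := by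
    intro φ hφ
    have h2 := hξ ⟨φ, hφ⟩
    have h3 : ∀ i, Integrable fun x => starRingEnd ℂ (ξ.snd i x) * wgrad M (fun j => pd j φ) i x :=
      fun i => (hb2 i).integrable_mul (testFun_memLp_volume (wgrad_mem hM hφ i) 2)
    rw [testForm, inner_mkForm_right hM, ← integral_finsetSum _ fun i _ => h3 i,
      ← integral_add] at h2
    · rw [← h2]
      refine integral_congr_ae (.of_forall fun x => ?_)
      simp only [sum_mix_mul, ha, hb, wgrad, hc]
      ring
    · refine (haL.integrable_mul hφ).congr (.of_forall fun x => ?_)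
      simp only [ha]
      ring
    · exact integrable_finsetSum _ fun i _ => h3 i
  set P : E3 → ℂ := fun x => a x * u x + ∑ i, b i x * wgrad M G i x with hP
  have hP1 : Integrable fun x => a x * u x := by
    have h3 := ((memLp_hMeasure_iff hM).1 (Lp.memLp ξ.fst)).star.integrable_mul
      ((memLp_hMeasure_iff hM).1 hu)
    refine h3.congr (.of_forall fun x => ?_)
    have h4 : (((lapse M x)⁻¹ : ℝ) : ℂ) = (((√(lapse M x))⁻¹ : ℝ) : ℂ) * ((√(lapse M x))⁻¹ : ℝ) := by
      rw [← Complex.ofReal_mul, ← mul_inv, Real.mul_self_sqrt (lapse_pos hM x).le]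
    simp only [ha, h4, Pi.mul_apply, Pi.star_apply, RCLike.star_def, map_mul, Complex.conj_ofReal]
    ring
  have hP2 : Integrable fun x => ∑ i, b i x * wgrad M G i x :=
    integrable_finsetSum _ fun i _ => (hb2 i).integrable_mul (hg i)
  have hPi : Integrable P := hP1.add hP2
  obtain ⟨C, hC, hk'⟩ := exists_abs_cutoff'_le
  have hH := hardy hM hw hG hu hE
  set f : E3 → ℂ := fun x => (((logLapse M ‖x‖ * ‖x‖ ^ 2 * √(lapse M x))⁻¹ : ℝ) : ℂ) * u x with hf
  have hrb : MemLp (radPart b) 2 volume := memLp_radPart hb2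
  set d : ℕ → E3 → ℝ := fun N x => cutoff' N (logLapse M ‖x‖) *
      (-(2 * M) / (‖x‖ ^ 2 * lapse M x)) with hd
  set F : ℕ → E3 → ℂ := fun N x => a x * (radCutoff M N x * u x) +
      ∑ i, mix c b i x * (radCutoff M N x * G i x + u x * pd i (radCutoff M N) x) with hF
  have hF0 : ∀ N, ∫ x, F N x = 0 := fun N =>
    integral_eq_zero_of_hasWeakGrad haL hbL h1 hu2 hG hw (radCutoff_mem hM N)
  have hFm : ∀ N, AEStronglyMeasurable (F N) volume := by
    intro N
    have hχ := radCutoff_mem hM N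
    refine Integrable.aestronglyMeasurable (((haL.integrable_mul_mul hu2 hχ).congr
      (.of_forall fun x => by ring)).add (integrable_finsetSum _ fun i _ => ?_))
    refine (((hbL i).integrable_mul_mul (hG i) hχ).add
      ((hbL i).integrable_mul_mul hu2 (pd_mem i hχ))).congr (.of_forall fun x => ?_)
    simp only [Pi.add_apply]
    ring
  have hFe : ∀ N, ∀ x ∈ Om, F N x = radCutoff M N x * P x
      + u x * ((d N x : ℂ) * (c x * radPart b x)) := by
    intro N x hx
    have h5 : ∀ i, mix c b i x * (radCutoff M N x * G i x + u x * pd i (radCutoff M N) x)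
        = radCutoff M N x * (mix c b i x * G i x) + u x * d N x * (rhat x i * mix c b i x) :=
      fun i => by
        rw [pd_radCutoff hM N hx]
        ring
    have h6 : ∑ i, (rhat x i : ℂ) * mix c b i x = c x * radPart b x := radPart_mix hx c b
    simp only [hF, h5, Finset.sum_add_distrib, ← Finset.mul_sum, h6, sum_mix_mul, hP, wgrad, ← hc]
    ring
  -- Since |k_N'| ≤ C/s, the error is at most 2MC |f| |radPart b|, with f square integrable by
  -- `hardy`. It vanishes pointwise for large N because k_N'(s) = 0 eventually.
  have hlim : Tendsto (fun N => ∫ x, F N x) atTop (𝓝 (∫ x, P x)) := by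
    refine tendsto_integral_of_dominated_convergence
      (fun x => ‖P x‖ + 2 * M * C * ‖f x * radPart b x‖) hFm
      (hPi.norm.add ((hH.integrable_mul hrb).norm.const_mul (2 * M * C))) ?_ ?_
    · intro N
      filter_upwards [ae_mem_Om] with x hx
      rw [hFe N x hx]
      have hr := norm_pos_of_mem_Om hx
      have hs := logLapse_pos hM hr
      have hW := lapse_pos hM x
      have hsW : 0 < √(lapse M x) := Real.sqrt_pos.2 hW
      refine (norm_add_le _ _).trans (add_le_add ?_ ?_)
      · rw [norm_mul]
        refine mul_le_of_le_one_left (norm_nonneg _) ?_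
        rw [radCutoff, Complex.norm_real, Real.norm_eq_abs, abs_of_nonneg (cutoff_nonneg _ _)]
        exact cutoff_le_one _ _
      · have h7 : |d N x| * √(lapse M x) ≤
            2 * M * C * (logLapse M ‖x‖ * ‖x‖ ^ 2 * √(lapse M x))⁻¹ := by
          have h9 : |d N x| = |cutoff' N (logLapse M ‖x‖)| * (2 * M / (‖x‖ ^ 2 * lapse M x)) := by
            have h10 : 0 < 2 * M / (‖x‖ ^ 2 * lapse M x) := by positivity
            simp only [hd]
            rw [neg_div, abs_mul, abs_neg, abs_of_pos h10]
          rw [h9]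
          calc |cutoff' N (logLapse M ‖x‖)| * (2 * M / (‖x‖ ^ 2 * lapse M x)) * √(lapse M x)
              ≤ C / logLapse M ‖x‖ * (2 * M / (‖x‖ ^ 2 * lapse M x)) * √(lapse M x) := by
                have := hk' N _ hs
                gcongr
            _ = 2 * M * C * (logLapse M ‖x‖ * ‖x‖ ^ 2 * √(lapse M x))⁻¹ := by
                have h8 : lapse M x = √(lapse M x) * √(lapse M x) := (Real.mul_self_sqrt hW.le).symm
                rw [show 2 * M / (‖x‖ ^ 2 * lapse M x) = 2 * M / (‖x‖ ^ 2 * (√(lapse M x) * √(lapse M x))) by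
                  rw [← h8]]
                field_simp
        simp only [hf, norm_mul, Complex.norm_real, Real.norm_eq_abs]
        rw [abs_of_pos (inv_pos.2 (by positivity :
          0 < logLapse M ‖x‖ * ‖x‖ ^ 2 * √(lapse M x))), hc, abs_of_pos hsW]
        calc ‖u x‖ * (|d N x| * (√(lapse M x) * ‖radPart b x‖))
            = (|d N x| * √(lapse M x)) * (‖u x‖ * ‖radPart b x‖) := by ring
          _ ≤ (2 * M * C * (logLapse M ‖x‖ * ‖x‖ ^ 2 * √(lapse M x))⁻¹) * (‖u x‖ * ‖radPart b x‖) := by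
              gcongr
          _ = _ := by ring
    · filter_upwards [ae_mem_Om] with x hx
      refine tendsto_const_nhds.congr' ?_
      filter_upwards [eventually_cutoff (logLapse_pos hM (norm_pos_of_mem_Om hx))] with N hN
      rw [hFe N x hx]
      simp [radCutoff, hd, hN.1, hN.2]
  simp only [hF0] at hlim
  have hP0 := tendsto_nhds_unique hlim tendsto_const_nhds
  have hbg : ∀ i, Integrable fun x => starRingEnd ℂ (ξ.snd i x) * wgrad M G i x :=
    fun i => (hb2 i).integrable_mul (hg i)
  rw [inner_mkForm_right hM, ← integral_finsetSum _ fun i _ => hbg i,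
    ← integral_add (hP1.congr (.of_forall fun x => by simp only [ha]; ring)) hP2, ← hP0]
  refine integral_congr_ae (.of_forall fun x => ?_)
  simp only [hP, ha, hb]
  ring

/-- Every self-adjoint extension with domain in the energy space is the Friedrichs extension. -/
theorem eq_friedrichs {M : ℝ} (hM : 0 < M) {B : H M →ₗ.[ℂ] H M} (hle : waveOp hM ≤ B)
    (hB : IsSelfAdjoint B) (hdom : (B.domain : Set (H M)) ⊆ energySpace M) :
    B = friedrichs hM := by
  refine eq_of_le_of_isSelfAdjoint hB (isSelfAdjoint_friedrichs hM) ?_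
  -- B is symmetric and agrees with A on test functions, so ⟪Bu, φ⟫ = ⟪u, Aφ⟫. Green's formula,
  -- valid as u has finite energy, makes this the weak equation of the Friedrichs extension.
  have key : ∀ u : B.domain, ∃ hy : (u : H M) ∈ (friedrichs hM).domain,
      friedrichs hM ⟨u, hy⟩ = B u := by
    intro u
    obtain ⟨-, G, hw, hG, he⟩ := hdom u.2
    obtain ⟨hE, hg⟩ := memLp_of_energy_lt_top hM
      (fun i => aestronglyMeasurable_of_locallyIntegrableOn (hw.2 i).1) he
    have hu : MemLp (u : H M) 2 (hMeasure M) := Lp.memLp _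
    have hz := mkForm_mem_formDomain hM hw hG hu hE hg
    have hfst : (mkForm hu hg).fst = (u : H M) := Lp.toLp_coeFn _ hu
    have h1 := friedrichs_apply hM hz (f := B u) fun φ => by
      have h2 := inner_toH_waveTest hM hw hG hu hg φ
      rw [← h2, hfst, Lp.toLp_coeFn]
      congr 1
      have h3 := B.adjoint_isFormalAdjoint hB.dense_domain
      rw [LinearPMap.isSelfAdjoint_def.1 hB] at h3
      have h4 := h3 u ⟨toH hM φ, hle.1 (mem_waveOp_domain hM φ)⟩
      rw [← hle.2 (x := ⟨toH hM φ, mem_waveOp_domain hM φ⟩)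
        (y := ⟨toH hM φ, hle.1 (mem_waveOp_domain hM φ)⟩) rfl, waveOp_apply hM φ _ rfl] at h4
      exact h4
    obtain ⟨hy, h5⟩ := h1
    refine ⟨hfst ▸ hy, ?_⟩
    rw [← h5]
    congr 1
    exact Subtype.ext hfst.symm
  exact ⟨fun u hu => (key ⟨u, hu⟩).1, fun u v huv => by
    rw [← (key u).2]
    congr 1
    exact Subtype.ext huv⟩

theorem friedrichs_domain_subset {M : ℝ} (hM : 0 < M) :
    ((friedrichs hM).domain : Set (H M)) ⊆ energySpace M := by
  intro y hy
  obtain ⟨z, hz, rfl⟩ := exists_of_mem_friedrichs hM hy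
  exact mem_energySpace_of_mem_formDomain hM hz

/-! ### Radial elements of the domain of the adjoint -/

/-- The complex valued radial function `x ↦ κ ‖x‖`. -/
def radFun (κ : ℝ → ℝ) (x : E3) : ℂ := ((κ ‖x‖ : ℝ) : ℂ)

theorem contDiffAt_radFun {κ : ℝ → ℝ} (hκ : ∀ r, 0 < r → ContDiffAt ℝ ∞ κ r) {x : E3}
    (hx : x ∈ Om) : ContDiffAt ℝ ∞ (radFun κ) x :=
  contDiffAt_ofReal ((hκ _ (norm_pos_of_mem_Om hx)).comp x (contDiffAt_norm_Om hx))

theorem memL2loc_radFun {κ : ℝ → ℝ} (hκ : ∀ r, 0 < r → ContDiffAt ℝ ∞ κ r) :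
    MemL2loc (radFun κ) :=
  MemL2loc.of_continuousOn fun _ hx => (contDiffAt_radFun hκ hx).continuousAt.continuousWithinAt

theorem hasDerivAt_of_smooth {κ : ℝ → ℝ} (hκ : ∀ r, 0 < r → ContDiffAt ℝ ∞ κ r) {r : ℝ}
    (hr : 0 < r) : HasDerivAt κ (deriv κ r) r :=
  ((hκ r hr).differentiableAt (by simp)).hasDerivAt

theorem contDiffAt_deriv {κ : ℝ → ℝ} (hκ : ∀ r, 0 < r → ContDiffAt ℝ ∞ κ r) {r : ℝ}
    (hr : 0 < r) : ContDiffAt ℝ ∞ (deriv κ) r :=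
  (hκ r hr).derivWithin (by simp)

/-- κ may be singular at r = 0, but test functions vanish near the origin: κη is itself a test
function, and its partial derivatives integrate to zero. -/
theorem hasWeakGrad_radFun {κ : ℝ → ℝ} (hκ : ∀ r, 0 < r → ContDiffAt ℝ ∞ κ r) :
    HasWeakGrad (radFun κ) (fun i x => radFun (deriv κ) x * rhat x i) ∧
      ∀ i : Fin 3, MemL2loc fun x => radFun (deriv κ) x * rhat x i := by
  have hG : ∀ i : Fin 3, MemL2loc fun x => radFun (deriv κ) x * rhat x i := fun i =>
    MemL2loc.of_continuousOn fun x hx =>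
      ((contDiffAt_radFun (fun r hr => contDiffAt_deriv hκ hr) hx).mul
        (contDiffAt_rhat_coord i hx)).continuousAt.continuousWithinAt
  refine ⟨⟨(memL2loc_radFun hκ).locallyIntegrableOn, fun i => ⟨(hG i).locallyIntegrableOn,
    fun η hη => ?_⟩⟩, hG⟩
  have h1 := integral_pd_eq_zero i (smooth_mul_mem hη fun x hx => contDiffAt_radFun hκ hx)
  have h2 : ∀ᵐ x : E3, pd i (fun x => radFun κ x * η x) x
      = radFun κ x * pd i η x + (radFun (deriv κ) x * rhat x i) * η x := by
    filter_upwards [ae_mem_Om] with x hx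
    rw [pd_mul i ((contDiffAt_radFun hκ hx).differentiableAt (by simp))
      (differentiable_of_mem hη x)]
    have : pd i (radFun κ) x = radFun (deriv κ) x * rhat x i :=
      pd_radial hx (hasDerivAt_of_smooth hκ (norm_pos_of_mem_Om hx)) i
    rw [this]
    ring
  rw [integral_congr_ae h2, integral_add ((memL2loc_radFun hκ).integrable_mul (pd_mem i hη))
    ((hG i).integrable_mul hη)] at h1
  exact eq_neg_of_add_eq_zero_left h1

/-- `A` applied to a radial function with flux `p`. -/
def fluxFun (M : ℝ) (p : ℝ → ℝ) (x : E3) : ℂ :=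
  ((-(lapse M x * ((‖x‖ ^ 2)⁻¹ * deriv p ‖x‖)) : ℝ) : ℂ)

/-- The field r⁻² p φ θ has compact support in Ω and divergence r⁻²(p'φ + p ∂_rφ). Its integral
vanishes, which moves the second derivative from φ to κ. No finite energy of κ is needed, so the
logarithm is allowed. -/
theorem integral_radFun_mul_waveExpr {M : ℝ} (hM : 0 < M) {κ p : ℝ → ℝ}
    (hκ : ∀ r, 0 < r → ContDiffAt ℝ ∞ κ r) (hp : ∀ r, 0 < r → ContDiffAt ℝ ∞ p r)
    (hpκ : ∀ r, 0 < r → p r = r ^ 2 * (1 + 2 * M / r) * deriv κ r) {φ : E3 → ℂ}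
    (hφ : φ ∈ testFun) :
    ∫ x, starRingEnd ℂ (radFun κ x) * waveExpr M φ x ∂(hMeasure M)
      = ∫ x, ((lapse M x)⁻¹ : ℝ) * (starRingEnd ℂ (fluxFun M p x) * φ x) := by
  obtain ⟨hw, hG⟩ := hasWeakGrad_radFun hκ
  rw [integral_conj_mul_waveExpr hM (memL2loc_radFun hκ) hw hG hφ]
  have hF : (fun x => radFun p x * φ x) ∈ testFun :=
    smooth_mul_mem hφ fun x hx => contDiffAt_radFun hp hx
  have hm : ∀ i : Fin 3, (fun y => (rhat y i : ℂ) * (((‖y‖ ^ 2)⁻¹ : ℝ) * (radFun p y * φ y)))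
      ∈ testFun := fun i => smooth_mul_mem (mul_mem_testFun hF (c := fun y => (‖y‖ ^ 2)⁻¹)
        fun x hx => ((contDiffAt_norm_Om hx).pow 2).inv
          (pow_ne_zero 2 (norm_ne_zero_iff.2 hx))) fun x hx => contDiffAt_rhat_coord i hx
  have h1 : ∫ x, ∑ i, pd i (fun y => (rhat y i : ℂ) * (((‖y‖ ^ 2)⁻¹ : ℝ) * (radFun p y * φ y))) x
      = 0 := by
    rw [integral_finsetSum _ fun i _ => testFun_integrable (pd_mem i (hm i))]
    exact Finset.sum_eq_zero fun i _ => integral_pd_eq_zero i (hm i)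
  have hint : Integrable fun x => ((lapse M x)⁻¹ : ℝ) * (starRingEnd ℂ (fluxFun M p x) * φ x) := by
    have hc : ∀ x ∈ Om, ContDiffAt ℝ ∞
        (fun x : E3 => (-(‖x‖ ^ 2)⁻¹ * deriv p ‖x‖)) x := fun x hx =>
      (((contDiffAt_norm_Om hx).pow 2).inv (pow_ne_zero 2 (norm_ne_zero_iff.2 hx))).neg.mul
        ((contDiffAt_deriv hp (norm_pos_of_mem_Om hx)).comp x (contDiffAt_norm_Om hx))
    refine (testFun_integrable (mul_mem_testFun hφ hc)).congr (.of_forall fun x => ?_)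
    have : (lapse M x : ℂ) ≠ 0 := by exact_mod_cast (lapse_pos hM x).ne'
    simp only [fluxFun, Complex.conj_ofReal]
    push_cast
    field_simp
  rw [← sub_eq_zero, ← integral_sub _ hint, ← h1]
  · refine integral_congr_ae ?_
    filter_upwards [ae_mem_Om] with x hx
    have hr := norm_pos_of_mem_Om hx
    have hw0 : (lapse M x : ℂ) ≠ 0 := by exact_mod_cast (lapse_pos hM x).ne'
    have hr0 : (‖x‖ : ℂ) ≠ 0 := by exact_mod_cast hr.ne'
    rw [sum_pd_rhat_mul hx (differentiable_of_mem hF x),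
      dRad_mul ((contDiffAt_radFun hp hx).differentiableAt (by simp)) (differentiable_of_mem hφ x)]
    have h2 : dRad (radFun p) x = deriv p ‖x‖ := dRad_radial hx (hasDerivAt_of_smooth hp hr)
    have h3 : radFun p x = ‖x‖ ^ 2 * lapse M x * radFun (deriv κ) x := by
      simp only [radFun, hpκ _ hr, lapse]
      push_cast
      ring
    have h4 : ∀ i, starRingEnd ℂ (radFun (deriv κ) x * rhat x i)
        * mix (lapse M) (fun j => pd j φ) i x
        = radFun (deriv κ) x * (rhat x i * mix (lapse M) (fun j => pd j φ) i x) := fun i => by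
      simp only [radFun, map_mul, Complex.conj_ofReal]
      ring
    have h5 : ∑ i, (rhat x i : ℂ) * mix (lapse M) (fun j => pd j φ) i x = lapse M x * dRad φ x := by
      rw [dRad_eq]
      exact radPart_mix hx _ _
    simp only [h4, ← Finset.mul_sum, h5, h2, h3, fluxFun, Complex.conj_ofReal]
    push_cast
    field_simp
    ring
  · exact integrable_finsetSum _ fun i _ => (hG i).conj.integrable_mul
      (mix_grad_mem (fun x hx => contDiffAt_lapse M hx) hφ i)

theorem fluxFun_mem {M : ℝ} {p : ℝ → ℝ} (hp : ∀ r, 0 < r → ContDiffAt ℝ ∞ p r) {a b : ℝ}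
    (ha : 0 < a) (h0 : ∀ r, 0 ≤ r → r < a ∨ b < r → deriv p r = 0) :
    fluxFun M p ∈ testFun := by
  refine mem_testFun_of_compact (fun x hx => contDiffAt_ofReal ?_) (isCompact_annulus a b)
    (annulus_subset ha) fun x hx => ?_
  · exact ((contDiffAt_lapse M hx).mul ((((contDiffAt_norm_Om hx).pow 2).inv
      (pow_ne_zero 2 (norm_ne_zero_iff.2 hx))).mul
        ((contDiffAt_deriv hp (norm_pos_of_mem_Om hx)).comp x (contDiffAt_norm_Om hx)))).neg
  · have h1 : deriv p ‖x‖ = 0 := h0 _ (norm_nonneg x) (by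
      by_contra h
      push Not at h
      exact hx h)
    simp [fluxFun, h1]

/-- A radial function in H whose flux is constant near the origin and vanishes far out is in the
domain of the adjoint, with image `fluxFun M p`. -/
theorem inner_toLp_radFun {M : ℝ} (hM : 0 < M) {κ p : ℝ → ℝ}
    (hκ : ∀ r, 0 < r → ContDiffAt ℝ ∞ κ r) (hp : ∀ r, 0 < r → ContDiffAt ℝ ∞ p r)
    (hpκ : ∀ r, 0 < r → p r = r ^ 2 * (1 + 2 * M / r) * deriv κ r)
    (hu : MemLp (radFun κ) 2 (hMeasure M)) (hf : fluxFun M p ∈ testFun)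
    (y : (waveOp hM).domain) :
    ⟪toH hM ⟨_, hf⟩, (y : H M)⟫_ℂ = ⟪hu.toLp _, waveOp hM y⟫_ℂ := by
  obtain ⟨_, φ, rfl⟩ := y
  rw [waveOp_apply hM φ _ rfl]
  have h1 := inner_H_eq hM hu.coeFn_toLp (testFun_memLp hM (waveTest M φ)).coeFn_toLp
  have h2 := inner_H_eq hM (testFun_memLp hM ⟨_, hf⟩).coeFn_toLp (testFun_memLp hM φ).coeFn_toLp
  refine h2.trans (Eq.trans ?_ h1.symm)
  rw [← integral_hMeasure hM (fun x => starRingEnd ℂ (radFun κ x) * (waveTest M φ : E3 → ℂ) x)]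
  exact (integral_radFun_mul_waveExpr hM hκ hp hpκ φ.2).symm

/-! ### Failure of essential self-adjointness -/

/-- A smooth function equal to `1` on `(-∞, a - 1]` and to `0` on `[a, ∞)`. -/
def stepDown (a r : ℝ) : ℝ := Real.smoothTransition (a - r)

/-- Minus the derivative of `stepDown a`. -/
def bump (a r : ℝ) : ℝ := deriv Real.smoothTransition (a - r)

theorem hasDerivAt_stepDown (a r : ℝ) : HasDerivAt (stepDown a) (-bump a r) r := by
  have h1 : HasDerivAt (fun r : ℝ => a - r) (-1) r := by
    simpa using (hasDerivAt_id r).const_sub a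
  refine ((hasDerivAt_smoothTransition _).comp r h1).congr_deriv ?_
  simp [bump]

theorem contDiff_stepDown (a : ℝ) : ContDiff ℝ ∞ (stepDown a) :=
  Real.smoothTransition.contDiff.comp (by fun_prop)

theorem contDiff_bump (a : ℝ) : ContDiff ℝ ∞ (bump a) := by
  have h : ContDiff ℝ ∞ (deriv Real.smoothTransition) := contDiff_iff_contDiffAt.2 fun x =>
    (Real.smoothTransition.contDiffAt (n := ⊤)).derivWithin (by simp)
  exact h.comp (by fun_prop)

theorem bump_eq_zero {a r : ℝ} (h : r ≤ a - 1 ∨ a ≤ r) : bump a r = 0 :=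
  deriv_smoothTransition_eq_zero (by rcases h with h | h <;> [right; left] <;> linarith)

theorem stepDown_eq_one {a r : ℝ} (h : r ≤ a - 1) : stepDown a r = 1 :=
  Real.smoothTransition.one_of_one_le (by linarith)

theorem stepDown_eq_zero {a r : ℝ} (h : a ≤ r) : stepDown a r = 0 :=
  Real.smoothTransition.zero_of_nonpos (by linarith)

theorem contDiffAt_logLapse {M : ℝ} (hM : 0 < M) {r : ℝ} (hr : 0 < r) :
    ContDiffAt ℝ ∞ (logLapse M) r :=
  (contDiffAt_const.add (contDiffAt_const.div contDiffAt_id hr.ne')).log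
    (zero_lt_one.trans (one_lt_lapse hM hr)).ne'

/-- The flux of `stepDown 2`. -/
def fluxStep (M r : ℝ) : ℝ := -((r ^ 2 + 2 * M * r) * bump 2 r)

/-- The flux of the cut off logarithm. -/
def fluxLog (M r : ℝ) : ℝ :=
  -(2 * M * stepDown 3 r) - (r ^ 2 + 2 * M * r) * (logLapse M r * bump 3 r)

theorem contDiff_fluxStep (M : ℝ) : ContDiff ℝ ∞ (fluxStep M) := by
  have := contDiff_bump 2
  unfold fluxStep
  fun_prop

theorem contDiffAt_fluxLog {M : ℝ} (hM : 0 < M) {r : ℝ} (hr : 0 < r) :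
    ContDiffAt ℝ ∞ (fluxLog M) r := by
  have h1 := (contDiff_bump 3).contDiffAt (x := r)
  have h2 := (contDiff_stepDown 3).contDiffAt (x := r)
  have h3 := contDiffAt_logLapse hM hr
  unfold fluxLog
  fun_prop

theorem fluxStep_eq {M r : ℝ} (hr : 0 < r) :
    fluxStep M r = r ^ 2 * (1 + 2 * M / r) * deriv (stepDown 2) r := by
  rw [(hasDerivAt_stepDown 2 r).deriv, fluxStep]
  field_simp

/-- The cut off logarithm. -/
def cutLog (M r : ℝ) : ℝ := logLapse M r * stepDown 3 r

theorem contDiffAt_cutLog {M : ℝ} (hM : 0 < M) {r : ℝ} (hr : 0 < r) :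
    ContDiffAt ℝ ∞ (cutLog M) r :=
  (contDiffAt_logLapse hM hr).mul (contDiff_stepDown 3).contDiffAt

theorem fluxLog_eq {M r : ℝ} (hM : 0 < M) (hr : 0 < r) :
    fluxLog M r = r ^ 2 * (1 + 2 * M / r) * deriv (cutLog M) r := by
  have h := (hasDerivAt_logLapse hM hr).mul (hasDerivAt_stepDown 3 r)
  have h1 : deriv (cutLog M) r = _ := h.deriv
  have h2 : r ^ 2 + 2 * M * r = r ^ 2 * (1 + 2 * M / r) := by field_simp
  have h3 := (zero_lt_one.trans (one_lt_lapse hM hr)).ne'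
  rw [h1, fluxLog, h2]
  generalize 1 + 2 * M / r = W at *
  field_simp
  ring

theorem deriv_fluxStep_eq_zero {M r : ℝ} (h : r < 1 ∨ 2 < r) : deriv (fluxStep M) r = 0 := by
  have h1 : fluxStep M =ᶠ[𝓝 r] fun _ => 0 := by
    rcases h with h | h
    · filter_upwards [Iio_mem_nhds h] with y hy
      rw [fluxStep, bump_eq_zero (Or.inl (by norm_num; exact le_of_lt hy))]
      ring
    · filter_upwards [Ioi_mem_nhds h] with y hy
      rw [fluxStep, bump_eq_zero (Or.inr (le_of_lt hy))]
      ring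
  rw [h1.deriv_eq, deriv_const]

/-- Below radius 2 the cutoff is inactive and the flux r²W ∂_r s is the constant -2M; above 3
everything vanishes. -/
theorem deriv_fluxLog_eq_zero {M r : ℝ} (h : r < 2 ∨ 3 < r) : deriv (fluxLog M) r = 0 := by
  rcases h with h | h
  · have h1 : fluxLog M =ᶠ[𝓝 r] fun _ => -(2 * M) := by
      filter_upwards [Iio_mem_nhds h] with y hy
      have hy' : y ≤ 3 - 1 := by norm_num; exact le_of_lt hy
      rw [fluxLog, bump_eq_zero (Or.inl hy'), stepDown_eq_one hy']
      ring
    rw [h1.deriv_eq, deriv_const]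
  · have h1 : fluxLog M =ᶠ[𝓝 r] fun _ => 0 := by
      filter_upwards [Ioi_mem_nhds h] with y hy
      rw [fluxLog, bump_eq_zero (Or.inr (le_of_lt hy)), stepDown_eq_zero (le_of_lt hy)]
      ring
    rw [h1.deriv_eq, deriv_const]

theorem memLp_stepDown (a : ℝ) : MemLp (radFun (stepDown a)) 2 volume := by
  have hc : Continuous (radFun (stepDown a)) :=
    Complex.continuous_ofReal.comp ((contDiff_stepDown a).continuous.comp continuous_norm)
  refine hc.memLp_of_hasCompactSupport (HasCompactSupport.intro (isCompact_closedBall 0 a)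
    fun x hx => ?_)
  rw [mem_closedBall_zero_iff, not_le] at hx
  simp [radFun, stepDown_eq_zero hx.le]

theorem memLp_cutLog {M : ℝ} (hM : 0 < M) : MemLp (radFun (cutLog M)) 2 (hMeasure M) := by
  rw [memLp_hMeasure_iff hM]
  have hlm : Measurable fun x : E3 => logLapse M ‖x‖ := (measurable_lapse M).log
  refine MemLp.of_le_mul (c := 2) (memLp_stepDown 3) (Measurable.aestronglyMeasurable ?_)
    (.of_forall fun x => ?_)
  · exact (Complex.measurable_ofReal.comp (measurable_lapse M).sqrt.inv).mul
      (Complex.measurable_ofReal.comp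
        (hlm.mul ((contDiff_stepDown 3).continuous.measurable.comp measurable_norm)))
  · have h1 := lapse_ge_one hM x
    have h2 : logLapse M ‖x‖ = Real.log (lapse M x) := rfl
    have h3 : 0 ≤ Real.log (lapse M x) := Real.log_nonneg h1
    have h4 : 0 < √(lapse M x) := Real.sqrt_pos.2 (lapse_pos hM x)
    -- From log √W ≤ √W: the factor W^(-1/2) coming from the weight of H compensates the logarithm.
    have h5 : Real.log (lapse M x) ≤ 2 * √(lapse M x) := by
      have h6 := Real.log_le_self h4.le
      rw [Real.log_sqrt (lapse_pos hM x).le] at h6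
      linarith
    simp only [radFun, cutLog, norm_mul, Complex.norm_real, Real.norm_eq_abs, h2]
    rw [abs_of_pos (inv_pos.2 h4), abs_of_nonneg h3, ← mul_assoc]
    gcongr
    rw [inv_mul_le_iff₀ h4]
    linarith

/-- The Wronskian of s and 1. With p the flux of `stepDown 2`, s'p = -2M (`stepDown 2`)', so s p' is
the derivative of s p + 2M `stepDown 2`. At both ends of [1, 2] p vanishes, while `stepDown 2` drops
from 1 to 0. -/
theorem integral_cutLog_mul_deriv_fluxStep {M : ℝ} (hM : 0 < M) :
    ∫ r in Ioi (0 : ℝ), cutLog M r * deriv (fluxStep M) r = -(2 * M) := by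
  have h1 : ∀ r, 1 ≤ r ∧ r ≤ 2 ∨ cutLog M r * deriv (fluxStep M) r = 0 := by
    intro r
    by_contra! h
    have := h.2
    rw [deriv_fluxStep_eq_zero] at this
    · simp at this
    · by_contra! h'
      exact absurd (h.1 h'.1) (not_lt.2 h'.2)
  have hpos : ∀ r ∈ Icc (1 : ℝ) 2, 0 < r := fun r hr => zero_lt_one.trans_le hr.1
  have h2 : ∫ r in Ioi (0 : ℝ), cutLog M r * deriv (fluxStep M) r
      = ∫ r in Icc (1 : ℝ) 2, cutLog M r * deriv (fluxStep M) r := by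
    refine setIntegral_eq_of_subset_of_forall_sdiff_eq_zero measurableSet_Ioi
      (fun r hr => hpos r hr) fun r hr => ?_
    exact (h1 r).resolve_left fun h => hr.2 h
  have h3 : ∀ r ∈ uIcc (1 : ℝ) 2, HasDerivAt
      (fun r => logLapse M r * fluxStep M r + 2 * M * stepDown 2 r)
      (cutLog M r * deriv (fluxStep M) r) r := by
    intro r hr
    rw [uIcc_of_le (by norm_num)] at hr
    have hr0 := hpos r hr
    have hd := ((hasDerivAt_logLapse hM hr0).mul
      (((contDiff_fluxStep M).differentiable (by simp) r).hasDerivAt)).add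
      ((hasDerivAt_stepDown 2 r).const_mul (2 * M))
    refine hd.congr_deriv ?_
    have h5 : cutLog M r = logLapse M r := by
      rw [cutLog, stepDown_eq_one (by linarith [hr.2]), mul_one]
    have h4 : r ^ 2 + 2 * M * r = r ^ 2 * (1 + 2 * M / r) := by field_simp
    have h6 := (zero_lt_one.trans (one_lt_lapse hM hr0)).ne'
    rw [h5]
    simp only [fluxStep, h4]
    generalize 1 + 2 * M / r = W at *
    field_simp
    ring
  have hc : ContinuousOn (fun r => cutLog M r * deriv (fluxStep M) r) (uIcc 1 2) := by
    intro r hr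
    rw [uIcc_of_le (by norm_num)] at hr
    exact ((contDiffAt_cutLog hM (hpos r hr)).continuousAt.mul
      ((contDiff_fluxStep M).continuous_deriv (by simp)).continuousAt).continuousWithinAt
  rw [h2, integral_Icc_eq_integral_Ioc, ← intervalIntegral.integral_of_le (by norm_num),
    intervalIntegral.integral_eq_sub_of_hasDerivAt h3 hc.intervalIntegrable]
  rw [fluxStep, fluxStep, bump_eq_zero (Or.inr le_rfl), bump_eq_zero (Or.inl (by norm_num)),
    stepDown_eq_zero le_rfl, stepDown_eq_one (by norm_num)]
  ring

/-- Cut-off versions of s and 1 lie in the domain of the adjoint with nonzero boundary form. The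
cutoff radii 3 and 2 differ so that one of its two terms vanishes identically and the other sees s
uncut. -/
theorem not_essentiallySelfAdjoint {M : ℝ} (hM : 0 < M) :
    ¬ EssentiallySelfAdjoint (waveOp hM) := by
  intro h
  have hs1 : ∀ r, 0 < r → ContDiffAt ℝ ∞ (cutLog M) r := fun r hr => contDiffAt_cutLog hM hr
  have hs2 : ∀ r, 0 < r → ContDiffAt ℝ ∞ (stepDown 2) r := fun r _ =>
    (contDiff_stepDown 2).contDiffAt
  have hp1 : ∀ r, 0 < r → ContDiffAt ℝ ∞ (fluxLog M) r := fun r hr => contDiffAt_fluxLog hM hr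
  have hp2 : ∀ r, 0 < r → ContDiffAt ℝ ∞ (fluxStep M) r := fun r _ =>
    (contDiff_fluxStep M).contDiffAt
  have hf1 : fluxFun M (fluxLog M) ∈ testFun :=
    fluxFun_mem (a := 2) (b := 3) hp1 (by norm_num) fun r _ hr => deriv_fluxLog_eq_zero hr
  have hf2 : fluxFun M (fluxStep M) ∈ testFun :=
    fluxFun_mem (a := 1) (b := 2) hp2 (by norm_num) fun r _ hr => deriv_fluxStep_eq_zero hr
  have hu2 : MemLp (radFun (stepDown 2)) 2 (hMeasure M) :=
    (memLp_stepDown 2).mono_measure (hMeasure_le hM)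
  have key := inner_eq_of_isSelfAdjoint_closure h
    (inner_toLp_radFun hM hs1 hp1 (fun r hr => fluxLog_eq hM hr) (memLp_cutLog hM) hf1)
    (inner_toLp_radFun hM hs2 hp2 (fun r hr => fluxStep_eq hr) hu2 hf2)
  have e1 := inner_H_eq hM (testFun_memLp hM ⟨_, hf1⟩).coeFn_toLp hu2.coeFn_toLp
  have e2 := inner_H_eq hM (memLp_cutLog hM).coeFn_toLp (testFun_memLp hM ⟨_, hf2⟩).coeFn_toLp
  have key2 := e1.symm.trans (key.trans e2)
  -- The image of the cut-off logarithm lives on 2 ≤ r ≤ 3, where `stepDown 2` is zero.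
  have z1 : ∫ x, (((lapse M x)⁻¹ : ℝ) : ℂ) *
      (starRingEnd ℂ (fluxFun M (fluxLog M) x) * radFun (stepDown 2) x) = 0 := by
    refine integral_eq_zero_of_ae (.of_forall fun x => ?_)
    rcases lt_or_ge ‖x‖ 2 with hx | hx
    · simp [fluxFun, deriv_fluxLog_eq_zero (M := M) (Or.inl hx)]
    · simp [radFun, stepDown_eq_zero hx]
  have z2 : ∫ x, (((lapse M x)⁻¹ : ℝ) : ℂ) *
      (starRingEnd ℂ (radFun (cutLog M) x) * fluxFun M (fluxStep M) x)
      = ((∫ x : E3, -((‖x‖ ^ 2)⁻¹ * (cutLog M ‖x‖ * deriv (fluxStep M) ‖x‖)) : ℝ) : ℂ) := by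
    rw [← integral_complex_ofReal]
    refine integral_congr_ae (.of_forall fun x => ?_)
    have : (lapse M x : ℂ) ≠ 0 := by exact_mod_cast (lapse_pos hM x).ne'
    simp only [radFun, fluxFun, Complex.conj_ofReal]
    push_cast
    field_simp
  have z3 : (∫ x : E3, -((‖x‖ ^ 2)⁻¹ * (cutLog M ‖x‖ * deriv (fluxStep M) ‖x‖))) = 0 := by
    have h4 := (z1.symm.trans key2).trans z2
    exact_mod_cast h4.symm
  -- Polar coordinates: the integral is 3 times the volume of the unit ball times a radial integral
  -- in which r² cancels, leaving 2M.
  rw [integral_fun_norm_addHaar volume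
    (fun r => -((r ^ 2)⁻¹ * (cutLog M r * deriv (fluxStep M) r)))] at z3
  have h5 : ∫ r in Ioi (0 : ℝ), r ^ (Module.finrank ℝ E3 - 1) •
      -((r ^ 2)⁻¹ * (cutLog M r * deriv (fluxStep M) r)) = 2 * M := by
    rw [← neg_neg (2 * M), ← integral_cutLog_mul_deriv_fluxStep hM, ← integral_neg]
    refine setIntegral_congr_fun measurableSet_Ioi fun r hr => ?_
    have hr0 : r ≠ 0 := (mem_Ioi.1 hr).ne'
    simp only [finrank_euclideanSpace, Fintype.card_fin, smul_eq_mul]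
    norm_num
    field_simp
  rw [h5] at z3
  have h6 : 0 < (volume : Measure E3).real (Metric.ball 0 1) :=
    ENNReal.toReal_pos (Metric.measure_ball_pos volume 0 one_pos).ne' measure_ball_lt_top.ne
  simp [h6.ne', hM.ne'] at z3

end NegSchwarzschild

end

theorem mainTheorem9 (M : ℝ) (hM : 0 < M) :
    ¬ NegSchwarzschild.EssentiallySelfAdjoint (NegSchwarzschild.waveOp hM) ∧
    ∃! B : NegSchwarzschild.H M →ₗ.[ℂ] NegSchwarzschild.H M,
      NegSchwarzschild.waveOp hM ≤ B ∧ IsSelfAdjoint B ∧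
      (B.domain : Set (NegSchwarzschild.H M)) ⊆ NegSchwarzschild.energySpace M :=
  ⟨NegSchwarzschild.not_essentiallySelfAdjoint hM, NegSchwarzschild.friedrichs hM,
    ⟨NegSchwarzschild.waveOp_le_friedrichs hM, NegSchwarzschild.isSelfAdjoint_friedrichs hM,
      NegSchwarzschild.friedrichs_domain_subset hM⟩,
    fun _ h => NegSchwarzschild.eq_friedrichs hM h.1 h.2.1 h.2.2⟩
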